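/- **Theorem (invariance of $\mathcal J$).** *Diagrams.* A tied link is a non-empty link together with ties, which connect pairs of its points; the ties define a partition of the set of components (two components belong to the same set if they are connected by a chain of ties). Ties have no other topological meaning: arcs and other ties may cross them. Tied link diagrams are considered in $S^2$. Two tied link diagrams are *regularly tie-isotopic* if they are related by a finite sequence of isotopies of $S^2$, Reidemeister moves II and III, and changes of the ties that keep the partition of the set of components; they are *tie-isotopic* if the Reidemeister move I is also allowed. Tie-isotopies of oriented diagrams respect the orientations. *The bracket.* Let $A$ and $c$ be independent commuting variables. For unoriented diagrams that agree outside a disc, let $D_+$ and $D_-$ be the two that have one crossing and no tie in the disc, where $D_+$ is the one with upper strand from the lower left to the upper right. Let $D_e$ be the diagram with two vertical strands in the disc joined by a tie, and $D_f$ the one with a lower and an upper arc in the disc joined by a tie. Let $D_{+,\sim}$ be $D_+$ with a tie added between the two strands of the crossing. Write $\bigcirc$ for the circle without crossings, $D\sqcup\bigcirc$ for the disjoint union without a tie between $D$ and $\bigcirc$, and $D\,\widetilde\sqcup\,\bigcirc$ for the disjoint union with a tie between $\bigcirc$ and a component of $D$. A function $$\langle\langle\ \ \rangle\rangle:\{\text{unoriented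 tied link diagrams}\}\to\mathbb Z[A^{\pm1},c]$$ is a *tied bracket* if 1. $\langle\langle\bigcirc\rangle\rangle=1$; 2. $\langle\langle D\sqcup\bigcirc\rangle\rangle=c\,\langle\langle D\rangle\rangle$; 3. $\langle\langle D\,\widetilde\sqcup\,\bigcirc\rangle\rangle=-(A^2+A^{-2})\,\langle\langle D\rangle\rangle$; 4. $\langle\langle\ \ \rangle\rangle$ is invariant under regular tie-isotopy; 5. $\langle\langle D_{+,\sim}\rangle\rangle=A\,\langle\langle D_e\rangle\rangle+A^{-1}\langle\langle D_f\rangle\rangle$; 6. $\langle\langle D_+\rangle\rangle+\langle\langle D_-\rangle\rangle=(A+A^{-1})\big(\langle\langle D_e\rangle\rangle+\langle\langle D_f\rangle\rangle\big)$. *Claim.* A tied bracket exists. For every tied bracket, the polynomial $$\mathcal J(\overrightarrow D)=(-A)^{-3w(D)}\langle\langle D\rangle\rangle$$ of an oriented tied link diagram $\overrightarrow D$, where $D$ is the underlying unoriented diagram and $w(D)$ is the writhe of $\overrightarrow D$ (the sum of the signs of the crossings), is a tie-isotopy invariant of oriented tied links: if $\overrightarrow D$ and $\overrightarrow D'$ are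 tie-isotopic, then $\mathcal J(\overrightarrow D)=\mathcal J(\overrightarrow D')$. -/

import Mathlib

/-!
Link diagrams are written as words: a diagram in general position in the plane is cut by horizontal
lines into slices, read from bottom to top, each of which holds one elementary piece (a local
minimum, a local maximum or a crossing) next to vertical strands. The strands that meet a
horizontal line are numbered `0, 1, 2, …` from the left.
-/

namespace TiedLink

/-- Labels of strands and their reversal: `Unit` for unoriented diagrams, `Bool` for oriented ones
(`true` is a strand directed upwards, `false` a strand directed downwards). -/
class StrandLabel (α : Type) where
  rev : α → α

instance : StrandLabel Unit := ⟨id⟩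

instance : StrandLabel Bool := ⟨not⟩

/-- The elementary pieces of a link diagram. `cup d` is a local minimum, whose left leg is labelled
`d` (and whose right leg is labelled `rev d`); `cap` is a local maximum; in `cross true` the strand
from the lower left to the upper right is the upper one, in `cross false` it is the lower one. -/
inductive Piece (α : Type) : Type
  | cup (d : α) : Piece α
  | cap : Piece α
  | cross (o : Bool) : Piece α

/-- The number of strands that enter a piece from below. -/
def Piece.ins {α : Type} : Piece α → ℕ
  | .cup _ => 0
  | .cap => 2
  | .cross _ => 2

/-- The number of strands that leave a piece at the top. -/
def Piece.outs {α : Type} : Piece α → ℕ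
  | .cup _ => 2
  | .cap => 0
  | .cross _ => 2

/-- A letter of a tied diagram: either a piece with its leftmost end in position `i`, or an end,
on the strand in position `i`, of the tie with name `t`. All points of the diagram that carry an
end of the tie `t` are tied together, at whatever heights they lie. -/
inductive Letter (α : Type) : Type
  | piece (P : Piece α) (i : ℕ) : Letter α
  | foot (t : ℕ) (i : ℕ) : Letter α

abbrev Word (α : Type) : Type := List (Letter α)

abbrev cup {α : Type} (i : ℕ) (d : α) : Letter α := .piece (.cup d) i

abbrev cap {α : Type} (i : ℕ) : Letter α := .piece .cap i

abbrev cross {α : Type} (i : ℕ) (o : Bool) : Letter α := .piece (.cross o) i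

abbrev foot {α : Type} (t i : ℕ) : Letter α := .foot t i

section Diagrams

variable {α : Type} [StrandLabel α] [DecidableEq α]

/-- The labels of the strands above a letter, from the labels of the strands below it; `none` if the
letter does not fit. -/
def Letter.act : Letter α → List α → Option (List α)
  | .piece (.cup d) i, l =>
      if i ≤ l.length then some (l.take i ++ d :: StrandLabel.rev d :: l.drop i) else none
  | .piece .cap i, l =>
      match l.drop i with
      | a :: b :: r => if b = StrandLabel.rev a then some (l.take i ++ r) else none
      | _ => none
  | .piece (.cross _) i, l =>
      match l.drop i with
      | a :: b :: r => some (l.take i ++ b :: a :: r)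
      | _ => none
  | .foot _ i, l => if i < l.length then some l else none

/-- The labels of the strands above a word, from the labels of the strands below it. -/
def Word.run : Word α → List α → Option (List α)
  | [], l => some l
  | L :: w, l => (L.act l).bind (Word.run w)

end Diagrams

/-- A tied link diagram: a word without open ends. As the empty link is excluded, the word is not
empty. -/
structure Diagram (α : Type) [StrandLabel α] [DecidableEq α] : Type where
  word : Word α
  closed : Word.run word [] = some []
  nonempty : word ≠ []

abbrev UnorientedDiagram : Type := Diagram Unit

abbrev OrientedDiagram : Type := Diagram Bool

section Ties

variable {α : Type}

/-- A point `(k, j)` of a diagram is the `j`-th strand at height `k`, that is, between the `k`-th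
and the next piece. `Adjacent k w p q` says that the points `p` and `q`, on the boundary of one
slice of `w`, are the ends of one arc of this slice; the bottom of `w` has height `k`. -/
inductive Adjacent : ℕ → Word α → ℕ × ℕ → ℕ × ℕ → Prop
  | left (k : ℕ) (P : Piece α) (i : ℕ) (w : Word α) (j : ℕ) (h : j < i) :
      Adjacent k (.piece P i :: w) (k, j) (k + 1, j)
  | right (k : ℕ) (P : Piece α) (i : ℕ) (w : Word α) (j : ℕ) (h : i ≤ j) :
      Adjacent k (.piece P i :: w) (k, j + P.ins) (k + 1, j + P.outs)
  | cup (k : ℕ) (d : α) (i : ℕ) (w : Word α) :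
      Adjacent k (cup i d :: w) (k + 1, i) (k + 1, i + 1)
  | cap (k : ℕ) (i : ℕ) (w : Word α) :
      Adjacent k (cap i :: w) (k, i) (k, i + 1)
  | crossLeft (k : ℕ) (o : Bool) (i : ℕ) (w : Word α) :
      Adjacent k (cross i o :: w) (k, i) (k + 1, i + 1)
  | crossRight (k : ℕ) (o : Bool) (i : ℕ) (w : Word α) :
      Adjacent k (cross i o :: w) (k, i + 1) (k + 1, i)
  | afterPiece (k : ℕ) (P : Piece α) (i : ℕ) (w : Word α) (p q : ℕ × ℕ)
      (h : Adjacent (k + 1) w p q) : Adjacent k (.piece P i :: w) p q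
  | afterFoot (k : ℕ) (t i : ℕ) (w : Word α) (p q : ℕ × ℕ)
      (h : Adjacent k w p q) : Adjacent k (foot t i :: w) p q

/-- The list of all ends of ties, each with the name of its tie and the point where it lies. -/
def Word.feet : ℕ → Word α → List (ℕ × (ℕ × ℕ))
  | _, [] => []
  | k, .piece _ _ :: w => Word.feet (k + 1) w
  | k, .foot t i :: w => (t, (k, i)) :: Word.feet k w

/-- The equivalence relation on the points of a diagram whose classes are the sets of the partition
of the components: generated by running along the components and along the ties. -/
def Word.tiePartition (w : Word α) : Setoid (ℕ × ℕ) :=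
  Relation.EqvGen.setoid fun p q =>
    Adjacent 0 w p q ∨ ∃ t, (t, p) ∈ Word.feet 0 w ∧ (t, q) ∈ Word.feet 0 w

/-- The link diagram without its ties. -/
def Word.eraseTies : Word α → Word α
  | [] => []
  | .piece P i :: w => .piece P i :: Word.eraseTies w
  | .foot _ _ :: w => Word.eraseTies w

/-- Moving, creating and destroying ties: the link diagram is the same, and the ties define the same
partition of the set of its components. -/
def TieMove (w v : Word α) : Prop :=
  w.eraseTies = v.eraseTies ∧ w.tiePartition = v.tiePartition

end Ties

section Moves

variable {α : Type}

/-- Isotopies of the plane, as local changes of words: exchange of the heights of two pieces that lie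
side by side, cancellation of a minimum with a maximum, a crossing that is turned past a maximum or a
minimum. -/
inductive PlanarMove : Word α → Word α → Prop
  | exchange (P Q : Piece α) (i k : ℕ) (h : i ≤ k) :
      PlanarMove [.piece P i, .piece Q (k + P.outs)] [.piece Q (k + P.ins), .piece P i]
  | zigzag (i : ℕ) (d : α) : PlanarMove [cup i d, cap (i + 1)] []
  | zagzig (i : ℕ) (d : α) : PlanarMove [cup (i + 1) d, cap i] []
  | turnCap (i : ℕ) (o : Bool) :
      PlanarMove [cross i o, cap (i + 1)] [cross (i + 1) (!o), cap i]
  | turnCup (i : ℕ) (d : α) (o : Bool) :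
      PlanarMove [cup (i + 1) d, cross i o] [cup i d, cross (i + 1) (!o)]

/-- The first Reidemeister move: removal of a curl, to the right or to the left of the strand. -/
inductive ReidemeisterI : Word α → Word α → Prop
  | right (i : ℕ) (d : α) (o : Bool) :
      ReidemeisterI [cup (i + 1) d, cross i o, cap (i + 1)] []
  | left (i : ℕ) (d : α) (o : Bool) :
      ReidemeisterI [cup i d, cross (i + 1) o, cap i] []

/-- The second Reidemeister move. -/
inductive ReidemeisterII : Word α → Word α → Prop
  | mk (i : ℕ) (o : Bool) : ReidemeisterII [cross i o, cross i (!o)] []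

/-- The third Reidemeister move. The condition on the crossings says that one of the three strands
lies above the two others, and one below the two others. -/
inductive ReidemeisterIII : Word α → Word α → Prop
  | mk (i : ℕ) (o₁ o₂ o₃ : Bool) (h : o₂ = o₁ ∨ o₂ = o₃) :
      ReidemeisterIII [cross i o₁, cross (i + 1) o₂, cross i o₃]
        [cross (i + 1) o₃, cross i o₂, cross (i + 1) o₁]

/-- The word with all its strands moved by one position to the right. -/
def Word.shift : Word α → Word α
  | [] => []
  | .piece P i :: w => .piece P (i + 1) :: Word.shift w
  | .foot t i :: w => .foot t (i + 1) :: Word.shift w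

/-- In the sphere an arc can be moved through the point at infinity: a word with one strand at its
bottom and one at its top may be closed on its left or on its right. -/
inductive SphereMove [StrandLabel α] : Word α → Word α → Prop
  | mk (d : α) (w : Word α) :
      SphereMove (cup 0 d :: w.shift ++ [cap 0]) (cup 0 (StrandLabel.rev d) :: w ++ [cap 0])

/-- Two diagrams differ by the replacement of a part `u` by a part `v` with `M u v`. -/
def Local (M : Word α → Word α → Prop) (w v : Word α) : Prop :=
  ∃ a b x y, M x y ∧ w = a ++ x ++ b ∧ v = a ++ y ++ b

variable [StrandLabel α] [DecidableEq α]

/-- The steps of regular tie-isotopy of diagrams in the sphere. -/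
def RegularStep (D E : Diagram α) : Prop :=
  Local PlanarMove D.word E.word ∨ SphereMove D.word E.word ∨ TieMove D.word E.word ∨
    Local ReidemeisterII D.word E.word ∨ Local ReidemeisterIII D.word E.word

/-- Regular tie-isotopy: isotopy of the sphere, moves of ties that keep the partition, and the
Reidemeister moves II and III, in both directions. -/
def RegularTieIsotopic : Diagram α → Diagram α → Prop :=
  Relation.EqvGen RegularStep

/-- Tie-isotopy: the Reidemeister move I is also allowed. -/
def TieIsotopic : Diagram α → Diagram α → Prop :=
  Relation.EqvGen fun D E => RegularStep D E ∨ Local ReidemeisterI D.word E.word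

end Moves

section Orientation

def Piece.forget : Piece Bool → Piece Unit
  | .cup _ => .cup ()
  | .cap => .cap
  | .cross o => .cross o

def Letter.forget : Letter Bool → Letter Unit
  | .piece P i => .piece P.forget i
  | .foot t i => .foot t i

theorem Letter.act_forget (L : Letter Bool) (l m : List Bool) (h : L.act l = some m) :
    L.forget.act (l.map fun _ => ()) = some (m.map fun _ => ()) := by
  rcases L with ⟨_ | _ | _, i⟩ | ⟨t, i⟩
  · simp only [Letter.act] at h
    split_ifs at h with hi
    obtain rfl := Option.some.inj h
    simp [Letter.forget, Piece.forget, Letter.act, hi]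
  · simp only [Letter.act] at h
    split at h
    · rename_i a b r hr
      split_ifs at h
      obtain rfl := Option.some.inj h
      simp only [Letter.forget, Piece.forget, Letter.act, ← List.map_drop, hr, List.map_cons]
      simp
    · simp at h
  · simp only [Letter.act] at h
    split at h
    · rename_i a b r hr
      obtain rfl := Option.some.inj h
      simp only [Letter.forget, Piece.forget, Letter.act, ← List.map_drop, hr, List.map_cons]
      simp
    · simp at h
  · simp only [Letter.act] at h
    split_ifs at h with hi
    obtain rfl := Option.some.inj h
    simp [Letter.forget, Letter.act, hi]

theorem Word.run_forget (w : Word Bool) (l m : List Bool) (h : Word.run w l = some m) :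
    Word.run (w.map Letter.forget) (l.map fun _ => ()) = some (m.map fun _ => ()) := by
  induction w generalizing l with
  | nil =>
    obtain rfl := Option.some.inj h
    rfl
  | cons L w ih =>
    simp only [Word.run, Option.bind_eq_some_iff] at h
    obtain ⟨n, hn, hw⟩ := h
    rw [List.map_cons, Word.run, Letter.act_forget L l n hn, Option.bind_some, ih n hw]

/-- The unoriented diagram of an oriented diagram. -/
def Diagram.forget (D : OrientedDiagram) : UnorientedDiagram where
  word := D.word.map Letter.forget
  closed := by simpa using Word.run_forget D.word [] [] D.closed
  nonempty := by simpa using D.nonempty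

/-- The sign of a crossing, from the directions of the strands below it. A crossing of two strands
that both go upwards is positive if the strand from the lower left to the upper right is the upper
one; reversing one of the two strands changes the sign. -/
def Letter.sign : Letter Bool → List Bool → ℤ
  | .piece (.cross o) i, l => if (l[i]? = l[i + 1]?) ↔ (o = true) then 1 else -1
  | _, _ => 0

/-- The sum of the signs of the crossings of a word with given directions of the strands below. -/
def Word.writhe : Word Bool → List Bool → ℤ
  | [], _ => 0
  | L :: w, l => L.sign l + Word.writhe w ((L.act l).getD [])

def Diagram.writhe (D : OrientedDiagram) : ℤ := Word.writhe D.word []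

end Orientation

/-- The ring of polynomials in `c` and Laurent polynomials in `A` with integral coefficients. -/
abbrev BracketRing : Type := Polynomial (LaurentPolynomial ℤ)

/-- The invertible variable `A`. -/
noncomputable def varA : BracketRingˣ where
  val := Polynomial.C (LaurentPolynomial.T 1)
  inv := Polynomial.C (LaurentPolynomial.T (-1))
  val_inv := by rw [← Polynomial.C_mul, ← LaurentPolynomial.T_add]; simp
  inv_val := by rw [← Polynomial.C_mul, ← LaurentPolynomial.T_add]; simp

/-- The variable `c`. -/
noncomputable def varC : BracketRing := Polynomial.X

/-- The tie `t` has no end in the word `w`. -/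
def Fresh {α : Type} (t : ℕ) (w : Word α) : Prop := ∀ i, foot t i ∉ w

/-- The rules of the bracket polynomial of unoriented tied link diagrams. The diagrams in a rule
agree outside a disc, with the words `a` below and `b` above it. -/
structure IsTiedBracket (br : UnorientedDiagram → BracketRing) : Prop where
  /-- The circle without crossings. -/
  circle (D : UnorientedDiagram) (h : D.word = [cup 0 (), cap 0]) : br D = 1
  /-- The disjoint union with a circle that carries no tie. -/
  union (a b : Word Unit) (i : ℕ) (D E : UnorientedDiagram)
    (hD : D.word = a ++ b) (hE : E.word = a ++ [cup i (), cap i] ++ b) :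
    br E = varC * br D
  /-- The disjoint union with a circle that is joined by a tie `t` to the rest of the diagram. -/
  tiedUnion (a b : Word Unit) (i t j : ℕ) (D E : UnorientedDiagram)
    (ht : foot t j ∈ a ++ b)
    (hD : D.word = a ++ b) (hE : E.word = a ++ [cup i (), foot t i, cap i] ++ b) :
    br E = -((varA ^ 2 : BracketRingˣ) + (varA ^ (-2 : ℤ) : BracketRingˣ) : BracketRing) * br D
  /-- Invariance under the Reidemeister moves II and III, isotopies of the sphere, and moves of ties
  that keep the partition of the set of components. -/
  regular (D E : UnorientedDiagram) (h : RegularTieIsotopic D E) : br D = br E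
  /-- A crossing of two strands joined by a tie. The two smoothings are two vertical strands, joined
  by a tie, and a lower and an upper arc, joined by a tie. -/
  tiedCrossing (a b : Word Unit) (i t : ℕ) (ht : Fresh t (a ++ b)) (D E F : UnorientedDiagram)
    (hD : D.word = a ++ [foot t i, foot t (i + 1), cross i true] ++ b)
    (hE : E.word = a ++ [foot t i, foot t (i + 1)] ++ b)
    (hF : F.word = a ++ [foot t i, cap i, cup i (), foot t i] ++ b) :
    br D = (varA : BracketRing) * br E + (varA⁻¹ : BracketRingˣ) * br F
  /-- The two crossings and their two smoothings, each with a tie. -/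
  skein (a b : Word Unit) (i t : ℕ) (ht : Fresh t (a ++ b)) (D D' E F : UnorientedDiagram)
    (hD : D.word = a ++ [cross i true] ++ b)
    (hD' : D'.word = a ++ [cross i false] ++ b)
    (hE : E.word = a ++ [foot t i, foot t (i + 1)] ++ b)
    (hF : F.word = a ++ [foot t i, cap i, cup i (), foot t i] ++ b) :
    br D + br D' = ((varA : BracketRing) + (varA⁻¹ : BracketRingˣ)) * (br E + br F)

/-- The polynomial `(-A) ^ (-3 w(D)) ⟨⟨D⟩⟩` of an oriented diagram. -/
noncomputable def jonesPoly (br : UnorientedDiagram → BracketRing) (D : OrientedDiagram) :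
    BracketRing :=
  ((-varA) ^ (-3 * D.writhe) : BracketRingˣ) * br D.forget

end TiedLink

/-! Existence is proved with a state sum. Fix numbers $N$ of colours and $M$ of labels of each
colour, and a unit $a$ with $a^2+a^{-2}=-M$. Label the arcs of a diagram by pairs (colour, label). A
crossing of strands of one colour gets the Kauffman expansion $a\cdot\mathrm{id}+a^{-1}\cdot e$, or
the same with $a$ and $a^{-1}$ exchanged, where $e$ is a cap followed by a cup of that colour, so
that $e^2=Me$. At a crossing of different colours the strands pass through each other with a sign
$\pm1$, which depends on the order of the colours and is opposite for the other crossing. A tie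
forces its ends to have one colour.

Then a free circle has the value $NM$ and a tied circle the value $M=-(a^2+a^{-2})$. In the sum
$D_++D_-$ the different colours cancel and equal colours give $(a+a^{-1})(\mathrm{id}+e)$, which is
the sum of the two tied smoothings. The moves II and III follow from the Temperley–Lieb relations
(`crossOp_crossOp_not`, `crossOp_braid`). A closing arc may change sides because both closures are
traces of the same operator (`partitionFn_sphereMove`). Ties enter only through the condition that
the colouring is constant on the classes of the partition (`partitionFn_eq_histories`).

These numerical invariants must come from one polynomial in $A^{\pm1}$ and $c$, with $c=NM$.
Permuting the colours changes the signs of the crossings only by a factor that depends on the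
colours at the bottom of a word (`transfer_relabel`). So all labels whose colour is not yet in use
contribute equally; there are $c-kM$ of them if $k$ colours are in use, and $M$ is itself a Laurent
polynomial in $a$. Induction on the word gives polynomiality (`isPoly_transfer`), and the bottom
minimum splits off the factor $NM$ (`exists_partitionFn_eq`). Over the complex numbers there are
enough admissible parameters to determine a polynomial (`eq_zero_of_eval_complexModel`), so the
rules pass from the numbers to the polynomial `tiedBracket`.

For the invariance of $\mathcal J$, let the bracket be any function with the rules. The two strands
at the crossing of a curl belong to one component, so a tie there is free and rule 5 applies. One
smoothing is the straightened strand with a tied circle, the other the straightened strand, whence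
the factor $-A(A^2+A^{-2})+A^{-1}=-A^3$; rule 6 then gives $-A^{-3}$ for the opposite curl
(`IsTiedBracket.curl`, `IsTiedBracket.reidemeisterI`). The writhe changes by $\pm1$ accordingly
(`writhe_curl`) and is unchanged by the other moves (`RegularStep.writhe_eq`). -/

namespace TiedLink

/-! ### Words acting on lists of labels -/

section Run

variable {α : Type} [StrandLabel α] [DecidableEq α]

theorem Letter.act_piece_length (P : Piece α) (i : ℕ) (l m : List α)
    (h : (Letter.piece P i).act l = some m) :
    i + P.ins ≤ l.length ∧ m.length + P.ins = l.length + P.outs := by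
  rcases P with _ | _ | _
  · simp only [Letter.act] at h
    split_ifs at h with hi
    obtain rfl := Option.some.inj h
    simp [Piece.ins, Piece.outs, hi]
    omega
  · simp only [Letter.act] at h
    split at h
    · rename_i a b r hr
      split_ifs at h
      obtain rfl := Option.some.inj h
      have := congrArg List.length hr
      simp [Piece.ins, Piece.outs] at this ⊢
      omega
    · simp at h
  · simp only [Letter.act] at h
    split at h
    · rename_i a b r hr
      obtain rfl := Option.some.inj h
      have := congrArg List.length hr
      simp [Piece.ins, Piece.outs] at this ⊢
      omega
    · simp at h

theorem Letter.act_foot (t i : ℕ) (l m : List α) (h : (Letter.foot t i).act l = some m) :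
    i < l.length ∧ m = l := by
  simp only [Letter.act] at h
  split_ifs at h with hi
  exact ⟨hi, (Option.some.inj h).symm⟩

theorem Word.run_append (a b : Word α) (l : List α) :
    Word.run (a ++ b) l = (Word.run a l).bind (Word.run b) := by
  induction a generalizing l with
  | nil => rfl
  | cons L a ih =>
    simp only [List.cons_append, Word.run]
    cases L.act l with
    | none => rfl
    | some m => simpa using ih m

theorem Word.run_append_eq_some {a b : Word α} {l m : List α} :
    Word.run (a ++ b) l = some m ↔ ∃ u, Word.run a l = some u ∧ Word.run b u = some m := by
  rw [Word.run_append, Option.bind_eq_some_iff]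

theorem Word.run_cons_eq_some {L : Letter α} {b : Word α} {l m : List α} :
    Word.run (L :: b) l = some m ↔ ∃ u, L.act l = some u ∧ Word.run b u = some m := by
  rw [Word.run, Option.bind_eq_some_iff]

end Run

/-- The state of an unoriented word is just a number of strands, so every statement about `Word.run`
reduces to arithmetic of lengths. -/
theorem unit_list_ext {u v : List Unit} (h : u.length = v.length) : u = v :=
  List.ext_getElem h fun _ _ _ => rfl

theorem Letter.act_piece_unit (P : Piece Unit) (i : ℕ) (u v : List Unit)
    (h : i + P.ins ≤ u.length) (hv : v.length + P.ins = u.length + P.outs) :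
    (Letter.piece P i).act u = some v := by
  have key : ∃ m, (Letter.piece P i).act u = some m := by
    rcases P with _ | _ | _
    · simp only [Letter.act, Piece.ins] at h ⊢
      simp only [Nat.add_zero] at h
      simp [h]
    · simp only [Letter.act, Piece.ins] at h ⊢
      have hd : (u.drop i).length = u.length - i := List.length_drop
      match hm : u.drop i with
      | [] => rw [hm] at hd; simp at hd; omega
      | [_] => rw [hm] at hd; simp at hd; omega
      | a :: b :: r => simp
    · simp only [Letter.act, Piece.ins] at h ⊢
      have hd : (u.drop i).length = u.length - i := List.length_drop
      match hm : u.drop i with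
      | [] => rw [hm] at hd; simp at hd; omega
      | [_] => rw [hm] at hd; simp at hd; omega
      | a :: b :: r => simp
  obtain ⟨m, hm⟩ := key
  have := (Letter.act_piece_length _ _ _ _ hm).2
  rw [hm, unit_list_ext (show m.length = v.length by omega)]

theorem Letter.act_foot_unit (t i : ℕ) (u : List Unit) (h : i < u.length) :
    (Letter.foot t i).act u = some u := by
  simp [Letter.act, h]

/-! ### The vertex model -/

/-- A label is a colour together with an element of a finite set. -/
abbrev Label : Type := ℕ × ℕ

/-- The number of strands, as a list. -/
abbrev strands (l : List Label) : List Unit := l.map fun _ => ()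

/-- The parameters of the vertex model: `colors` colours, `size` labels of each colour, and a unit `a`
for which a loop has the value `size`. -/
structure VertexModel (R : Type*) [CommRing R] where
  a : Rˣ
  colors : ℕ
  size : ℕ
  loop : (a : R) ^ 2 + (↑a⁻¹ : R) ^ 2 = -(size : R)

/-- The functions on which words act: the first argument records the colours of the ties that have
been met, the second one the labels of the strands. -/
abbrev StateFun (R : Type*) : Type _ := (ℕ → Option ℕ) → List Label → R

/-- The weight of a crossing of strands of different colours `p` (on the lower left) and `q`. -/
def crossSign (o : Bool) (p q : ℕ) : ℤ := if (o = true ↔ q < p) then 1 else -1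

namespace VertexModel

variable {R : Type*} [CommRing R] (S : VertexModel R)

def box : Finset Label := Finset.range S.colors ×ˢ Finset.range S.size

theorem mem_box {x : Label} : x ∈ S.box ↔ x.1 < S.colors ∧ x.2 < S.size := by
  simp [box]

/-- The coefficient of the vertical smoothing of a crossing. -/
def vert (o : Bool) : R := if o then (S.a : R) else (↑S.a⁻¹ : R)

theorem vert_mul_vert_not (o : Bool) : S.vert o * S.vert (!o) = 1 := by
  cases o <;> simp [vert]

theorem vert_sq_add (o : Bool) : S.vert o ^ 2 + S.vert (!o) ^ 2 = -(S.size : R) := by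
  cases o
  · simpa [vert, add_comm] using S.loop
  · simpa [vert] using S.loop

/-- The weight of a piece with given labels of its lower and upper ends. -/
def weight : Piece Unit → List Label → List Label → R
  | .cup _, [], [u, v] => if u = v then 1 else 0
  | .cap, [x, y], [] => if x = y then 1 else 0
  | .cross o, [x, y], [u, v] =>
      if x.1 = y.1 then
        S.vert o * (if x = u ∧ y = v then 1 else 0) +
          -- The upper arc keeps the colour of the lower one, so a loop between two such smoothings
          -- counts `size` labels and not `colors * size`.
          S.vert (!o) * (if x = y ∧ u = v ∧ u.1 = x.1 then 1 else 0)
      else (crossSign o x.1 y.1 : R) * (if u = y ∧ v = x then 1 else 0)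
  | _, _, _ => 0

/-- The lists of `n` labels. -/
def lists : ℕ → Finset (List Label)
  | 0 => {[]}
  | n + 1 => (S.box ×ˢ lists n).image fun p => p.1 :: p.2

theorem mem_lists {n : ℕ} {l : List Label} :
    l ∈ S.lists n ↔ l.length = n ∧ ∀ x ∈ l, x ∈ S.box := by
  induction n generalizing l with
  | zero =>
    simp only [lists, Finset.mem_singleton, List.length_eq_zero_iff]
    exact ⟨fun h => ⟨h, by simp [h]⟩, fun h => h.1⟩
  | succ n ih =>
    simp only [lists, Finset.mem_image, Finset.mem_product]
    constructor
    · rintro ⟨⟨x, l⟩, ⟨hx, hl⟩, rfl⟩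
      obtain ⟨h1, h2⟩ := ih.1 hl
      refine ⟨by simp [h1], ?_⟩
      simpa using ⟨hx, fun a b hab => h2 (a, b) hab⟩
    · rintro ⟨h1, h2⟩
      match l with
      | x :: l =>
        refine ⟨(x, l), ⟨h2 x (by simp), ih.2 ⟨by simpa using h1, fun y hy => h2 y (by simp [hy])⟩⟩,
          rfl⟩

theorem sum_lists_succ (n : ℕ) (F : List Label → R) :
    ∑ b ∈ S.lists (n + 1), F b = ∑ x ∈ S.box, ∑ b ∈ S.lists n, F (x :: b) := by
  rw [lists, Finset.sum_image, Finset.sum_product]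
  rintro ⟨x, l⟩ _ ⟨y, m⟩ _ h
  simpa using h

theorem sum_lists_zero (F : List Label → R) : ∑ b ∈ S.lists 0, F b = F [] := by
  simp [lists]

theorem sum_lists_two (F : List Label → R) :
    ∑ b ∈ S.lists 2, F b = ∑ x ∈ S.box, ∑ y ∈ S.box, F [x, y] := by
  simp only [sum_lists_succ, sum_lists_zero]

/-- The action of a letter on functions of states; the state is below the letter. -/
def step : Letter Unit → StateFun R → StateFun R
  | .piece P i, f => fun τ l =>
      ∑ b ∈ S.lists P.outs,
        S.weight P ((l.drop i).take P.ins) b * f τ (l.take i ++ b ++ l.drop (i + P.ins))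
  | .foot t i, f => fun τ l =>
      match l[i]? with
      -- A default value that is not reached when the word fits on the strands.
      | none => 0
      | some x =>
          -- The first end of a tie records its colour, each later end tests for this colour.
          if τ t = none ∨ τ t = some x.1 then f (Function.update τ t (some x.1)) l else 0

def transfer : Word Unit → StateFun R → StateFun R
  | [], f => f
  | L :: w, f => S.step L (transfer w f)

/-- There is no strand above a closed diagram. -/
def vacuum : StateFun R := fun _ l => if l = [] then 1 else 0

/-- The partition function of a closed word. -/
def partitionFn (w : Word Unit) : R := S.transfer w vacuum (fun _ => none) []

@[simp] theorem transfer_nil (f : StateFun R) : S.transfer [] f = f := rfl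

@[simp] theorem transfer_cons (L : Letter Unit) (w : Word Unit) (f : StateFun R) :
    S.transfer (L :: w) f = S.step L (S.transfer w f) := rfl

theorem transfer_append (w v : Word Unit) (f : StateFun R) :
    S.transfer (w ++ v) f = S.transfer w (S.transfer v f) := by
  induction w with
  | nil => rfl
  | cons L w ih => simp [ih]

/-! ### Transfer operators on lists that are split at the piece -/

theorem step_piece (P : Piece Unit) (i : ℕ) (f : StateFun R) (τ : ℕ → Option ℕ)
    (p c r : List Label) (hp : p.length = i) (hc : c.length = P.ins) :
    S.step (.piece P i) f τ (p ++ (c ++ r)) =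
      ∑ b ∈ S.lists P.outs, S.weight P c b * f τ (p ++ (b ++ r)) := by
  subst hp
  have h : List.drop (p.length + c.length) p = [] := List.drop_eq_nil_of_le (by omega)
  simp [step, List.drop_append, ← hc, h]

theorem step_cup (i : ℕ) (d : Unit) (f : StateFun R) (τ : ℕ → Option ℕ) (p r : List Label)
    (hp : p.length = i) :
    S.step (cup i d) f τ (p ++ r) = ∑ x ∈ S.box, f τ (p ++ x :: x :: r) := by
  have := S.step_piece (.cup d) i f τ p [] r hp rfl
  simp only [List.nil_append] at this
  rw [this, Piece.outs, sum_lists_two]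
  refine Finset.sum_congr rfl fun x hx => ?_
  rw [Finset.sum_eq_single x]
  · simp [weight]
  · intro y _ hy
    simp [weight, hy.symm]
  · exact fun h => absurd hx h

theorem step_cap (i : ℕ) (f : StateFun R) (τ : ℕ → Option ℕ) (p r : List Label) (x y : Label)
    (hp : p.length = i) :
    S.step (cap i) f τ (p ++ x :: y :: r) = if x = y then f τ (p ++ r) else 0 := by
  have := S.step_piece .cap i f τ p [x, y] r hp rfl
  simp only [List.cons_append, List.nil_append] at this
  rw [this, Piece.outs, sum_lists_zero]
  simp [weight]

theorem sum_box_color (q : ℕ) (hq : q < S.colors) (F : Label → R) :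
    ∑ u ∈ S.box, (if u.1 = q then F u else 0) = ∑ j ∈ Finset.range S.size, F (q, j) := by
  rw [box, Finset.sum_product, Finset.sum_eq_single q]
  · simp
  · intro b _ hb
    simp [hb]
  · intro h
    simp [hq] at h

theorem step_cross_same (i : ℕ) (o : Bool) (f : StateFun R) (τ : ℕ → Option ℕ) (p r : List Label)
    (x y : Label) (hp : p.length = i) (hx : x ∈ S.box) (hy : y ∈ S.box) (hxy : x.1 = y.1) :
    S.step (cross i o) f τ (p ++ x :: y :: r) =
      S.vert o * f τ (p ++ x :: y :: r) + S.vert (!o) *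
        if x = y then ∑ j ∈ Finset.range S.size, f τ (p ++ (x.1, j) :: (x.1, j) :: r) else 0 := by
  have := S.step_piece (.cross o) i f τ p [x, y] r hp rfl
  simp only [List.cons_append, List.nil_append] at this
  rw [this, Piece.outs, sum_lists_two]
  simp only [weight, hxy, if_true, add_mul, Finset.sum_add_distrib]
  congr 1
  · rw [Finset.sum_eq_single x, Finset.sum_eq_single y]
    · simp
    · intro z _ hz
      simp [hz.symm]
    · exact fun h => absurd hy h
    · intro z _ hz
      simp [hz.symm]
    · exact fun h => absurd hx h
  · by_cases h : x = y
    · subst h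
      rw [if_pos rfl, Finset.mul_sum,
        ← S.sum_box_color x.1 (S.mem_box.1 hx).1 (fun u => S.vert (!o) * f τ (p ++ u :: u :: r))]
      refine Finset.sum_congr rfl fun u hu => ?_
      rw [Finset.sum_eq_single u]
      · by_cases h : u.1 = x.1 <;> simp [h]
      · intro z _ hz
        simp [hz.symm]
      · exact fun h => absurd hu h
    · simp [h]

theorem step_cross_ne (i : ℕ) (o : Bool) (f : StateFun R) (τ : ℕ → Option ℕ) (p r : List Label)
    (x y : Label) (hp : p.length = i) (hx : x ∈ S.box) (hy : y ∈ S.box) (hxy : x.1 ≠ y.1) :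
    S.step (cross i o) f τ (p ++ x :: y :: r) =
      (crossSign o x.1 y.1 : R) * f τ (p ++ y :: x :: r) := by
  have := S.step_piece (.cross o) i f τ p [x, y] r hp rfl
  simp only [List.cons_append, List.nil_append] at this
  rw [this, Piece.outs, sum_lists_two]
  simp only [weight, if_neg hxy]
  rw [Finset.sum_eq_single y, Finset.sum_eq_single x]
  · simp
  · intro z _ hz
    simp [hz]
  · exact fun h => absurd hx h
  · intro z _ hz
    simp [hz]
  · exact fun h => absurd hy h

theorem step_foot (t i : ℕ) (f : StateFun R) (τ : ℕ → Option ℕ) (p r : List Label)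
    (x : Label) (hp : p.length = i) :
    S.step (foot t i) f τ (p ++ x :: r) =
      if τ t = none ∨ τ t = some x.1 then f (Function.update τ t (some x.1)) (p ++ x :: r)
        else 0 := by
  subst hp
  simp [step]

/-- The colours `τ` of ties may be turned by the word `w` into the colours `τ'` of more ties. -/
def Reach (w : Word Unit) (τ τ' : ℕ → Option ℕ) : Prop :=
  (∀ t, τ' t = none ↔ τ t = none ∧ Fresh t w) ∧
    ((∀ t c, τ t = some c → c < S.colors) → ∀ t c, τ' t = some c → c < S.colors)

/-- This reduces identities between closed diagrams to identities at the place of a move: what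
follows has to be compared only on states that can occur there. `Reach` records that a tie is
uncoloured exactly if none of its ends has been met. -/
theorem transfer_congr (w : Word Unit) (f g : StateFun R) (τ : ℕ → Option ℕ) (l : List Label)
    (u : List Unit) (hrun : Word.run w (strands l) = some u) (hl : ∀ x ∈ l, x ∈ S.box)
    (h : ∀ τ' l', strands l' = u → (∀ x ∈ l', x ∈ S.box) → S.Reach w τ τ' → f τ' l' = g τ' l') :
    S.transfer w f τ l = S.transfer w g τ l := by
  induction w generalizing τ l with
  | nil =>
    refine h τ l (Option.some.inj hrun) hl ⟨fun t => ?_, id⟩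
    simp [Fresh]
  | cons L w ih =>
    obtain ⟨v, hv, hw⟩ := Word.run_cons_eq_some.1 hrun
    rcases L with ⟨P, i⟩ | ⟨t, i⟩
    · obtain ⟨h1, h2⟩ := Letter.act_piece_length _ _ _ _ hv
      simp only [List.length_map] at h1 h2
      refine Finset.sum_congr rfl fun b hb => ?_
      obtain ⟨hb1, hb2⟩ := S.mem_lists.1 hb
      congr 1
      apply ih
      · rw [← hw]
        congr 1
        apply unit_list_ext
        simp
        omega
      · intro x hx
        simp only [List.mem_append] at hx
        rcases hx with (hx | hx) | hx
        · exact hl x (List.mem_of_mem_take hx)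
        · exact hb2 x hx
        · exact hl x (List.mem_of_mem_drop hx)
      · intro τ' l' h3 h4 h5
        refine h τ' l' h3 h4 ⟨fun t => ?_, h5.2⟩
        rw [h5.1 t]
        simp [Fresh, foot]
    · obtain ⟨h1, rfl⟩ := Letter.act_foot _ _ _ _ hv
      simp only [List.length_map] at h1
      have h6 : l[i]? = some l[i] := List.getElem?_eq_getElem h1
      simp only [transfer_cons, step, h6]
      split_ifs with hτ
      · apply ih _ _ hw hl
        intro τ' l' h3 h4 h5
        refine h τ' l' h3 h4 ⟨fun s => ?_, fun hτ => h5.2 fun s c hs => ?_⟩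
        swap
        · by_cases hst : s = t
          · subst hst
            obtain rfl : (l[i]).1 = c := by simpa using hs
            exact (S.mem_box.1 (hl _ (List.getElem_mem h1))).1
          · exact hτ s c (by simpa [hst] using hs)
        rw [h5.1 s]
        by_cases hs : s = t
        · subst hs
          simpa [Fresh, foot] using fun _ => ⟨i, fun hi => absurd rfl hi⟩
        · simp [Fresh, foot, hs]
      · rfl

end VertexModel

/-! ### Invariance of the vertex model under local moves -/

theorem exists_split_one {β : Type*} {l : List β} {i : ℕ} (h : i + 1 ≤ l.length) :
    ∃ p x r, l = p ++ x :: r ∧ p.length = i := by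
  refine ⟨l.take i, l[i], l.drop (i + 1), ?_, by simp; omega⟩
  simp

theorem exists_split_two {β : Type*} {l : List β} {i : ℕ} (h : i + 2 ≤ l.length) :
    ∃ p x y r, l = p ++ x :: y :: r ∧ p.length = i := by
  refine ⟨l.take i, l[i], l[i + 1], l.drop (i + 2), ?_, by simp; omega⟩
  simp

theorem exists_split_three {β : Type*} {l : List β} {i : ℕ} (h : i + 3 ≤ l.length) :
    ∃ p x y z r, l = p ++ x :: y :: z :: r ∧ p.length = i := by
  refine ⟨l.take i, l[i], l[i + 1], l[i + 2], l.drop (i + 3), ?_, by simp; omega⟩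
  simp

theorem exists_split_append {β : Type*} {l : List β} {i n : ℕ} (h : i + n ≤ l.length) :
    ∃ p c r, l = p ++ (c ++ r) ∧ p.length = i ∧ c.length = n := by
  refine ⟨l.take i, (l.drop i).take n, (l.drop i).drop n, ?_, by simp; omega, by simp; omega⟩
  rw [List.take_append_drop, List.take_append_drop]

/-- Each letter changes the number of strands by a fixed amount. Applied to the word above a move,
this shows that both sides of the move end with equally many strands. -/
theorem Word.length_eq_of_run {α : Type} [StrandLabel α] [DecidableEq α] (w : Word α)
    {l m l' m' : List α} (h : Word.run w l = some m) (h' : Word.run w l' = some m')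
    (hm : m.length = m'.length) : l.length = l'.length := by
  induction w generalizing l l' with
  | nil =>
    obtain rfl := Option.some.inj h
    obtain rfl := Option.some.inj h'
    exact hm
  | cons L w ih =>
    obtain ⟨u, hu, hw⟩ := Word.run_cons_eq_some.1 h
    obtain ⟨u', hu', hw'⟩ := Word.run_cons_eq_some.1 h'
    have := ih hw hw'
    rcases L with ⟨P, i⟩ | ⟨t, i⟩
    · have h1 := Letter.act_piece_length _ _ _ _ hu
      have h2 := Letter.act_piece_length _ _ _ _ hu'
      omega
    · obtain ⟨-, rfl⟩ := Letter.act_foot _ _ _ _ hu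
      obtain ⟨-, rfl⟩ := Letter.act_foot _ _ _ _ hu'
      exact this

namespace VertexModel

variable {R : Type*} [CommRing R] (S : VertexModel R)

/-- The action of a crossing on functions of the labels of its ends. -/
def crossOp (o : Bool) (F : Label → Label → R) (x y : Label) : R :=
  if x.1 = y.1 then
    S.vert o * F x y + S.vert (!o) *
      if x = y then ∑ j ∈ Finset.range S.size, F (x.1, j) (x.1, j) else 0
  else (crossSign o x.1 y.1 : R) * F y x

theorem step_cross (i : ℕ) (o : Bool) (f : StateFun R) (τ : ℕ → Option ℕ) (p r : List Label)
    (x y : Label) (hp : p.length = i) (hx : x ∈ S.box) (hy : y ∈ S.box) :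
    S.step (cross i o) f τ (p ++ x :: y :: r) =
      S.crossOp o (fun u v => f τ (p ++ u :: v :: r)) x y := by
  by_cases h : x.1 = y.1
  · rw [S.step_cross_same i o f τ p r x y hp hx hy h, crossOp, if_pos h]
  · rw [S.step_cross_ne i o f τ p r x y hp hx hy h, crossOp, if_neg h]

theorem step_cross_succ (i : ℕ) (o : Bool) (f : StateFun R) (τ : ℕ → Option ℕ) (p r : List Label)
    (w x y : Label) (hp : p.length = i) (hx : x ∈ S.box) (hy : y ∈ S.box) :
    S.step (cross (i + 1) o) f τ (p ++ w :: x :: y :: r) =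
      S.crossOp o (fun u v => f τ (p ++ w :: u :: v :: r)) x y := by
  have := S.step_cross (i + 1) o f τ (p ++ [w]) r x y (by simp [hp]) hx hy
  simpa using this

theorem step_cap_succ (i : ℕ) (f : StateFun R) (τ : ℕ → Option ℕ) (p r : List Label)
    (w x y : Label) (hp : p.length = i) :
    S.step (cap (i + 1)) f τ (p ++ w :: x :: y :: r) = if x = y then f τ (p ++ w :: r) else 0 := by
  have := S.step_cap (i + 1) f τ (p ++ [w]) r x y (by simp [hp])
  simpa using this

theorem step_cup_succ (i : ℕ) (d : Unit) (f : StateFun R) (τ : ℕ → Option ℕ) (p r : List Label)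
    (w : Label) (hp : p.length = i) :
    S.step (cup (i + 1) d) f τ (p ++ w :: r) = ∑ x ∈ S.box, f τ (p ++ w :: x :: x :: r) := by
  have := S.step_cup (i + 1) d f τ (p ++ [w]) r (by simp [hp])
  simpa using this

/-- The formula `step_cross` holds for labels in the box only. The operator never leaves the box, so
the formula may be substituted under it. -/
theorem crossOp_congr (o : Bool) {F G : Label → Label → R} {x y : Label} (hx : x ∈ S.box)
    (hy : y ∈ S.box) (h : ∀ u ∈ S.box, ∀ v ∈ S.box, F u v = G u v) :
    S.crossOp o F x y = S.crossOp o G x y := by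
  unfold crossOp
  rw [h x hx y hy, h y hy x hx, Finset.sum_congr rfl fun j hj => ?_]
  have : (x.1, j) ∈ S.box := S.mem_box.2 ⟨(S.mem_box.1 hx).1, Finset.mem_range.1 hj⟩
  exact h _ this _ this

/-- Changing the crossing and exchanging two different colours negates the condition in `crossSign`
twice. So both factors are the same sign. -/
theorem crossSign_mul_crossSign_not {p q : ℕ} (o : Bool) (h : p ≠ q) :
    crossSign o p q * crossSign (!o) q p = 1 := by
  rcases lt_or_gt_of_ne h with h | h <;> cases o <;> simp [crossSign, h, h.not_gt]

theorem crossSign_not_swap {p q : ℕ} (o : Bool) (h : p ≠ q) :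
    crossSign (!o) q p = crossSign o p q := by
  rcases lt_or_gt_of_ne h with h | h <;> cases o <;> simp [crossSign, h, h.not_gt]

/-- For one colour, let $v$, $v'$ be the coefficients of the two smoothings and $e^2=Me$, with $M$
the size. Then $(v+v'e)(v'+ve)=vv'+(v^2+v'^2+Mvv')e=1$. -/
theorem crossOp_crossOp_not (o : Bool) (F : Label → Label → R) (x y : Label) :
    S.crossOp o (S.crossOp (!o) F) x y = F x y := by
  unfold crossOp
  by_cases h : x.1 = y.1
  · have h1 := S.vert_mul_vert_not o
    have h2 := S.vert_sq_add o
    simp only [h, if_true, Bool.not_not, Finset.sum_add_distrib, ← Finset.mul_sum,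
      Finset.sum_const, Finset.card_range, nsmul_eq_mul]
    split_ifs with hxy
    · linear_combination (F x y + S.size * ∑ j ∈ Finset.range S.size, F (y.1, j) (y.1, j)) * h1 +
        (∑ j ∈ Finset.range S.size, F (y.1, j) (y.1, j)) * h2
    · linear_combination F x y * h1
  · rw [if_neg h, if_neg (Ne.symm h), ← mul_assoc, ← Int.cast_mul,
      crossSign_mul_crossSign_not o h, Int.cast_one, one_mul]

/-- Let $e_1,e_2$ be the Temperley–Lieb generators and $v_k$, $v_k'$ the coefficients of the
crossing `oₖ`. This compares the coefficients of $e_1$ in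
$(v_1+v_1'e_1)(v_2+v_2'e_2)(v_3+v_3'e_1)=(v_3+v_3'e_2)(v_2+v_2'e_1)(v_1+v_1'e_2)$. The last two
terms come from $e_1^2=Me_1$ and $e_1e_2e_1=e_1$. Comparing $e_2$ gives the same identity, and the
other coefficients agree term by term. -/
theorem vert_braid (o₁ o₂ o₃ : Bool) (h : o₂ = o₁ ∨ o₂ = o₃) :
    S.vert o₁ * S.vert (!o₂) * S.vert o₃ =
      S.vert (!o₁) * S.vert o₂ * S.vert o₃ + S.vert o₁ * S.vert o₂ * S.vert (!o₃) +
        S.size * (S.vert (!o₁) * S.vert o₂ * S.vert (!o₃)) +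
        S.vert (!o₁) * S.vert (!o₂) * S.vert (!o₃) := by
  rcases h with rfl | rfl
  · linear_combination (-S.vert (!o₃) * S.vert_sq_add o₂) -
      S.size * S.vert (!o₃) * S.vert_mul_vert_not o₂
  · linear_combination (-S.vert (!o₁) * S.vert_sq_add o₂) -
      S.size * S.vert (!o₁) * S.vert_mul_vert_not o₂

theorem crossOp_braid_same (o₁ o₂ o₃ : Bool) (h : o₂ = o₁ ∨ o₂ = o₃)
    (G : Label → Label → Label → R) (q x y z : ℕ) (hx : x < S.size) (hz : z < S.size) :
    S.crossOp o₁ (fun u v => S.crossOp o₂ (fun v w => S.crossOp o₃ (fun u v => G u v w) u v)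
        v (q, z)) (q, x) (q, y) =
      S.crossOp o₃ (fun v w => S.crossOp o₂ (fun u v => S.crossOp o₁ (fun v w => G u v w) v w)
        (q, x) v) (q, y) (q, z) := by
  have key := S.vert_braid o₁ o₂ o₃ h
  simp only [crossOp, if_true, Prod.mk.injEq, true_and]
  simp only [Finset.sum_add_distrib, ← Finset.mul_sum, Finset.sum_ite_eq, Finset.sum_ite_eq',
    Finset.mem_range, hx, hz, if_true, Finset.sum_const, Finset.card_range, nsmul_eq_mul]
  -- The generators act on equal neighbouring labels only, so it matters which of the three labels
  -- coincide.
  by_cases hxy : x = y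
  · subst hxy
    by_cases hyz : x = z
    · subst hyz
      simp only [if_true]
      linear_combination (∑ j ∈ Finset.range S.size, G (q, x) (q, j) (q, j) -
        ∑ j ∈ Finset.range S.size, G (q, j) (q, j) (q, x)) * key
    · simp only [if_true, hyz, if_false]
      linear_combination (-∑ j ∈ Finset.range S.size, G (q, j) (q, j) (q, z)) * key
  · by_cases hyz : y = z
    · subst hyz
      simp only [if_true, hxy, if_false]
      linear_combination (∑ j ∈ Finset.range S.size, G (q, x) (q, j) (q, j)) * key
    · simp only [hxy, hyz, if_false]
      ring

/-- Only three strands of one colour need the Temperley–Lieb relations and the condition on the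
crossings. A strand of a colour different from the two others slides past their crossing or its
smoothings with the same signs on both sides, and for three different colours both sides carry the
same product of three signs. -/
theorem crossOp_braid (o₁ o₂ o₃ : Bool) (h : o₂ = o₁ ∨ o₂ = o₃)
    (G : Label → Label → Label → R) (x y z : Label) (hx : x ∈ S.box) (hz : z ∈ S.box) :
    S.crossOp o₁ (fun u v => S.crossOp o₂ (fun v w => S.crossOp o₃ (fun u v => G u v w) u v) v z)
        x y =
      S.crossOp o₃ (fun v w => S.crossOp o₂ (fun u v => S.crossOp o₁ (fun v w => G u v w) v w) x v)
        y z := by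
  obtain ⟨q, x⟩ := x
  obtain ⟨q', y⟩ := y
  obtain ⟨q'', z⟩ := z
  by_cases h1 : q = q'
  · subst h1
    by_cases h2 : q = q''
    · subst h2
      exact S.crossOp_braid_same o₁ o₂ o₃ h G q x y z (S.mem_box.1 hx).2 (S.mem_box.1 hz).2
    · simp only [crossOp, h2, if_false, if_true, Prod.mk.injEq, true_and]
      split_ifs
      · simp only [mul_add, Finset.mul_sum]
        congr 1
        · ring
        · exact Finset.sum_congr rfl fun _ _ => by ring
      · ring
  · by_cases h2 : q' = q''
    · subst h2
      simp only [crossOp, h1, if_false, if_true, Prod.mk.injEq, true_and]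
      split_ifs
      · simp only [mul_add, Finset.mul_sum]
        congr 1
        · ring
        · exact Finset.sum_congr rfl fun _ _ => by ring
      · ring
    · by_cases h3 : q = q''
      · subst h3
        simp only [crossOp, h1, Ne.symm h1, if_false, if_true, Prod.mk.injEq, true_and]
        split_ifs
        · simp only [mul_add, Finset.mul_sum]
          congr 1
          · ring
          · exact Finset.sum_congr rfl fun _ _ => by ring
        · ring
      · simp only [crossOp, h1, h2, h3, if_false]
        ring

theorem transfer_reidemeisterIII {w v : Word Unit} (h : ReidemeisterIII w v) (f : StateFun R)
    (τ : ℕ → Option ℕ) (l : List Label) (u : List Unit) (hl : ∀ x ∈ l, x ∈ S.box)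
    (hw : Word.run w (strands l) = some u) (hv : Word.run v (strands l) = some u) :
    S.transfer w f τ l = S.transfer v f τ l := by
  obtain ⟨i, o₁, o₂, o₃, ho⟩ := h
  obtain ⟨m, hm, -⟩ := Word.run_cons_eq_some.1 hv
  have := (Letter.act_piece_length _ _ _ _ hm).1
  simp only [Piece.ins, List.length_map] at this
  obtain ⟨p, x, y, z, r, rfl, hp⟩ := exists_split_three (i := i) (l := l) (by omega)
  have hx : x ∈ S.box := hl x (by simp)
  have hy : y ∈ S.box := hl y (by simp)
  have hz : z ∈ S.box := hl z (by simp)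
  have := S.crossOp_braid o₁ o₂ o₃ ho (fun u v w => f τ (p ++ u :: v :: w :: r)) x y z hx hz
  simp only [transfer_cons, transfer_nil]
  rw [S.step_cross _ _ _ _ _ _ _ _ hp hx hy, S.step_cross_succ _ _ _ _ _ _ _ _ _ hp hy hz]
  refine Eq.trans ?_ (this.trans ?_)
  · refine S.crossOp_congr _ hx hy fun u hu v hv => ?_
    rw [S.step_cross_succ _ _ _ _ _ _ _ _ _ hp hv hz]
    refine S.crossOp_congr _ hv hz fun v hv w _ => ?_
    rw [S.step_cross _ _ _ _ _ _ _ _ hp hu hv]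
  · refine S.crossOp_congr _ hy hz fun v hv w hw => ?_
    rw [S.step_cross _ _ _ _ _ _ _ _ hp hx hv]
    refine S.crossOp_congr _ hx hv fun u _ v hv => ?_
    rw [S.step_cross_succ _ _ _ _ _ _ _ _ _ hp hv hw]

theorem transfer_reidemeisterII {w v : Word Unit} (h : ReidemeisterII w v) (f : StateFun R)
    (τ : ℕ → Option ℕ) (l : List Label) (u : List Unit) (hl : ∀ x ∈ l, x ∈ S.box)
    (hw : Word.run w (strands l) = some u) :
    S.transfer w f τ l = S.transfer v f τ l := by
  obtain ⟨i, o⟩ := h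
  obtain ⟨m, hm, -⟩ := Word.run_cons_eq_some.1 hw
  have := (Letter.act_piece_length _ _ _ _ hm).1
  simp only [Piece.ins, List.length_map] at this
  obtain ⟨p, x, y, r, rfl, hp⟩ := exists_split_two (i := i) (l := l) (by omega)
  have hx : x ∈ S.box := hl x (by simp)
  have hy : y ∈ S.box := hl y (by simp)
  simp only [transfer_cons, transfer_nil]
  rw [S.step_cross _ _ _ _ _ _ _ _ hp hx hy]
  refine Eq.trans ?_ (S.crossOp_crossOp_not o (fun u v => f τ (p ++ u :: v :: r)) x y)
  refine S.crossOp_congr _ hx hy fun u hu v hv => ?_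
  rw [S.step_cross _ _ _ _ _ _ _ _ hp hu hv]

/-! ### Planar isotopies -/

theorem transfer_exchange (P Q : Piece Unit) (i k : ℕ) (h : i ≤ k) (f : StateFun R)
    (τ : ℕ → Option ℕ) (l : List Label) (hl : k + P.ins + Q.ins ≤ l.length) :
    S.transfer [.piece P i, .piece Q (k + P.outs)] f τ l =
      S.transfer [.piece Q (k + P.ins), .piece P i] f τ l := by
  obtain ⟨p, c, r, rfl, hp, hc⟩ := exists_split_append (i := i) (n := P.ins) (l := l) (by omega)
  obtain ⟨q, c', r, rfl, hq, hc'⟩ := exists_split_append (i := k - i) (n := Q.ins) (l := r) (by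
    simp at hl
    omega)
  simp only [transfer_cons, transfer_nil]
  rw [S.step_piece P i _ τ p c _ hp hc,
    show p ++ (c ++ (q ++ (c' ++ r))) = (p ++ c ++ q) ++ (c' ++ r) by simp,
    S.step_piece Q _ _ τ _ c' _ (by simp; omega) hc']
  have h1 : ∀ b ∈ S.lists P.outs, S.weight P c b *
      S.step (.piece Q (k + P.outs)) f τ (p ++ (b ++ (q ++ (c' ++ r)))) =
        ∑ b' ∈ S.lists Q.outs, S.weight P c b *
          (S.weight Q c' b' * f τ (p ++ (b ++ (q ++ (b' ++ r))))) := by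
    intro b hb
    have := (S.mem_lists.1 hb).1
    rw [show p ++ (b ++ (q ++ (c' ++ r))) = (p ++ b ++ q) ++ (c' ++ r) by simp,
      S.step_piece Q _ _ τ _ c' _ (by simp; omega) hc', Finset.mul_sum]
    simp
  have h2 : ∀ b' ∈ S.lists Q.outs, S.weight Q c' b' *
      S.step (.piece P i) f τ (p ++ c ++ q ++ (b' ++ r)) =
        ∑ b ∈ S.lists P.outs, S.weight P c b *
          (S.weight Q c' b' * f τ (p ++ (b ++ (q ++ (b' ++ r))))) := by
    intro b' _
    rw [show p ++ c ++ q ++ (b' ++ r) = p ++ (c ++ (q ++ (b' ++ r))) by simp,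
      S.step_piece P i _ τ p c _ hp hc, Finset.mul_sum]
    exact Finset.sum_congr rfl fun _ _ => by ring
  rw [Finset.sum_congr rfl h1, Finset.sum_congr rfl h2, Finset.sum_comm]

/-- A quarter turn exchanges the two smoothings and also the type of the crossing, so the
coefficients match. For different colours the signs match by `crossSign_not_swap`. -/
theorem crossOp_turnCap (o : Bool) (g : Label → R) (x y z : Label) (hx : x ∈ S.box)
    (hz : z ∈ S.box) :
    S.crossOp o (fun u v => if v = z then g u else 0) x y =
      S.crossOp (!o) (fun v w => if x = v then g w else 0) y z := by
  obtain ⟨q, x⟩ := x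
  obtain ⟨q', y⟩ := y
  obtain ⟨q'', z⟩ := z
  have hx' : x < S.size := (S.mem_box.1 hx).2
  have hz' : z < S.size := (S.mem_box.1 hz).2
  by_cases h1 : q = q'
  · subst h1
    by_cases h2 : q = q''
    · subst h2
      simp only [crossOp, if_true, Prod.mk.injEq, true_and, Bool.not_not,
        Finset.sum_ite_eq, Finset.sum_ite_eq', Finset.mem_range, hx', hz']
      split_ifs <;> simp_all [add_comm]
    · simp [crossOp, h2]
  · by_cases h2 : q' = q''
    · subst h2
      simp [crossOp, h1]
    · by_cases h3 : q = q''
      · subst h3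
        simp only [crossOp, h1, h2, if_false, crossSign_not_swap o h1, Prod.mk.injEq, true_and]
      · simp [crossOp, h1, h2, h3]

theorem sum_crossOp_turnCup (o : Bool) (F : Label → Label → Label → R) (x : Label)
    (hx : x ∈ S.box) :
    ∑ u ∈ S.box, S.crossOp o (fun v w => F v w u) x u =
      ∑ u ∈ S.box, S.crossOp (!o) (fun v w => F u v w) u x := by
  obtain ⟨q, x⟩ := x
  obtain ⟨hq, hx'⟩ := S.mem_box.1 hx
  simp only at hq hx'
  simp only [box, Finset.sum_product]
  have hq' := Finset.mem_range.2 hq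
  -- The colour of the through strand is split off: there the crossing is smoothed, at all other
  -- colours it is a sign.
  rw [← Finset.add_sum_erase _ _ hq', ← Finset.add_sum_erase _ _ hq']
  congr 1
  · simp only [crossOp, if_true, Prod.mk.injEq, true_and, Bool.not_not, Finset.sum_add_distrib,
      ← Finset.mul_sum, Finset.sum_ite_eq, Finset.sum_ite_eq', Finset.mem_range, hx']
    ring
  · refine Finset.sum_congr rfl fun q' hq' => Finset.sum_congr rfl fun y _ => ?_
    have hne : q' ≠ q := Finset.ne_of_mem_erase hq'
    simp only [crossOp, hne, hne.symm, if_false, crossSign_not_swap o hne.symm]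

theorem transfer_planarMove {w v : Word Unit} (h : PlanarMove w v) (f : StateFun R)
    (τ : ℕ → Option ℕ) (l : List Label) (u : List Unit) (hl : ∀ x ∈ l, x ∈ S.box)
    (hw : Word.run w (strands l) = some u) (hv : Word.run v (strands l) = some u) :
    S.transfer w f τ l = S.transfer v f τ l := by
  rcases h with ⟨P, Q, i, k, hik⟩ | ⟨i, d⟩ | ⟨i, d⟩ | ⟨i, o⟩ | ⟨i, d, o⟩
  · obtain ⟨m, hm, -⟩ := Word.run_cons_eq_some.1 hv
    have := (Letter.act_piece_length _ _ _ _ hm).1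
    simp only [List.length_map] at this
    exact S.transfer_exchange P Q i k hik f τ l this
  · obtain ⟨m, hm, hw⟩ := Word.run_cons_eq_some.1 hw
    obtain ⟨n, hn, hw⟩ := Word.run_cons_eq_some.1 hw
    have h1 := Letter.act_piece_length _ _ _ _ hm
    have h2 := Letter.act_piece_length _ _ _ _ hn
    simp only [Piece.ins, Piece.outs, List.length_map] at h1 h2
    obtain ⟨p, x, r, rfl, hp⟩ := exists_split_one (i := i) (l := l) (by omega)
    have hx : x ∈ S.box := hl x (by simp)
    simp only [transfer_cons, transfer_nil]
    rw [S.step_cup _ _ _ _ _ _ hp]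
    simp only [S.step_cap_succ _ _ _ _ _ _ _ _ hp]
    rw [Finset.sum_ite_eq', if_pos hx]
  · obtain ⟨m, hm, hw⟩ := Word.run_cons_eq_some.1 hw
    have h1 := Letter.act_piece_length _ _ _ _ hm
    simp only [Piece.ins, List.length_map] at h1
    obtain ⟨p, x, r, rfl, hp⟩ := exists_split_one (i := i) (l := l) (by omega)
    have hx : x ∈ S.box := hl x (by simp)
    simp only [transfer_cons, transfer_nil]
    rw [S.step_cup_succ _ _ _ _ _ _ _ hp]
    simp only [S.step_cap _ _ _ _ _ _ _ hp]
    rw [Finset.sum_ite_eq, if_pos hx]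
  · obtain ⟨m, hm, hv⟩ := Word.run_cons_eq_some.1 hv
    have h1 := Letter.act_piece_length _ _ _ _ hm
    simp only [Piece.ins, List.length_map] at h1
    obtain ⟨p, x, y, z, r, rfl, hp⟩ := exists_split_three (i := i) (l := l) (by omega)
    have hx : x ∈ S.box := hl x (by simp)
    have hy : y ∈ S.box := hl y (by simp)
    have hz : z ∈ S.box := hl z (by simp)
    simp only [transfer_cons, transfer_nil]
    rw [S.step_cross _ _ _ _ _ _ _ _ hp hx hy, S.step_cross_succ _ _ _ _ _ _ _ _ _ hp hy hz]
    simp only [S.step_cap_succ _ _ _ _ _ _ _ _ hp, S.step_cap _ _ _ _ _ _ _ hp]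
    exact S.crossOp_turnCap o (fun u => f τ (p ++ u :: r)) x y z hx hz
  · obtain ⟨m, hm, hw⟩ := Word.run_cons_eq_some.1 hw
    have h1 := Letter.act_piece_length _ _ _ _ hm
    simp only [Piece.ins, List.length_map] at h1
    obtain ⟨p, x, r, rfl, hp⟩ := exists_split_one (i := i) (l := l) (by omega)
    have hx : x ∈ S.box := hl x (by simp)
    simp only [transfer_cons, transfer_nil]
    rw [S.step_cup_succ _ _ _ _ _ _ _ hp, S.step_cup _ _ _ _ _ _ hp]
    refine Eq.trans ?_ ((S.sum_crossOp_turnCup o (fun u v w => f τ (p ++ u :: v :: w :: r)) x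
      hx).trans ?_)
    · refine Finset.sum_congr rfl fun u hu => ?_
      rw [S.step_cross _ _ _ _ _ _ _ _ hp hx hu]
    · refine Finset.sum_congr rfl fun u hu => ?_
      rw [S.step_cross_succ _ _ _ _ _ _ _ _ _ hp hu hx]

/-- A local move that preserves the transfer operators preserves the partition function. -/
theorem partitionFn_local {B : Word Unit → Word Unit → Prop}
    (hB : ∀ w v, B w v → ∀ (f : StateFun R) (τ : ℕ → Option ℕ) (l : List Label) (u : List Unit),
      (∀ x ∈ l, x ∈ S.box) → Word.run w (strands l) = some u → Word.run v (strands l) = some u →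
      S.transfer w f τ l = S.transfer v f τ l)
    {D E : UnorientedDiagram} (h : Local B D.word E.word) :
    S.partitionFn D.word = S.partitionFn E.word := by
  obtain ⟨a, b, x, y, hxy, hD, hE⟩ := h
  have h1 := D.closed
  have h2 := E.closed
  rw [hD, Word.run_append_eq_some] at h1
  rw [hE, Word.run_append_eq_some] at h2
  obtain ⟨u1, h1, hb1⟩ := h1
  obtain ⟨u2, h2, hb2⟩ := h2
  obtain ⟨u, ha, hx⟩ := Word.run_append_eq_some.1 h1
  obtain ⟨u', ha', hy⟩ := Word.run_append_eq_some.1 h2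
  obtain rfl : u = u' := Option.some.inj (ha.symm.trans ha')
  simp only [partitionFn, hD, hE, transfer_append]
  refine S.transfer_congr a _ _ _ [] u ha (by simp) fun τ l hl hbox _ => ?_
  subst hl
  obtain rfl : u1 = u2 := unit_list_ext (Word.length_eq_of_run b hb1 hb2 rfl)
  exact hB x y hxy _ τ l u1 hbox hx hy

end VertexModel

/-! ### Moves through the point at infinity -/

section PassiveStrand

variable {α : Type} [StrandLabel α] [DecidableEq α]

theorem Word.run_shift (w : Word α) (x : α) (l : List α) :
    Word.run w.shift (x :: l) = (Word.run w l).map (x :: ·) := by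
  induction w generalizing l with
  | nil => rfl
  | cons L w ih =>
    rcases L with ⟨P | _ | _, i⟩ | ⟨t, i⟩
    · simp only [Word.shift, Word.run, Letter.act, List.length_cons, Nat.add_le_add_iff_right,
        List.take_succ_cons, List.drop_succ_cons]
      split_ifs
      · simpa using ih _
      · simp
    · simp only [Word.shift, Word.run, Letter.act, List.take_succ_cons, List.drop_succ_cons]
      split
      · split_ifs
        · simpa using ih _
        · simp
      · simp
    · simp only [Word.shift, Word.run, Letter.act, List.take_succ_cons, List.drop_succ_cons]
      split
      · simpa using ih _
      · simp
    · simp only [Word.shift, Word.run, Letter.act, List.length_cons, Nat.add_lt_add_iff_right]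
      split_ifs
      · simpa using ih _
      · simp

theorem Letter.act_append (L : Letter α) (l m r : List α) (h : L.act l = some m) :
    L.act (l ++ r) = some (m ++ r) := by
  rcases L with ⟨P | _ | _, i⟩ | ⟨t, i⟩
  · have := (Letter.act_piece_length _ _ _ _ h).1
    simp only [Piece.ins, Nat.add_zero] at this
    simp only [Letter.act, this, if_true, List.length_append, Nat.le_add_right_of_le] at h ⊢
    obtain rfl := Option.some.inj h
    simp [List.take_append_of_le_length this, List.drop_append_of_le_length this]
  · have := (Letter.act_piece_length _ _ _ _ h).1
    simp only [Piece.ins] at this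
    simp only [Letter.act] at h ⊢
    rw [List.take_append_of_le_length (by omega), List.drop_append_of_le_length (by omega)]
    split at h
    · rename_i a b s hs
      split_ifs at h with hab
      obtain rfl := Option.some.inj h
      simp [hs, hab]
    · simp at h
  · have := (Letter.act_piece_length _ _ _ _ h).1
    simp only [Piece.ins] at this
    simp only [Letter.act] at h ⊢
    rw [List.take_append_of_le_length (by omega), List.drop_append_of_le_length (by omega)]
    split at h
    · rename_i a b s hs
      obtain rfl := Option.some.inj h
      simp [hs]
    · simp at h
  · obtain ⟨h1, rfl⟩ := Letter.act_foot _ _ _ _ h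
    simp [Letter.act]
    omega

theorem Word.run_concat (w : Word α) (l m r : List α) (h : Word.run w l = some m) :
    Word.run w (l ++ r) = some (m ++ r) := by
  induction w generalizing l with
  | nil =>
    obtain rfl := Option.some.inj h
    rfl
  | cons L w ih =>
    obtain ⟨u, hu, hw⟩ := Word.run_cons_eq_some.1 h
    exact Word.run_cons_eq_some.2 ⟨_, L.act_append _ _ r hu, ih _ hw⟩

end PassiveStrand

theorem SphereMove.exists_eq {α : Type} [StrandLabel α] {x y : Word α} (h : SphereMove x y) :
    ∃ (d : α) (w : Word α), x = cup 0 d :: Word.shift w ++ [cap 0] ∧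
      y = cup 0 (StrandLabel.rev d) :: w ++ [cap 0] := by
  obtain ⟨d, w⟩ := h
  exact ⟨d, w, rfl, rfl⟩

namespace VertexModel

variable {R : Type*} [CommRing R] (S : VertexModel R)

theorem transfer_shift (w : Word Unit) (f : StateFun R) (τ : ℕ → Option ℕ) (x : Label)
    (l : List Label) :
    S.transfer w.shift f τ (x :: l) = S.transfer w (fun τ l => f τ (x :: l)) τ l := by
  induction w generalizing τ l with
  | nil => rfl
  | cons L w ih =>
    rcases L with ⟨P, i⟩ | ⟨t, i⟩
    · simp only [Word.shift, transfer_cons, step]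
      refine Finset.sum_congr rfl fun b _ => ?_
      rw [← ih]
      simp [Nat.add_right_comm i 1]
    · simp only [Word.shift, transfer_cons, step, List.getElem?_cons_succ]
      split
      · rfl
      · simp only [ih]

/-- A strand on the far right is inert only if the word fits on the strands to its left; otherwise a
piece could take hold of it. On the left, `Word.shift` takes care of this. -/
theorem transfer_concat (w : Word Unit) (f : StateFun R) (τ : ℕ → Option ℕ) (y : Label)
    (l : List Label) (u : List Unit) (hrun : Word.run w (strands l) = some u) :
    S.transfer w f τ (l ++ [y]) = S.transfer w (fun τ l => f τ (l ++ [y])) τ l := by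
  induction w generalizing τ l with
  | nil => rfl
  | cons L w ih =>
    obtain ⟨v, hv, hw⟩ := Word.run_cons_eq_some.1 hrun
    rcases L with ⟨P, i⟩ | ⟨t, i⟩
    · obtain ⟨h1, h2⟩ := Letter.act_piece_length _ _ _ _ hv
      simp only [List.length_map] at h1 h2
      obtain ⟨p, c, r, rfl, hp, hc⟩ := exists_split_append h1
      simp only [transfer_cons]
      rw [show p ++ (c ++ r) ++ [y] = p ++ (c ++ (r ++ [y])) by simp,
        S.step_piece P i _ τ p c _ hp hc, S.step_piece P i _ τ p c _ hp hc]
      refine Finset.sum_congr rfl fun b hb => ?_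
      have hb := (S.mem_lists.1 hb).1
      rw [← ih _ _ ?_]
      · simp
      · rw [← hw]
        congr 1
        apply unit_list_ext
        simp at h2 ⊢
        omega
    · obtain ⟨h1, rfl⟩ := Letter.act_foot _ _ _ _ hv
      simp only [List.length_map] at h1
      obtain ⟨p, x, r, rfl, hp⟩ := exists_split_one h1
      simp only [transfer_cons]
      rw [show p ++ x :: r ++ [y] = p ++ x :: (r ++ [y]) by simp,
        S.step_foot _ _ _ _ _ _ _ hp, S.step_foot _ _ _ _ _ _ _ hp, ← ih _ _ hw]
      simp

/-- Both closures are the trace of the operator of `w` on one strand: a sum over the label `x` of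
the closing arc, where `w` leads from `x` to `x`, whether this arc runs on the left or on the right.
-/
theorem partitionFn_sphereMove {D E : UnorientedDiagram} (h : SphereMove D.word E.word) :
    S.partitionFn D.word = S.partitionFn E.word := by
  obtain ⟨d, w, hD, hE⟩ := h.exists_eq
  have hrun : Word.run w [()] = some [()] := by
    have := D.closed
    rw [hD, List.cons_append] at this
    obtain ⟨u, hu, hw⟩ := Word.run_cons_eq_some.1 this
    obtain ⟨v, hw, hv⟩ := Word.run_append_eq_some.1 hw
    obtain ⟨v', hv, hv'⟩ := Word.run_cons_eq_some.1 hv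
    obtain rfl := Option.some.inj hv'
    have h1 := (Letter.act_piece_length _ _ _ _ hu).2
    have h2 := (Letter.act_piece_length _ _ _ _ hv).2
    obtain rfl : u = [(), ()] := unit_list_ext (by simpa [Piece.ins, Piece.outs] using h1)
    rw [Word.run_shift, Option.map_eq_some_iff] at hw
    obtain ⟨m, hm, rfl⟩ := hw
    rw [hm, unit_list_ext (u := m) (v := [()])]
    simp [Piece.ins, Piece.outs] at h2 ⊢
    omega
  simp only [partitionFn, hD, hE, transfer_cons, List.cons_append, transfer_append]
  have hcap1 : ∀ (τ : ℕ → Option ℕ) (x : Label) (l : List Label), strands l = [()] →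
      S.transfer [cap 0] (vacuum (R := R)) τ (x :: l) = if l = [x] then 1 else 0 := by
    intro τ x l hl
    match l with
    | [y] =>
      have := S.step_cap 0 (vacuum (R := R)) τ [] [] x y rfl
      simpa [vacuum, eq_comm] using this
  have hcap2 : ∀ (τ : ℕ → Option ℕ) (x : Label) (l : List Label), strands l = [()] →
      S.transfer [cap 0] (vacuum (R := R)) τ (l ++ [x]) = if l = [x] then 1 else 0 := by
    intro τ x l hl
    match l with
    | [y] =>
      have := S.step_cap 0 (vacuum (R := R)) τ [] [] y x rfl
      simpa [vacuum] using this
  have h1 := S.step_cup 0 d (S.transfer (Word.shift w) (S.transfer [cap 0] vacuum)) (fun _ => none) [] []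
    rfl
  have h2 := S.step_cup 0 (StrandLabel.rev d) (S.transfer w (S.transfer [cap 0] vacuum))
    (fun _ => none) [] [] rfl
  simp only [List.append_nil, List.nil_append] at h1 h2
  refine h1.trans (Eq.trans ?_ h2.symm)
  refine Finset.sum_congr rfl fun x hx => ?_
  have h3 := S.transfer_concat w (S.transfer [cap 0] vacuum) (fun _ => none) x [x] _ hrun
  rw [transfer_shift, show [x, x] = [x] ++ [x] from rfl, h3]
  refine S.transfer_congr w _ _ _ _ _ hrun (by simpa using hx) fun τ l hl _ _ => ?_
  rw [hcap1 τ x l hl, hcap2 τ x l hl]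

/-! ### Moves of ties -/

/-- Colourings of the points of a diagram; there are no colours off the diagram. -/
abbrev Coloring : Type := ℕ × ℕ → Option ℕ

/-- A colouring with a new row of colours at height `k`. -/
def addRow (χ : Coloring) (k : ℕ) (l : List Label) : Coloring :=
  fun p => if p.1 = k then l[p.2]?.map Prod.fst else χ p

/-- The sum of the weights of all labellings of a closed word that extend the colouring `χ` and the
labels `l` at height `k`, each weight multiplied by the value of `Φ` on the colouring. -/
def histories : Word Unit → ℕ → Coloring → List Label → (Coloring → R) → R
  | [], _, χ, l, Φ => if l = [] then Φ χ else 0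
  | .piece P i :: w, k, χ, l, Φ =>
      ∑ b ∈ S.lists P.outs, S.weight P ((l.drop i).take P.ins) b *
        histories w (k + 1) (addRow χ (k + 1) (l.take i ++ b ++ l.drop (i + P.ins)))
          (l.take i ++ b ++ l.drop (i + P.ins)) Φ
  | .foot _ _ :: w, k, χ, l, Φ => histories w k χ l Φ

theorem histories_eraseTies (w : Word Unit) (k : ℕ) (χ : Coloring) (l : List Label)
    (Φ : Coloring → R) : S.histories w.eraseTies k χ l Φ = S.histories w k χ l Φ := by
  induction w generalizing k χ l with
  | nil => rfl
  | cons L w ih =>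
    rcases L with ⟨P, i⟩ | ⟨t, i⟩
    · simp only [Word.eraseTies, histories, ih]
    · simp only [Word.eraseTies, histories, ih]

theorem histories_zero (w : Word Unit) (k : ℕ) (χ : Coloring) (l : List Label) :
    S.histories w k χ l (fun _ => 0) = 0 := by
  induction w generalizing k χ l with
  | nil => simp [histories]
  | cons L w ih => rcases L with ⟨P, i⟩ | ⟨t, i⟩ <;> simp [histories, ih]

/-- With the next two lemmas: a labelling with nonzero weight has a constant colour along every arc
of the diagram. -/
theorem weight_ne_zero_cup {d : Unit} {c b : List Label} (h : S.weight (.cup d) c b ≠ 0) :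
    ∃ u, b = [u, u] := by
  match c, b with
  | [], [u, v] =>
    simp only [weight, ne_eq, ite_eq_right_iff, not_forall] at h
    exact ⟨u, by rw [h.1]⟩
  | [], [] | [], [_] | [], _ :: _ :: _ :: _ | _ :: _, _ => simp [weight] at h

theorem weight_ne_zero_cap {c b : List Label} (h : S.weight .cap c b ≠ 0) :
    ∃ u, c = [u, u] := by
  match c, b with
  | [u, v], [] =>
    simp only [weight, ne_eq, ite_eq_right_iff, not_forall] at h
    exact ⟨u, by rw [h.1]⟩
  | [], _ | [_], _ | _ :: _ :: _ :: _, _ | [_, _], _ :: _ => simp [weight] at h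

/-- Also in the smoothings the colours follow the strands of the crossing, because all four ends
then have one colour. -/
theorem weight_ne_zero_cross {o : Bool} {c b : List Label} (h : S.weight (.cross o) c b ≠ 0) :
    ∃ x y u v, c = [x, y] ∧ b = [u, v] ∧ u.1 = y.1 ∧ v.1 = x.1 := by
  match c, b with
  | [x, y], [u, v] =>
    refine ⟨x, y, u, v, rfl, rfl, ?_⟩
    by_contra hne
    apply h
    simp only [weight]
    split_ifs with h1 h2 h3 h3 h2
    · obtain ⟨rfl, rfl⟩ := h2
      exact absurd ⟨h1, h1.symm⟩ hne
    · obtain ⟨rfl, rfl⟩ := h2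
      exact absurd ⟨h1, h1.symm⟩ hne
    · obtain ⟨rfl, rfl, h4⟩ := h3
      exact absurd ⟨h4, h4⟩ hne
    · simp
    · obtain ⟨rfl, rfl⟩ := h2
      exact absurd ⟨rfl, rfl⟩ hne
    · simp
  | [], _ | [_], _ | _ :: _ :: _ :: _, _ | [_, _], [] | [_, _], [_]
  | [_, _], _ :: _ :: _ :: _ => simp [weight] at h

/-- Only labellings with nonzero weight contribute. Their colourings are constant along arcs and are
defined at all ends of ties; at heights up to `k` they are still `χ`, since the later rows are
written above. -/
theorem histories_congr (w : Word Unit) (k : ℕ) (χ : Coloring) (l : List Label)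
    (Φ Ψ : Coloring → R) (u : List Unit) (hrun : Word.run w (strands l) = some u)
    (hχ : ∀ j, χ (k, j) = l[j]?.map Prod.fst)
    (h : ∀ χ' : Coloring, (∀ p, p.1 ≤ k → χ' p = χ p) → (∀ p q, Adjacent k w p q → χ' p = χ' q) →
      (∀ t p, (t, p) ∈ Word.feet k w → χ' p ≠ none) → Φ χ' = Ψ χ') :
    S.histories w k χ l Φ = S.histories w k χ l Ψ := by
  induction w generalizing k χ l with
  | nil =>
    simp only [histories]
    congr 1
    exact h χ (fun _ _ => rfl) (fun p q hpq => by cases hpq) (fun t p hp => by simp [Word.feet] at hp)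
  | cons L w ih =>
    obtain ⟨v, hv, hw⟩ := Word.run_cons_eq_some.1 hrun
    rcases L with ⟨P, i⟩ | ⟨t, i⟩
    · obtain ⟨h1, h2⟩ := Letter.act_piece_length _ _ _ _ hv
      simp only [List.length_map] at h1 h2
      obtain ⟨p, c, r, rfl, hp, hc⟩ := exists_split_append h1
      simp only [histories]
      refine Finset.sum_congr rfl fun b hb => ?_
      obtain ⟨hb, -⟩ := S.mem_lists.1 hb
      subst hp
      have e1 : ((p ++ (c ++ r)).drop p.length).take P.ins = c := by simp [← hc]
      have e2 : (p ++ (c ++ r)).take p.length ++ b ++ (p ++ (c ++ r)).drop (p.length + P.ins) =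
          p ++ (b ++ r) := by
        rw [← List.drop_drop]
        simp [← hc]
      rw [e1, e2]
      by_cases hW : S.weight P c b = 0
      · rw [hW, zero_mul, zero_mul]
      congr 1
      apply ih
      · rw [← hw]
        congr 1
        apply unit_list_ext
        simp at h2 ⊢
        omega
      · intro j
        simp [addRow]
      · intro χ' h3 h4 h5
        have r0 : ∀ j, χ' (k, j) = (p ++ (c ++ r))[j]?.map Prod.fst := by
          intro j
          rw [h3 _ (by simp), ← hχ]
          simp [addRow]
        have r1 : ∀ j, χ' (k + 1, j) = (p ++ (b ++ r))[j]?.map Prod.fst := by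
          intro j
          rw [h3 _ (by simp)]
          simp [addRow]
        refine h χ' ?_ ?_ ?_
        · intro q hq
          rw [h3 q (by omega), addRow, if_neg (by omega)]
        · intro q q' hqq
          cases hqq with
          | left _ _ _ _ j hj =>
            rw [r0, r1, List.getElem?_append_left hj, List.getElem?_append_left hj]
          | right _ _ _ _ j hj =>
            rw [r0, r1, List.getElem?_append_right (by omega), List.getElem?_append_right (by omega),
              List.getElem?_append_right (by omega), List.getElem?_append_right (by omega)]
            congr 2
            omega
          | cup =>
            obtain ⟨u, rfl⟩ := S.weight_ne_zero_cup hW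
            rw [r1, r1]
            simp
          | cap =>
            obtain ⟨u, rfl⟩ := S.weight_ne_zero_cap hW
            rw [r0, r0]
            simp
          | crossLeft =>
            obtain ⟨x, y, u, v, rfl, rfl, e1, e2⟩ := S.weight_ne_zero_cross hW
            rw [r0, r1]
            simp [e2]
          | crossRight =>
            obtain ⟨x, y, u, v, rfl, rfl, e1, e2⟩ := S.weight_ne_zero_cross hW
            rw [r0, r1]
            simp [e1]
          | afterPiece _ _ _ _ _ _ hqq => exact h4 _ _ hqq
        · exact fun t q hq => h5 t q hq
    · obtain ⟨h1, rfl⟩ := Letter.act_foot _ _ _ _ hv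
      simp only [List.length_map] at h1
      simp only [histories]
      apply ih _ _ _ hw hχ
      intro χ' h3 h4 h5
      refine h χ' h3 ?_ ?_
      · intro p q hpq
        cases hpq with
        | afterFoot _ _ _ _ _ _ hpq => exact h4 _ _ hpq
      · intro s p hp
        simp only [Word.feet, List.mem_cons, Prod.mk.injEq] at hp
        rcases hp with ⟨rfl, rfl⟩ | hp
        · rw [h3 _ le_rfl, hχ, List.getElem?_eq_getElem h1]
          simp
        · exact h5 s p hp

/-- The colouring `χ` is compatible with the given ends of ties. -/
def RespectsTies : List (ℕ × (ℕ × ℕ)) → (ℕ → Option ℕ) → Coloring → Prop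
  | [], _, _ => True
  | (t, p) :: F, τ, χ =>
      ∃ c, χ p = some c ∧ (τ t = none ∨ τ t = some c) ∧
        RespectsTies F (Function.update τ t (some c)) χ

/-- The test made while reading the word from bottom to top turns into a condition that does not
depend on the order of the ends. -/
theorem respectsTies_iff (F : List (ℕ × (ℕ × ℕ))) (τ : ℕ → Option ℕ) (χ : Coloring)
    (hF : ∀ t p, (t, p) ∈ F → χ p ≠ none) :
    RespectsTies F τ χ ↔ (∀ t p, (t, p) ∈ F → τ t = none ∨ τ t = χ p) ∧
      ∀ t p q, (t, p) ∈ F → (t, q) ∈ F → χ p = χ q := by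
  induction F generalizing τ with
  | nil => simp [RespectsTies]
  | cons tp F ih =>
    obtain ⟨t, p⟩ := tp
    obtain ⟨c, hc⟩ := Option.ne_none_iff_exists'.1 (hF t p (by simp))
    have hF' : ∀ t p, (t, p) ∈ F → χ p ≠ none := fun s q hq => hF s q (by simp [hq])
    have ih := ih (Function.update τ t (some c)) hF'
    simp only [RespectsTies, hc, Option.some.injEq, exists_eq_left', ih]
    constructor
    · rintro ⟨h1, h2, h3⟩
      have key : ∀ q, (t, q) ∈ F → χ q = some c := by
        intro q hq
        have := h2 t q hq
        simp only [Function.update_self, reduceCtorEq, false_or] at this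
        exact this.symm
      refine ⟨?_, ?_⟩
      · intro s q hq
        simp only [List.mem_cons, Prod.mk.injEq] at hq
        rcases hq with ⟨rfl, rfl⟩ | hq
        · rwa [hc]
        · by_cases hs : s = t
          · subst hs
            rwa [key q hq]
          · simpa [hs] using h2 s q hq
      · intro s q q' hq hq'
        simp only [List.mem_cons, Prod.mk.injEq] at hq hq'
        rcases hq with ⟨rfl, rfl⟩ | hq <;> rcases hq' with ⟨h4, rfl⟩ | hq'
        · rfl
        · rw [hc, key q' hq']
        · subst h4
          rw [hc, key q hq]
        · exact h3 s q q' hq hq'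
    · rintro ⟨h1, h2⟩
      refine ⟨?_, ?_, ?_⟩
      · rw [← hc]
        exact h1 t p (by simp)
      · intro s q hq
        by_cases hs : s = t
        · subst hs
          right
          rw [Function.update_self, ← hc]
          exact h2 s p q (by simp) (by simp [hq])
        · simpa [hs] using h1 s q (by simp [hq])
      · exact fun s q q' hq hq' => h2 s q q' (by simp [hq]) (by simp [hq'])

-- The tests of the ties can be postponed until the whole colouring is known.
open Classical in
theorem transfer_vacuum (w : Word Unit) (k : ℕ) (χ : Coloring) (τ : ℕ → Option ℕ) (l : List Label)
    (u : List Unit) (hrun : Word.run w (strands l) = some u)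
    (hχ : ∀ j, χ (k, j) = l[j]?.map Prod.fst) :
    S.transfer w vacuum τ l = S.histories w k χ l fun χ' =>
      if RespectsTies (Word.feet k w) τ χ' then 1 else 0 := by
  induction w generalizing k χ τ l with
  | nil => simp [histories, vacuum, Word.feet, RespectsTies]
  | cons L w ih =>
    obtain ⟨v, hv, hw⟩ := Word.run_cons_eq_some.1 hrun
    rcases L with ⟨P, i⟩ | ⟨t, i⟩
    · obtain ⟨h1, h2⟩ := Letter.act_piece_length _ _ _ _ hv
      simp only [List.length_map] at h1 h2
      refine Finset.sum_congr rfl fun b hb => ?_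
      obtain ⟨hb, -⟩ := S.mem_lists.1 hb
      congr 1
      apply ih
      · rw [← hw]
        congr 1
        apply unit_list_ext
        simp
        omega
      · intro j
        simp [addRow]
    · obtain ⟨h1, rfl⟩ := Letter.act_foot _ _ _ _ hv
      simp only [List.length_map] at h1
      have h6 : l[i]? = some l[i] := List.getElem?_eq_getElem h1
      have h7 : χ (k, i) = some l[i].1 := by rw [hχ, h6]; rfl
      simp only [transfer_cons, step, h6, histories]
      split_ifs with hτ
      · rw [ih k χ _ l hw hχ]
        refine S.histories_congr w k χ l _ _ u hw hχ fun χ' h3 _ _ => ?_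
        have : χ' (k, i) = some l[i].1 := by rw [h3 _ le_rfl, h7]
        simp [Word.feet, RespectsTies, this, hτ]
      · rw [S.histories_congr w k χ l _ (fun _ => 0) u hw hχ]
        · rw [histories_zero]
        · intro χ' h3 _ _
          have : χ' (k, i) = some l[i].1 := by rw [h3 _ le_rfl, h7]
          simp [Word.feet, RespectsTies, this, hτ]

-- A colouring that is constant along arcs respects the ties exactly if it is constant on the
-- classes of the partition. So the right side depends only on the two data that a move of ties
-- preserves.
open Classical in
theorem partitionFn_eq_histories {w : Word Unit} (hw : Word.run w [] = some []) :
    S.partitionFn w = S.histories w.eraseTies 0 (fun _ => none) [] fun χ =>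
      if ∀ p q, w.tiePartition p q → χ p = χ q then 1 else 0 := by
  rw [histories_eraseTies, partitionFn,
    S.transfer_vacuum w 0 (fun _ => none) (fun _ => none) [] [] hw (by simp)]
  refine S.histories_congr w 0 _ [] _ _ _ hw (by simp) fun χ _ h4 h5 => ?_
  congr 1
  rw [respectsTies_iff _ _ _ h5, eq_iff_iff]
  constructor
  · rintro ⟨-, h⟩ p q hpq
    induction hpq with
    | rel p q hpq =>
      rcases hpq with hpq | ⟨t, hp, hq⟩
      · exact h4 p q hpq
      · exact h t p q hp hq
    | refl p => rfl
    | symm p q _ ih => exact ih.symm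
    | trans p q r _ _ ih1 ih2 => exact ih1.trans ih2
  · exact fun h => ⟨by simp, fun t p q hp hq => h p q (.rel _ _ (.inr ⟨t, hp, hq⟩))⟩

theorem partitionFn_tieMove {D E : UnorientedDiagram} (h : TieMove D.word E.word) :
    S.partitionFn D.word = S.partitionFn E.word := by
  rw [S.partitionFn_eq_histories D.closed, S.partitionFn_eq_histories E.closed, h.1, h.2]

theorem partitionFn_regular {D E : UnorientedDiagram} (h : RegularTieIsotopic D E) :
    S.partitionFn D.word = S.partitionFn E.word := by
  induction h with
  | rel D E h =>
    rcases h with h | h | h | h | h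
    · exact S.partitionFn_local (fun w v h f τ l u hl hw hv =>
        S.transfer_planarMove h f τ l u hl hw hv) h
    · exact S.partitionFn_sphereMove h
    · exact S.partitionFn_tieMove h
    · exact S.partitionFn_local (fun w v h f τ l u hl hw _ =>
        S.transfer_reidemeisterII h f τ l u hl hw) h
    · exact S.partitionFn_local (fun w v h f τ l u hl hw hv =>
        S.transfer_reidemeisterIII h f τ l u hl hw hv) h
  | refl D => rfl
  | symm D E _ ih => exact ih.symm
  | trans D E F _ _ ih1 ih2 => exact ih1.trans ih2

end VertexModel

/-! ### Relabellings -/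

/-- The sign of the reversal of the order of the colours `p`, `q` by a permutation. -/
def swapSign (σ : Equiv.Perm ℕ) (p q : ℕ) : ℤ := if p < q ∧ σ q < σ p then -1 else 1

/-- The product of the signs of all pairs in a list. -/
def orderSign (σ : Equiv.Perm ℕ) : List ℕ → ℤ
  | [] => 1
  | p :: l => (l.map (swapSign σ p)).prod * orderSign σ l

theorem swapSign_mul_self (σ : Equiv.Perm ℕ) (p q : ℕ) : swapSign σ p q * swapSign σ p q = 1 := by
  unfold swapSign
  split_ifs <;> rfl

theorem swapSign_self (σ : Equiv.Perm ℕ) (p : ℕ) : swapSign σ p p = 1 := by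
  simp [swapSign]

/-- Every other entry meets `x` twice, so its signs cancel. Hence minima and maxima do not affect
`orderSign`. -/
theorem orderSign_pair (σ : Equiv.Perm ℕ) (p r : List ℕ) (x : ℕ) :
    orderSign σ (p ++ x :: x :: r) = orderSign σ (p ++ r) := by
  induction p with
  | nil =>
    simp only [List.nil_append, orderSign, List.map_cons, List.prod_cons, swapSign_self, one_mul]
    rw [← mul_assoc, ← List.prod_map_mul]
    simp [swapSign_mul_self]
  | cons z p ih =>
    simp only [List.cons_append, orderSign, ih, List.map_append, List.map_cons, List.prod_append,
      List.prod_cons]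
    linear_combination ((p.map (swapSign σ z)).prod * (r.map (swapSign σ z)).prod *
      orderSign σ (p ++ r)) * swapSign_mul_self σ z x

/-- Exchanging neighbours affects only the sign of their own pair. This matches the change of the
sign of a crossing. -/
theorem orderSign_swap (σ : Equiv.Perm ℕ) (p r : List ℕ) (x y : ℕ) :
    orderSign σ (p ++ x :: y :: r) * swapSign σ y x =
      orderSign σ (p ++ y :: x :: r) * swapSign σ x y := by
  induction p with
  | nil =>
    simp only [List.nil_append, orderSign, List.map_cons, List.prod_cons]
    ring
  | cons z p ih =>
    simp only [List.cons_append, orderSign, List.map_append, List.map_cons, List.prod_append,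
      List.prod_cons]
    linear_combination ((p.map (swapSign σ z)).prod * (r.map (swapSign σ z)).prod *
      swapSign σ z x * swapSign σ z y) * ih

theorem orderSign_eq_one (σ : Equiv.Perm ℕ) (l : List ℕ) (h : ∀ p ∈ l, σ p = p) :
    orderSign σ l = 1 := by
  induction l with
  | nil => rfl
  | cons p l ih =>
    rw [orderSign, ih fun q hq => h q (by simp [hq]), mul_one]
    apply List.prod_eq_one
    simp only [List.mem_map]
    rintro _ ⟨q, hq, rfl⟩
    have h1 := h p (by simp)
    have h2 := h q (by simp [hq])
    rw [swapSign, if_neg]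
    rw [h1, h2]
    omega

/-- At most one of the two factors `swapSign` is not $1$, and their product is $-1$ exactly if `σ`
reverses the order of the two colours. -/
theorem crossSign_perm (σ : Equiv.Perm ℕ) (o : Bool) {p q : ℕ} (h : p ≠ q) :
    crossSign o (σ p) (σ q) = crossSign o p q * (swapSign σ p q * swapSign σ q p) := by
  have h' : σ p ≠ σ q := fun e => h (σ.injective e)
  rcases lt_or_gt_of_ne h with h | h <;> rcases lt_or_gt_of_ne h' with h' | h' <;> cases o <;>
    simp [crossSign, swapSign, h, h.not_gt, h', h'.not_gt]

namespace VertexModel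

variable {R : Type*} [CommRing R] (S : VertexModel R)

/-- The order of the colours enters the weights, so these are not symmetric under recolouring. But
the change of sign at each crossing is the quotient of the values of `orderSign` below and above it,
so the product over the word telescopes; at the top there is no strand and the value is $1$. -/
theorem transfer_relabel (σ : Equiv.Perm ℕ) (π : Equiv.Perm Label) (hπ : ∀ x, (π x).1 = σ x.1)
    (hbox : ∀ x, π x ∈ S.box ↔ x ∈ S.box) (w : Word Unit) (τ : ℕ → Option ℕ) (l : List Label)
    (u : List Unit) (hrun : Word.run w (strands l) = some u) (hl : ∀ x ∈ l, x ∈ S.box) :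
    S.transfer w vacuum (fun t => (τ t).map σ) (l.map π) =
      (orderSign σ (l.map Prod.fst) : R) * S.transfer w vacuum τ l := by
  have hsum : ∀ F : Label → R, ∑ x ∈ S.box, F x = ∑ x ∈ S.box, F (π x) := by
    intro F
    refine (Finset.sum_equiv π (fun x => (hbox x).symm) fun _ _ => rfl).symm
  induction w generalizing τ l with
  | nil =>
    cases l <;> simp [vacuum, orderSign]
  | cons L w ih =>
    obtain ⟨n, hv, hw⟩ := Word.run_cons_eq_some.1 hrun
    have ih : ∀ (τ : ℕ → Option ℕ) (m : List Label), m.length = n.length →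
        (∀ x ∈ m, x ∈ S.box) → S.transfer w vacuum (fun t => (τ t).map σ) (m.map π) =
          (orderSign σ (m.map Prod.fst) : R) * S.transfer w vacuum τ m := by
      intro τ m hm hm'
      apply ih τ m _ hm'
      rw [← hw]
      congr 1
      exact unit_list_ext (by simpa using hm)
    rcases L with ⟨P, i⟩ | ⟨t, i⟩
    · obtain ⟨h1, h2⟩ := Letter.act_piece_length _ _ _ _ hv
      simp only [List.length_map] at h1 h2
      rcases P with d | _ | o
      · obtain ⟨p, _, r, rfl, hp, hc⟩ := exists_split_append h1
        obtain rfl := List.length_eq_zero_iff.1 hc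
        simp only [transfer_cons, List.nil_append, List.map_append] at hl ⊢
        rw [S.step_cup _ _ _ _ _ _ (by simpa using hp), S.step_cup _ _ _ _ _ _ hp, hsum,
          Finset.mul_sum]
        refine Finset.sum_congr rfl fun x hx => ?_
        have := ih τ (p ++ x :: x :: r) (by
          simp [Piece.ins, Piece.outs] at h2 ⊢
          omega) (by
          intro y hy
          simp only [List.mem_append, List.mem_cons] at hy hl
          rcases hy with hy | rfl | rfl | hy
          exacts [hl y (.inl hy), hx, hx, hl y (.inr hy)])
        simp only [List.map_append, List.map_cons, orderSign_pair] at this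
        exact this
      · obtain ⟨p, x, y, r, rfl, hp⟩ := exists_split_two h1
        simp only [transfer_cons, List.map_append, List.map_cons]
        rw [S.step_cap _ _ _ _ _ _ _ (by simpa using hp), S.step_cap _ _ _ _ _ _ _ hp]
        simp only [EmbeddingLike.apply_eq_iff_eq]
        split_ifs with hxy
        · subst hxy
          have := ih τ (p ++ r) (by
            simp [Piece.ins, Piece.outs] at h2 ⊢
            omega) (fun z hz => hl z (by
              simp only [List.mem_append, List.mem_cons] at hz ⊢
              tauto))
          rw [orderSign_pair]
          simpa using this
        · simp
      · obtain ⟨p, x, y, r, rfl, hp⟩ := exists_split_two h1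
        have hx : x ∈ S.box := hl x (by simp)
        have hy : y ∈ S.box := hl y (by simp)
        have hlen : ∀ u v : Label, (p ++ u :: v :: r).length = n.length := by
          intro u v
          simp [Piece.ins, Piece.outs] at h2 ⊢
          omega
        have hmem : ∀ u ∈ S.box, ∀ v ∈ S.box, ∀ z ∈ p ++ u :: v :: r, z ∈ S.box := by
          intro u hu v hv z hz
          simp only [List.mem_append, List.mem_cons] at hz hl
          rcases hz with hz | rfl | rfl | hz
          exacts [hl z (.inl hz), hu, hv, hl z (.inr (.inr (.inr hz)))]
        simp only [transfer_cons, List.map_append, List.map_cons]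
        by_cases hxy : x.1 = y.1
        · rw [S.step_cross_same _ _ _ _ _ _ _ _ (by simpa using hp) ((hbox x).2 hx)
            ((hbox y).2 hy) (by rw [hπ, hπ, hxy]), S.step_cross_same _ _ _ _ _ _ _ _ hp hx hy hxy]
          simp only [EmbeddingLike.apply_eq_iff_eq]
          have h3 := ih τ (p ++ x :: y :: r) (hlen x y) (hmem x hx y hy)
          simp only [List.map_append, List.map_cons] at h3
          rw [h3, mul_add]
          congr 1
          · ring
          · split_ifs with hxy
            · subst hxy
              rw [← S.sum_box_color _ (S.mem_box.1 ((hbox x).2 hx)).1 (fun u =>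
                S.transfer w vacuum (fun t => (τ t).map σ) (p.map π ++ u :: u :: r.map π)),
                ← S.sum_box_color _ (S.mem_box.1 hx).1 (fun u =>
                S.transfer w vacuum τ (p ++ u :: u :: r)), hsum, mul_left_comm]
              congr 1
              rw [Finset.mul_sum]
              refine Finset.sum_congr rfl fun u hu => ?_
              have h4 := ih τ (p ++ u :: u :: r) (hlen u u) (hmem u hu u hu)
              simp only [List.map_append, List.map_cons, orderSign_pair] at h4
              simp only [hπ, EmbeddingLike.apply_eq_iff_eq, orderSign_pair, h4]
              split_ifs
              · rfl
              · simp
            · simp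
        · rw [S.step_cross_ne _ _ _ _ _ _ _ _ (by simpa using hp) ((hbox x).2 hx)
            ((hbox y).2 hy) (by rw [hπ, hπ]; exact fun e => hxy (σ.injective e)),
            S.step_cross_ne _ _ _ _ _ _ _ _ hp hx hy hxy]
          have h3 := ih τ (p ++ y :: x :: r) (hlen y x) (hmem y hy x hx)
          simp only [List.map_append, List.map_cons] at h3
          rw [h3, hπ, hπ, crossSign_perm σ o hxy]
          have h4 := orderSign_swap σ (p.map Prod.fst) (r.map Prod.fst) x.1 y.1
          have h5 := swapSign_mul_self σ y.1 x.1
          have h6 : crossSign o x.1 y.1 * (swapSign σ x.1 y.1 * swapSign σ y.1 x.1) *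
              orderSign σ (p.map Prod.fst ++ y.1 :: x.1 :: r.map Prod.fst) =
              orderSign σ (p.map Prod.fst ++ x.1 :: y.1 :: r.map Prod.fst) *
                crossSign o x.1 y.1 := by
            linear_combination (-crossSign o x.1 y.1 * swapSign σ y.1 x.1) * h4 +
              (crossSign o x.1 y.1 *
                orderSign σ (p.map Prod.fst ++ x.1 :: y.1 :: r.map Prod.fst)) * h5
          have h7 := congrArg (Int.cast : ℤ → R) h6
          push_cast at h7 ⊢
          linear_combination S.transfer w vacuum τ (p ++ y :: x :: r) * h7
    · obtain ⟨h1, rfl⟩ := Letter.act_foot _ _ _ _ hv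
      simp only [List.length_map] at h1
      obtain ⟨p, x, r, rfl, hp⟩ := exists_split_one h1
      have h3 := ih (Function.update τ t (some x.1)) (p ++ x :: r) (by simp) hl
      have h4 : (fun s => (Function.update τ t (some x.1) s).map σ) =
          Function.update (fun s => (τ s).map σ) t (some (σ x.1)) := by
        ext1 s
        by_cases hs : s = t
        · subst hs
          simp
        · simp [hs]
      rw [h4] at h3
      simp only [List.map_append, List.map_cons] at h3
      simp only [transfer_cons, List.map_append, List.map_cons]
      rw [S.step_foot _ _ _ _ _ _ _ (by simpa using hp), S.step_foot _ _ _ _ _ _ _ hp, hπ, h3]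
      have h5 : (Option.map σ (τ t) = none ∨ Option.map σ (τ t) = some (σ x.1)) ↔
          (τ t = none ∨ τ t = some x.1) := by
        cases τ t <;> simp
      simp only [h5]
      split_ifs
      · rfl
      · simp

/-- Relabelling by the transposition of `x` and `y` fixes all other strands and keeps all colours.
-/
theorem transfer_fresh_label (w : Word Unit) (τ : ℕ → Option ℕ) (p r : List Label) (x y : Label)
    (u : List Unit) (hrun : Word.run w (strands (p ++ x :: x :: r)) = some u)
    (hl : ∀ z ∈ p ++ r, z ∈ S.box) (hx : x ∈ S.box) (hy : y ∈ S.box) (hxy : x.1 = y.1)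
    (hx' : x ∉ p ++ r) (hy' : y ∉ p ++ r) :
    S.transfer w vacuum τ (p ++ y :: y :: r) = S.transfer w vacuum τ (p ++ x :: x :: r) := by
  have hfix : ∀ z, z ∈ p ++ r → Equiv.swap x y z = z := by
    intro z hz
    apply Equiv.swap_apply_of_ne_of_ne
    · rintro rfl
      exact hx' hz
    · rintro rfl
      exact hy' hz
  have h := S.transfer_relabel (Equiv.refl ℕ) (Equiv.swap x y) (fun z => by
      rcases eq_or_ne z x with rfl | h1
      · simp [hxy]
      rcases eq_or_ne z y with rfl | h2
      · simp [hxy]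
      rw [Equiv.swap_apply_of_ne_of_ne h1 h2]
      rfl) (fun z => by
      rcases eq_or_ne z x with rfl | h1
      · simp [hx, hy]
      rcases eq_or_ne z y with rfl | h2
      · simp [hx, hy]
      rw [Equiv.swap_apply_of_ne_of_ne h1 h2]) w τ (p ++ x :: x :: r) u hrun (fun z hz => by
        simp only [List.mem_append, List.mem_cons] at hz hl
        rcases hz with hz | rfl | rfl | hz
        exacts [hl z (.inl hz), hx, hx, hl z (.inr hz)])
  rw [orderSign_eq_one _ _ (by simp), Int.cast_one, one_mul] at h
  rw [← h]
  have e1 : p.map (Equiv.swap x y) = p := by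
    conv_rhs => rw [← List.map_id p]
    exact List.map_congr_left fun z hz => hfix z (by simp [hz])
  have e2 : r.map (Equiv.swap x y) = r := by
    conv_rhs => rw [← List.map_id r]
    exact List.map_congr_left fun z hz => hfix z (by simp [hz])
  simp [e1, e2]

/-- The transposition of two colours outside `C` fixes the colours of the ties and of the other
strands. The two neighbouring strands of colour `q` cancel in `orderSign`, so no sign remains. -/
theorem transfer_fresh_color (w : Word Unit) (τ : ℕ → Option ℕ) (p r : List Label) (q q' j : ℕ)
    (u : List Unit) (hrun : Word.run w (strands (p ++ (q, j) :: (q, j) :: r)) = some u)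
    (C : Finset ℕ) (hτ : ∀ t c, τ t = some c → c ∈ C) (hC : ∀ z ∈ p ++ r, z.1 ∈ C)
    (hl : ∀ z ∈ p ++ r, z ∈ S.box) (hq : q < S.colors) (hq' : q' < S.colors) (hj : j < S.size)
    (hqC : q ∉ C) (hqC' : q' ∉ C) :
    S.transfer w vacuum τ (p ++ (q', j) :: (q', j) :: r) =
      S.transfer w vacuum τ (p ++ (q, j) :: (q, j) :: r) := by
  set σ : Equiv.Perm ℕ := Equiv.swap q q' with hσ
  have hfix : ∀ c ∈ C, σ c = c := by
    intro c hc
    apply Equiv.swap_apply_of_ne_of_ne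
    · rintro rfl
      exact hqC hc
    · rintro rfl
      exact hqC' hc
  have h := S.transfer_relabel σ (Equiv.prodCongr σ (Equiv.refl ℕ)) (fun z => rfl) (fun z => by
      rw [mem_box, mem_box]
      refine and_congr ?_ Iff.rfl
      change σ z.1 < _ ↔ z.1 < _
      rcases eq_or_ne z.1 q with h1 | h1
      · simp [hσ, h1, hq, hq']
      rcases eq_or_ne z.1 q' with h2 | h2
      · simp [hσ, h2, hq, hq']
      rw [hσ, Equiv.swap_apply_of_ne_of_ne h1 h2]) w τ (p ++ (q, j) :: (q, j) :: r) u hrun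
      (fun z hz => by
        have hx : (q, j) ∈ S.box := S.mem_box.2 ⟨hq, hj⟩
        simp only [List.mem_append, List.mem_cons] at hz hl
        rcases hz with hz | rfl | rfl | hz
        exacts [hl z (.inl hz), hx, hx, hl z (.inr hz)])
  simp only [List.map_append, List.map_cons, orderSign_pair] at h
  rw [← List.map_append, orderSign_eq_one _ _ (by
    intro c hc
    obtain ⟨z, hz, rfl⟩ := List.mem_map.1 hc
    exact hfix _ (hC z hz)), Int.cast_one, one_mul] at h
  rw [← h]
  have e0 : (fun t => (τ t).map σ) = τ := by
    ext1 t
    cases ht : τ t with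
    | none => rfl
    | some c => simp [hfix c (hτ t c ht)]
  have e1 : p.map (Equiv.prodCongr σ (Equiv.refl ℕ)) = p := by
    conv_rhs => rw [← List.map_id p]
    exact List.map_congr_left fun z hz => Prod.ext (hfix z.1 (hC z (by simp [hz]))) rfl
  have e2 : r.map (Equiv.prodCongr σ (Equiv.refl ℕ)) = r := by
    conv_rhs => rw [← List.map_id r]
    exact List.map_congr_left fun z hz => Prod.ext (hfix z.1 (hC z (by simp [hz]))) rfl
  rw [e0, e1, e2]
  simp [hσ]

end VertexModel

/-! ### Polynomiality of the partition function -/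

namespace VertexModel

variable {R : Type*} [CommRing R] (S : VertexModel R)

/-- The specialization of the variables that belongs to a vertex model. -/
noncomputable def eval : BracketRing →+* R :=
  Polynomial.eval₂RingHom (LaurentPolynomial.eval₂ (Int.castRingHom R) S.a) (S.colors * S.size)

/-! ### Values of the specialization -/

theorem map_eval_varA : Units.map (S.eval : BracketRing →* R) varA = S.a := by
  ext
  simp [eval, varA, LaurentPolynomial.eval₂_T]

theorem eval_zpow_varA (n : ℤ) : S.eval ((varA ^ n : BracketRingˣ) : BracketRing) =
    ((S.a ^ n : Rˣ) : R) := by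
  rw [← S.map_eval_varA, ← map_zpow]
  rfl

theorem eval_varA : S.eval (varA : BracketRing) = S.a := by
  simpa using S.eval_zpow_varA 1

theorem eval_inv_varA : S.eval ((varA⁻¹ : BracketRingˣ) : BracketRing) = ((S.a⁻¹ : Rˣ) : R) := by
  simpa using S.eval_zpow_varA (-1)

theorem eval_varC : S.eval varC = S.colors * S.size := by
  simp [eval, varC]

/-- The value of a circle that is tied to the rest of the diagram. -/
noncomputable def loopValue : BracketRing :=
  -((varA ^ 2 : BracketRingˣ) + (varA ^ (-2 : ℤ) : BracketRingˣ) : BracketRing)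

theorem eval_loopValue : S.eval loopValue = S.size := by
  have h1 := S.eval_zpow_varA 2
  have h2 := S.eval_zpow_varA (-2)
  have h3 := S.loop
  rw [loopValue, map_neg, map_add, h2]
  -- The square in `loopValue` has a natural exponent, that in `h1` an integral one; they agree by
  -- definition.
  erw [h1]
  have e1 : ((S.a ^ (2 : ℤ) : Rˣ) : R) = (S.a : R) ^ 2 := by
    rw [zpow_ofNat, Units.val_pow_eq_pow_val]
  have e2 : ((S.a ^ (-2 : ℤ) : Rˣ) : R) = ((S.a⁻¹ : Rˣ) : R) ^ 2 := by
    rw [zpow_neg, zpow_ofNat, ← inv_pow, Units.val_pow_eq_pow_val]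
  rw [e1, e2, h3, neg_neg]

/-- A property holds for all vertex models with enough colours and labels. -/
def Eventually (p : VertexModel R → Prop) : Prop :=
  ∃ K, ∀ S : VertexModel R, K ≤ S.colors → K ≤ S.size → p S

theorem Eventually.mono {p q : VertexModel R → Prop} (hp : Eventually p) (h : ∀ S, p S → q S) :
    Eventually q := by
  obtain ⟨K, hK⟩ := hp
  exact ⟨K, fun S h1 h2 => h S (hK S h1 h2)⟩

theorem Eventually.and {p q : VertexModel R → Prop} (hp : Eventually p) (hq : Eventually q) :
    Eventually fun S => p S ∧ q S := by
  obtain ⟨K, hK⟩ := hp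
  obtain ⟨L, hL⟩ := hq
  exact ⟨max K L, fun S h1 h2 => ⟨hK S (le_trans (le_max_left _ _) h1)
    (le_trans (le_max_left _ _) h2), hL S (le_trans (le_max_right _ _) h1)
    (le_trans (le_max_right _ _) h2)⟩⟩

theorem Eventually.of_forall {p : VertexModel R → Prop} (h : ∀ S, p S) : Eventually p :=
  ⟨0, fun S _ _ => h S⟩

theorem eventually_mem_box (x : Label) : Eventually fun S : VertexModel R => x ∈ S.box :=
  ⟨max (x.1 + 1) (x.2 + 1), fun S h1 h2 => S.mem_box.2 ⟨by omega, by omega⟩⟩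

theorem eventually_forall_mem {ι : Type*} (s : Finset ι) {p : ι → VertexModel R → Prop}
    (h : ∀ i ∈ s, Eventually (p i)) : Eventually fun S => ∀ i ∈ s, p i S := by
  classical
  induction s using Finset.induction_on with
  | empty => exact .of_forall fun S i hi => by simp at hi
  | insert i s _ ih =>
    refine ((h i (by simp)).and (ih fun j hj => h j (by simp [hj]))).mono ?_
    rintro S ⟨h1, h2⟩ j hj
    rcases Finset.mem_insert.1 hj with rfl | hj
    exacts [h1, h2 j hj]

/-- A function on vertex models is given by a polynomial. -/
def IsPoly (F : VertexModel R → R) : Prop :=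
  ∃ P : BracketRing, Eventually fun S => F S = S.eval P

theorem IsPoly.congr {F G : VertexModel R → R} (hF : IsPoly F) (h : Eventually fun S => G S = F S) :
    IsPoly G := by
  obtain ⟨P, hP⟩ := hF
  exact ⟨P, (hP.and h).mono fun S hS => hS.2.trans hS.1⟩

theorem IsPoly.eval (P : BracketRing) : IsPoly fun S : VertexModel R => S.eval P :=
  ⟨P, .of_forall fun _ => rfl⟩

theorem IsPoly.add {F G : VertexModel R → R} (hF : IsPoly F) (hG : IsPoly G) :
    IsPoly fun S => F S + G S := by
  obtain ⟨P, hP⟩ := hF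
  obtain ⟨Q, hQ⟩ := hG
  exact ⟨P + Q, (hP.and hQ).mono fun S hS => by simp only [map_add, ← hS.1, ← hS.2]⟩

theorem IsPoly.mul {F G : VertexModel R → R} (hF : IsPoly F) (hG : IsPoly G) :
    IsPoly fun S => F S * G S := by
  obtain ⟨P, hP⟩ := hF
  obtain ⟨Q, hQ⟩ := hG
  exact ⟨P * Q, (hP.and hQ).mono fun S hS => by simp only [map_mul, ← hS.1, ← hS.2]⟩

theorem IsPoly.sum {ι : Type*} (s : Finset ι) {F : ι → VertexModel R → R}
    (hF : ∀ i ∈ s, IsPoly (F i)) : IsPoly fun S => ∑ i ∈ s, F i S := by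
  classical
  induction s using Finset.induction_on with
  | empty => exact (IsPoly.eval 0).congr (.of_forall fun S => by simp)
  | insert i s hi ih =>
    refine ((hF i (by simp)).add (ih fun j hj => hF j (by simp [hj]))).congr
      (.of_forall fun S => ?_)
    rw [Finset.sum_insert hi]

theorem isPoly_intCast (n : ℤ) : IsPoly fun _ : VertexModel R => (n : R) :=
  (IsPoly.eval n).congr (.of_forall fun S => by simp)

theorem isPoly_vert (o : Bool) : IsPoly fun S : VertexModel R => S.vert o := by
  cases o
  · exact (IsPoly.eval _).congr (.of_forall fun S => (S.eval_inv_varA).symm)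
  · exact (IsPoly.eval _).congr (.of_forall fun S => (S.eval_varA).symm)

/-- The size is no independent parameter: by the loop relation it is $-(a^2+a^{-2})$. -/
theorem isPoly_size : IsPoly fun S : VertexModel R => (S.size : R) :=
  (IsPoly.eval _).congr (.of_forall fun S => (S.eval_loopValue).symm)

/-- The variable $c$ stands for this product. Colours are therefore always counted together with
their labels. -/
theorem isPoly_colors_mul_size : IsPoly fun S : VertexModel R => (S.colors * S.size : R) :=
  (IsPoly.eval _).congr (.of_forall fun S => (S.eval_varC).symm)

/-- A sum over all labels of one colour, all but finitely many of which have the same weight. -/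
theorem isPoly_sum_size (F : VertexModel R → ℕ → R) (J : Finset ℕ)
    (hF : ∀ j, IsPoly fun S => F S j)
    (h : Eventually fun S => ∀ i j, i < S.size → j < S.size → i ∉ J → j ∉ J → F S i = F S j) :
    IsPoly fun S => ∑ j ∈ Finset.range S.size, F S j := by
  obtain ⟨k, hk⟩ := Infinite.exists_notMem_finset J
  have hJ : Eventually fun S : VertexModel R => ∀ j ∈ insert k J, ((0, j) : Label) ∈ S.box :=
    eventually_forall_mem _ fun j _ => eventually_mem_box (0, j)
  -- The exceptional terms are added one by one; the other `size - J.card` terms all equal the one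
  -- at `k`.
  refine ((IsPoly.sum J fun j _ => hF j).add
    ((isPoly_size.add (isPoly_intCast (-J.card))).mul (hF k))).congr ((h.and hJ).mono ?_)
  rintro S ⟨h, hJ⟩
  have hsub : J ⊆ Finset.range S.size := fun j hj =>
    Finset.mem_range.2 (S.mem_box.1 (hJ j (by simp [hj]))).2
  have hk' := (S.mem_box.1 (hJ k (by simp))).2
  rw [← Finset.sum_sdiff hsub, Finset.sum_congr rfl fun j hj => h j k
    (Finset.mem_range.1 (Finset.mem_sdiff.1 hj).1) hk' (Finset.mem_sdiff.1 hj).2 hk,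
    Finset.sum_const, Finset.card_sdiff_of_subset hsub, Finset.card_range, nsmul_eq_mul,
    Nat.cast_sub (by simpa using Finset.card_le_card hsub)]
  push_cast
  ring

/-- A sum over all labels, all of which but those of finitely many colours have the same weight. -/
theorem isPoly_sum_box (F : VertexModel R → Label → R) (C : Finset ℕ)
    (hF : ∀ x, IsPoly fun S => F S x)
    (hC : ∀ q ∈ C, IsPoly fun S => ∑ j ∈ Finset.range S.size, F S (q, j))
    (h : Eventually fun S => ∀ x ∈ S.box, ∀ y ∈ S.box, x.1 ∉ C → y.1 ∉ C → F S x = F S y) :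
    IsPoly fun S => ∑ x ∈ S.box, F S x := by
  obtain ⟨k, hk⟩ := Infinite.exists_notMem_finset C
  have hJ : Eventually fun S : VertexModel R => ∀ q ∈ insert k C, ((q, 0) : Label) ∈ S.box :=
    eventually_forall_mem _ fun j _ => eventually_mem_box (j, 0)
  -- The exceptional colours are added one by one. All other labels, `colors * size - C.card * size`
  -- in number, have the weight of the label `(k, 0)`.
  refine ((IsPoly.sum C hC).add ((isPoly_colors_mul_size.add
    ((isPoly_intCast (-C.card)).mul isPoly_size)).mul (hF (k, 0)))).congr ((h.and hJ).mono ?_)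
  rintro S ⟨h, hJ⟩
  have hsub : C ⊆ Finset.range S.colors := fun j hj =>
    Finset.mem_range.2 (S.mem_box.1 (hJ j (by simp [hj]))).1
  have hk' := hJ k (by simp)
  rw [box, Finset.sum_product, ← Finset.sum_sdiff hsub,
    Finset.sum_congr rfl fun q hq => Finset.sum_congr rfl fun j hj => h (q, j)
      (Finset.mem_product.2 ⟨(Finset.mem_sdiff.1 hq).1, hj⟩) (k, 0) hk' (Finset.mem_sdiff.1 hq).2 hk,
    Finset.sum_const, Finset.sum_const, Finset.card_sdiff_of_subset hsub, Finset.card_range,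
    Finset.card_range, nsmul_eq_mul, nsmul_eq_mul,
    Nat.cast_sub (by simpa using Finset.card_le_card hsub)]
  push_cast
  ring

theorem isPoly_sum_fresh_label (w : Word Unit) (τ : ℕ → Option ℕ) (p r : List Label) (q : ℕ)
    (u : List Unit) (hrun : ∀ x, Word.run w (strands (p ++ x :: x :: r)) = some u)
    (hF : ∀ x, IsPoly fun S : VertexModel R => S.transfer w vacuum τ (p ++ x :: x :: r)) :
    IsPoly fun S : VertexModel R =>
      ∑ j ∈ Finset.range S.size, S.transfer w vacuum τ (p ++ (q, j) :: (q, j) :: r) := by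
  classical
  refine isPoly_sum_size _ ((p ++ r).toFinset.image Prod.snd) (fun j => hF (q, j)) ?_
  have h1 : Eventually fun S : VertexModel R =>
      ∀ x ∈ insert (q, 0) (p ++ r).toFinset, x ∈ S.box :=
    eventually_forall_mem _ fun j _ => eventually_mem_box j
  refine h1.mono fun S hS i j hi hj hi' hj' => ?_
  have hq := (S.mem_box.1 (hS (q, 0) (by simp))).1
  have hl : ∀ z ∈ p ++ r, z ∈ S.box := fun z hz => hS z (by simp at hz ⊢; tauto)
  have hnot : ∀ k, k ∉ (p ++ r).toFinset.image Prod.snd → (q, k) ∉ p ++ r := by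
    intro k hk hk'
    exact hk (Finset.mem_image.2 ⟨(q, k), by simpa using hk', rfl⟩)
  exact S.transfer_fresh_label w τ p r (q, j) (q, i) u (hrun _) hl (S.mem_box.2 ⟨hq, hj⟩)
    (S.mem_box.2 ⟨hq, hi⟩) rfl (hnot j hj') (hnot i hi')

theorem transfer_fresh (w : Word Unit) (τ : ℕ → Option ℕ) (p r : List Label) (x y : Label)
    (u : List Unit) (hrun : ∀ x, Word.run w (strands (p ++ x :: x :: r)) = some u)
    (C : Finset ℕ) (hτ : ∀ t c, τ t = some c → c ∈ C) (hC : ∀ z ∈ p ++ r, z.1 ∈ C)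
    (hl : ∀ z ∈ p ++ r, z ∈ S.box) (hx : x ∈ S.box) (hy : y ∈ S.box)
    (hx' : x.1 ∉ C) (hy' : y.1 ∉ C) :
    S.transfer w vacuum τ (p ++ y :: y :: r) = S.transfer w vacuum τ (p ++ x :: x :: r) := by
  obtain ⟨q, i⟩ := x
  obtain ⟨q', j⟩ := y
  obtain ⟨hq, hi⟩ := S.mem_box.1 hx
  obtain ⟨hq', hj⟩ := S.mem_box.1 hy
  rw [S.transfer_fresh_color w τ p r q q' j u (hrun _) C hτ hC hl hq hq' hj hx' hy']
  exact S.transfer_fresh_label w τ p r (q, i) (q, j) u (hrun _) hl hx (S.mem_box.2 ⟨hq, hj⟩) rfl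
    (fun h => hx' (hC (q, i) h)) (fun h => hx' (hC (q, j) h))

/-- The state is fixed while the model varies, and `C` contains the colours in use. A minimum sums
over new labels: those of a colour outside `C` are interchangeable, and in a colour of `C` so are
all labels but finitely many. Thus the number of terms enters only through `size` and `colors *
size`. The smoothings of a crossing are treated in the same way within one colour. -/
theorem isPoly_transfer (w : Word Unit) (τ : ℕ → Option ℕ) (l : List Label) (u : List Unit)
    (hrun : Word.run w (strands l) = some u) (C : Finset ℕ) (hτ : ∀ t c, τ t = some c → c ∈ C)
    (hC : ∀ z ∈ l, z.1 ∈ C) : IsPoly fun S : VertexModel R => S.transfer w vacuum τ l := by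
  classical
  induction w generalizing τ l C with
  | nil =>
    exact (isPoly_intCast (if l = [] then 1 else 0)).congr (.of_forall fun S => by
      simp [vacuum])
  | cons L w ih =>
    obtain ⟨n, hv, hw⟩ := Word.run_cons_eq_some.1 hrun
    have hw' : ∀ m : List Label, m.length = n.length → Word.run w (strands m) = some u := by
      intro m hm
      rw [← hw]
      congr 1
      exact unit_list_ext (by simpa using hm)
    rcases L with ⟨P, i⟩ | ⟨t, i⟩
    · obtain ⟨h1, h2⟩ := Letter.act_piece_length _ _ _ _ hv
      simp only [List.length_map] at h1 h2
      rcases P with d | _ | o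
      · obtain ⟨p, _, r, rfl, hp, hc⟩ := exists_split_append h1
        obtain rfl := List.length_eq_zero_iff.1 hc
        simp only [transfer_cons, List.nil_append] at hC ⊢
        have hr : ∀ x, Word.run w (strands (p ++ x :: x :: r)) = some u := fun x => hw' _ (by
          simp [Piece.ins, Piece.outs] at h2 ⊢
          omega)
        have hF : ∀ x, IsPoly fun S : VertexModel R => S.transfer w vacuum τ (p ++ x :: x :: r) :=
          fun x => ih τ _ (hr x) (insert x.1 C)
            (fun t c h => Finset.mem_insert_of_mem (hτ t c h)) (by
              intro z hz
              simp only [List.mem_append, List.mem_cons] at hz hC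
              rcases hz with hz | rfl | rfl | hz
              exacts [Finset.mem_insert_of_mem (hC z (.inl hz)), Finset.mem_insert_self _ _,
                Finset.mem_insert_self _ _, Finset.mem_insert_of_mem (hC z (.inr hz))])
        have hG := isPoly_sum_box (fun S x => S.transfer w vacuum τ (p ++ x :: x :: r)) C hF
          (fun q _ => isPoly_sum_fresh_label w τ p r q u hr hF) (by
            have h1 : Eventually fun S : VertexModel R => ∀ x ∈ (p ++ r).toFinset, x ∈ S.box :=
              eventually_forall_mem _ fun j _ => eventually_mem_box j
            refine h1.mono fun S hS x hx y hy hx' hy' => ?_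
            exact S.transfer_fresh w τ p r y x u hr C hτ hC
              (fun z hz => hS z (by simpa using hz)) hy hx hy' hx')
        exact hG.congr (.of_forall fun S => S.step_cup _ _ _ _ _ _ hp)
      · obtain ⟨p, x, y, r, rfl, hp⟩ := exists_split_two h1
        by_cases hxy : x = y
        · have := ih τ (p ++ r) (hw' _ (by
            simp [Piece.ins, Piece.outs] at h2 ⊢
            omega)) C hτ (fun z hz => hC z (by
              simp only [List.mem_append, List.mem_cons] at hz ⊢
              tauto))
          exact this.congr (.of_forall fun S => by
            rw [transfer_cons, S.step_cap _ _ _ _ _ _ _ hp, if_pos hxy])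
        · exact (IsPoly.eval 0).congr (.of_forall fun S => by
            rw [transfer_cons, S.step_cap _ _ _ _ _ _ _ hp, if_neg hxy, map_zero])
      · obtain ⟨p, x, y, r, rfl, hp⟩ := exists_split_two h1
        have hr : ∀ u' v' : Label, Word.run w (strands (p ++ u' :: v' :: r)) = some u :=
          fun u' v' => hw' _ (by
            simp [Piece.ins, Piece.outs] at h2 ⊢
            omega)
        have hbox := (eventually_mem_box (R := R) x).and (eventually_mem_box y)
        have hmem : ∀ u' v' : Label, ∀ z ∈ p ++ u' :: v' :: r,
            z.1 ∈ insert u'.1 (insert v'.1 C) := by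
          intro u' v' z hz
          simp only [List.mem_append, List.mem_cons, Finset.mem_insert] at hz hC ⊢
          rcases hz with hz | rfl | rfl | hz
          exacts [.inr (.inr (hC z (.inl hz))), .inl rfl, .inr (.inl rfl),
            .inr (.inr (hC z (.inr (.inr (.inr hz)))))]
        have hF : ∀ u' v', IsPoly fun S : VertexModel R =>
            S.transfer w vacuum τ (p ++ u' :: v' :: r) := fun u' v' =>
          ih τ _ (hr u' v') _ (fun t c h => Finset.mem_insert_of_mem
            (Finset.mem_insert_of_mem (hτ t c h))) (hmem u' v')
        by_cases hxy : x.1 = y.1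
        · have hG : IsPoly fun S : VertexModel R =>
              if x = y then ∑ j ∈ Finset.range S.size,
                S.transfer w vacuum τ (p ++ (x.1, j) :: (x.1, j) :: r) else 0 := by
            split_ifs
            · exact isPoly_sum_fresh_label w τ p r x.1 u (fun x => hr x x) (fun x => hF x x)
            · exact (IsPoly.eval 0).congr (.of_forall fun S => by simp)
          exact (((isPoly_vert o).mul (hF x y)).add ((isPoly_vert (!o)).mul hG)).congr
            (hbox.mono fun S hS => S.step_cross_same _ _ _ _ _ _ _ _ hp hS.1 hS.2 hxy)
        · exact ((isPoly_intCast _).mul (hF y x)).congr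
            (hbox.mono fun S hS => S.step_cross_ne _ _ _ _ _ _ _ _ hp hS.1 hS.2 hxy)
    · obtain ⟨h1, rfl⟩ := Letter.act_foot _ _ _ _ hv
      simp only [List.length_map] at h1
      obtain ⟨p, x, r, rfl, hp⟩ := exists_split_one h1
      by_cases hτ' : τ t = none ∨ τ t = some x.1
      · have := ih (Function.update τ t (some x.1)) _ hw C (by
          intro s c hs
          by_cases hst : s = t
          · subst hst
            obtain rfl : x.1 = c := by simpa using hs
            exact hC x (by simp)
          · exact hτ s c (by simpa [hst] using hs)) hC
        exact this.congr (.of_forall fun S => by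
          rw [transfer_cons, S.step_foot _ _ _ _ _ _ _ hp, if_pos hτ'])
      · exact (IsPoly.eval 0).congr (.of_forall fun S => by
          rw [transfer_cons, S.step_foot _ _ _ _ _ _ _ hp, if_neg hτ', map_zero])

/-- There is no strand at the bottom, and a minimum is the only letter that needs none. -/
theorem _root_.TiedLink.Diagram.exists_eq_cup_cons (D : UnorientedDiagram) :
    ∃ d w, D.word = cup 0 d :: w ∧ Word.run w [(), ()] = some [] := by
  match hw : D.word with
  | [] => exact absurd hw D.nonempty
  | L :: w =>
    have := D.closed
    rw [hw] at this
    obtain ⟨n, hv, hw⟩ := Word.run_cons_eq_some.1 this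
    rcases L with ⟨P, i⟩ | ⟨t, i⟩
    · have h := Letter.act_piece_length _ _ _ _ hv
      rcases P with d | _ | o
      · simp only [Piece.ins, Piece.outs, List.length_nil] at h
        obtain rfl : i = 0 := by omega
        obtain rfl : n = [(), ()] := unit_list_ext (by simpa using h.2)
        exact ⟨d, w, rfl, hw⟩
      · simp [Piece.ins] at h
      · simp [Piece.ins] at h
    · simpa using (Letter.act_foot _ _ _ _ hv).1

/-- The partition function of a non-empty diagram is divisible by the value of a circle. -/
theorem exists_partitionFn_eq (D : UnorientedDiagram) :
    ∃ P : BracketRing, Eventually fun S : VertexModel R =>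
      S.partitionFn D.word = S.colors * S.size * S.eval P := by
  obtain ⟨d, w, hw, hrun⟩ := Diagram.exists_eq_cup_cons D
  have hr : ∀ x : Label, Word.run w (strands ([] ++ x :: x :: [])) = some [] := fun _ => hrun
  obtain ⟨P, hP⟩ := isPoly_transfer (R := R) w (fun _ => none) [(0, 0), (0, 0)] [] hrun {0}
    (by simp) (by simp)
  refine ⟨P, (hP.and (eventually_mem_box (0, 0))).mono fun S hS => ?_⟩
  have h := S.step_cup 0 d (S.transfer w vacuum) (fun _ => none) [] [] rfl
  simp only [List.append_nil, List.nil_append] at h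
  -- Above the first minimum there is no other strand and no coloured tie, so no label is
  -- exceptional and each of the `colors * size` labels contributes the same.
  have h' : ∀ x ∈ S.box, S.transfer w vacuum (fun _ => none) [x, x] = S.eval P := fun x hx =>
    (S.transfer_fresh w (fun _ => none) [] [] (0, 0) x [] hr ∅ (by simp) (by simp) (by simp) hS.2
      hx (by simp) (by simp)).trans hS.1
  rw [partitionFn, hw, transfer_cons, h, Finset.sum_congr rfl h', Finset.sum_const, nsmul_eq_mul]
  simp only [box, Finset.card_product, Finset.card_range, Nat.cast_mul]

end VertexModel

/-! ### Specializations in the complex numbers -/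

theorem exists_complex_loop (n : ℕ) :
    ∃ a : ℂˣ, (a : ℂ) ^ 2 + (↑a⁻¹ : ℂ) ^ 2 = -(n : ℂ) := by
  -- The square of `a` has to be a root of $z^2+nz+1$; here `s` is a square root of the
  -- discriminant.
  obtain ⟨s, hs⟩ := IsAlgClosed.exists_pow_nat_eq ((n : ℂ) ^ 2 - 4) (n := 2) (by norm_num)
  obtain ⟨a, ha⟩ := IsAlgClosed.exists_pow_nat_eq ((s - n) / 2) (n := 2) (by norm_num)
  have h0 : a ^ 2 * (a ^ 2 + n) = -1 := by
    rw [ha]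
    linear_combination hs / 4
  have ha0 : a ≠ 0 := by
    rintro rfl
    norm_num at h0
  refine ⟨Units.mk0 a ha0, ?_⟩
  simp only [Units.val_mk0, Units.val_inv_eq_inv_val]
  field_simp
  linear_combination h0

/-- A vertex model over the complex numbers with given numbers of colours and labels. -/
noncomputable def complexModel (N M : ℕ) : VertexModel ℂ where
  a := (exists_complex_loop M).choose
  colors := N
  size := M
  loop := (exists_complex_loop M).choose_spec

/-- A power of the variable turns `f` into an ordinary polynomial, which then has infinitely many
complex roots. -/
theorem laurentPolynomial_eq_zero (f : LaurentPolynomial ℤ)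
    (a : ℕ → ℂˣ) (ha : Function.Injective a) (K : ℕ)
    (h : ∀ n, K ≤ n → LaurentPolynomial.eval₂ (Int.castRingHom ℂ) (a n) f = 0) : f = 0 := by
  obtain ⟨n, p, hp⟩ := f.exists_T_pow
  have hp0 : p.map (Int.castRingHom ℂ) = 0 := by
    apply Polynomial.eq_zero_of_infinite_isRoot
    have hinf : (Set.range fun k => ((a (K + k) : ℂˣ) : ℂ)).Infinite := by
      apply Set.infinite_range_of_injective
      intro i j hij
      exact Nat.add_left_cancel (ha (Units.ext hij))
    refine hinf.mono ?_
    rintro _ ⟨k, rfl⟩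
    have := congrArg (LaurentPolynomial.eval₂ (Int.castRingHom ℂ) (a (K + k))) hp
    rw [LaurentPolynomial.eval₂_toLaurent, map_mul, h _ (by omega), zero_mul] at this
    rwa [Set.mem_ofPred_eq, Polynomial.IsRoot, Polynomial.eval_map]
  have hp0 : p = 0 := (Polynomial.map_eq_zero_iff (RingHom.injective_int _)).1 hp0
  rw [hp0, map_zero] at hp
  have hT := (LaurentPolynomial.isUnit_T (R := ℤ) (n : ℤ))
  exact (hT.mul_left_eq_zero).1 hp.symm

/-- The loop relation recovers the size from `a`. The number of colours plays no role in the choice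
of `a`, so $0$ serves. -/
theorem complexModel_a_injective : Function.Injective fun M => (complexModel 0 M).a := by
  intro i j hij
  have h1 := (complexModel 0 i).loop
  have h2 := (complexModel 0 j).loop
  simp only at hij
  rw [hij, h2] at h1
  simpa [complexModel, eq_comm] using h1

/-- For a fixed size $M\neq0$ the values $NM$ of $c$ are infinite in number, so every coefficient of
a power of $c$ vanishes at the value of $A$ belonging to $M$. These values are infinite in number as
well, so the coefficients are zero. -/
theorem eq_zero_of_eval_complexModel (P : BracketRing) (K : ℕ)
    (h : ∀ N M, K ≤ N → K ≤ M → (complexModel N M).eval P = 0) : P = 0 := by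
  ext1 k
  rw [Polynomial.coeff_zero]
  apply laurentPolynomial_eq_zero _ _ complexModel_a_injective (max K 1)
  intro M hM
  have hM0 : (M : ℂ) ≠ 0 := by
    have : M ≠ 0 := by omega
    exact_mod_cast this
  set φ := LaurentPolynomial.eval₂ (Int.castRingHom ℂ) (complexModel 0 M).a with hφ
  have hP : P.map φ = 0 := by
    apply Polynomial.eq_zero_of_infinite_isRoot
    have hinf : (Set.range fun j : ℕ => (((K + j : ℕ) : ℂ) * M)).Infinite := by
      apply Set.infinite_range_of_injective
      intro i j hij
      have := mul_right_cancel₀ hM0 hij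
      have : K + i = K + j := by exact_mod_cast this
      omega
    refine hinf.mono ?_
    rintro _ ⟨j, rfl⟩
    have := h (K + j) M (by omega) (by omega)
    rw [Set.mem_ofPred_eq, Polynomial.IsRoot, Polynomial.eval_map]
    -- The unit of `complexModel (K + j) M` is by definition that of `complexModel 0 M`.
    exact this
  have := congrArg (fun Q => Polynomial.coeff Q k) hP
  simpa [Polynomial.coeff_map] using this

/-! ### Existence of a tied bracket -/

namespace VertexModel

variable {R : Type*} [CommRing R] (S : VertexModel R)

theorem transfer_linear (w : Word Unit) (f g : StateFun R) (c d : R) (τ : ℕ → Option ℕ)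
    (l : List Label) :
    S.transfer w (fun τ l => c * f τ l + d * g τ l) τ l =
      c * S.transfer w f τ l + d * S.transfer w g τ l := by
  induction w generalizing τ l with
  | nil => rfl
  | cons L w ih =>
    rcases L with ⟨P, i⟩ | ⟨t, i⟩
    · simp only [transfer_cons, step, ih, Finset.mul_sum, ← Finset.sum_add_distrib]
      exact Finset.sum_congr rfl fun b _ => by ring
    · simp only [transfer_cons, step]
      split
      · simp
      · split_ifs
        · exact ih _ _
        · simp

theorem transfer_const_mul (w : Word Unit) (f : StateFun R) (c : R) (τ : ℕ → Option ℕ)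
    (l : List Label) :
    S.transfer w (fun τ l => c * f τ l) τ l = c * S.transfer w f τ l := by
  simpa using S.transfer_linear w f f c 0 τ l

theorem transfer_update_of_fresh (w : Word Unit) (f : StateFun R) (τ : ℕ → Option ℕ)
    (l : List Label) (t : ℕ) (c : Option ℕ) (ht : Fresh t w)
    (hf : ∀ τ l, f (Function.update τ t c) l = f τ l) :
    S.transfer w f (Function.update τ t c) l = S.transfer w f τ l := by
  induction w generalizing τ l with
  | nil => exact hf τ l
  | cons L w ih =>
    have ht' : Fresh t w := fun i hi => ht i (by simp [hi])
    rcases L with ⟨P, i⟩ | ⟨s, i⟩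
    · simp only [transfer_cons, step, fun τ l => ih τ l ht']
    · have hst : s ≠ t := by
        rintro rfl
        exact ht i (by simp [foot])
      simp only [transfer_cons, step, Function.update_of_ne hst]
      split
      · rfl
      · rw [Function.update_comm hst.symm, ih _ _ ht']

/-- If the colour of `t` is prescribed beforehand, only the colour found at the first end of `t`
gives a nonzero term, and this term is the original value. -/
theorem transfer_eq_sum_update (w : Word Unit) (f : StateFun R) (τ : ℕ → Option ℕ)
    (l : List Label) (t j : ℕ) (u : List Unit) (hrun : Word.run w (strands l) = some u)
    (hl : ∀ x ∈ l, x ∈ S.box) (ht : foot t j ∈ w) (hτ : τ t = none) :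
    S.transfer w f τ l =
      ∑ c ∈ Finset.range S.colors, S.transfer w f (Function.update τ t (some c)) l := by
  induction w generalizing τ l with
  | nil => simp at ht
  | cons L w ih =>
    obtain ⟨n, hv, hw⟩ := Word.run_cons_eq_some.1 hrun
    rcases L with ⟨P, i⟩ | ⟨s, i⟩
    · have ht' : foot t j ∈ w := by simpa [foot] using ht
      obtain ⟨h1, h2⟩ := Letter.act_piece_length _ _ _ _ hv
      simp only [List.length_map] at h1 h2
      simp only [transfer_cons, step]
      rw [Finset.sum_comm]
      refine Finset.sum_congr rfl fun b hb => ?_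
      obtain ⟨hb, hb'⟩ := S.mem_lists.1 hb
      rw [← Finset.mul_sum, ih _ _ _ _ ht' hτ]
      · rw [← hw]
        congr 1
        apply unit_list_ext
        simp
        omega
      · intro x hx
        simp only [List.mem_append] at hx
        rcases hx with (hx | hx) | hx
        exacts [hl x (List.mem_of_mem_take hx), hb' x hx, hl x (List.mem_of_mem_drop hx)]
    · obtain ⟨h1, rfl⟩ := Letter.act_foot _ _ _ _ hv
      simp only [List.length_map] at h1
      obtain ⟨p, x, r, rfl, hp⟩ := exists_split_one h1
      simp only [transfer_cons]
      rw [S.step_foot _ _ _ _ _ _ _ hp]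
      simp only [S.step_foot _ _ _ _ _ _ _ hp]
      by_cases hst : s = t
      · subst hst
        have hx := Finset.mem_range.2 (S.mem_box.1 (hl x (by simp))).1
        simp [hτ, hx]
      · have ht' : foot t j ∈ w := by
          simp only [foot, List.mem_cons, Letter.foot.injEq] at ht
          rcases ht with ht | ht
          · exact absurd ht.1.symm hst
          · exact ht
        simp only [Function.update_of_ne hst]
        split_ifs with h
        · rw [ih _ _ hw hl ht' (by rwa [Function.update_of_ne (Ne.symm hst)])]
          exact Finset.sum_congr rfl fun c _ => by rw [Function.update_comm hst]
        · simp

/-! ### Circles, ties and smoothings under the transfer operators -/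

theorem transfer_circle (i : ℕ) (f : StateFun R) (τ : ℕ → Option ℕ) (l : List Label)
    (hi : i ≤ l.length) :
    S.transfer [cup i (), cap i] f τ l = S.colors * S.size * f τ l := by
  obtain ⟨p, c, r, rfl, hp, hc⟩ := exists_split_append (l := l) (i := i) (n := 0) (by omega)
  obtain rfl := List.length_eq_zero_iff.1 hc
  simp only [transfer_cons, List.nil_append]
  rw [S.step_cup _ _ _ _ _ _ hp]
  simp only [S.step_cap _ _ _ _ _ _ _ hp]
  simp [box]

/-- If `t` has a colour already, the circle has `size` labels. Otherwise the circle chooses the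
colour, and `hf` says that summing over this choice imposes nothing on the rest. -/
theorem transfer_tied_circle (i t : ℕ) (f : StateFun R) (τ : ℕ → Option ℕ) (l : List Label)
    (hi : i ≤ l.length) (hτ : ∀ c, τ t = some c → c < S.colors)
    (hf : τ t = none → f τ l = ∑ c ∈ Finset.range S.colors, f (Function.update τ t (some c)) l) :
    S.transfer [cup i (), foot t i, cap i] f τ l = S.size * f τ l := by
  obtain ⟨p, c, r, rfl, hp, hc⟩ := exists_split_append (l := l) (i := i) (n := 0) (by omega)
  obtain rfl := List.length_eq_zero_iff.1 hc
  simp only [transfer_cons, List.nil_append] at hf ⊢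
  rw [S.step_cup _ _ _ _ _ _ hp]
  simp only [S.step_foot _ _ _ _ _ _ _ hp, S.step_cap _ _ _ _ _ _ _ hp]
  cases h : τ t with
  | none =>
    rw [hf h]
    simp [box, Finset.sum_product, Finset.mul_sum]
  | some c =>
    have := S.sum_box_color c (hτ c h) fun x => f (Function.update τ t (some x.1)) (p ++ r)
    have e : Function.update τ t (some c) = τ := by rw [← h, Function.update_eq_self]
    simp [e] at this
    simpa [eq_comm] using this

theorem transfer_tied_vertical (i t : ℕ) (f : StateFun R) (τ : ℕ → Option ℕ) (p r : List Label)
    (x y : Label) (hp : p.length = i) :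
    S.transfer [foot t i, foot t (i + 1)] f τ (p ++ x :: y :: r) =
      if (τ t = none ∨ τ t = some x.1) ∧ x.1 = y.1 then
        f (Function.update τ t (some x.1)) (p ++ x :: y :: r) else 0 := by
  have h := fun τ => S.step_foot t (i + 1) f τ (p ++ [x]) r y (by simp [hp])
  simp only [List.append_assoc, List.cons_append, List.nil_append] at h
  simp only [transfer_cons, transfer_nil]
  rw [S.step_foot _ _ _ _ _ _ _ hp, h]
  by_cases h1 : τ t = none ∨ τ t = some x.1
  · by_cases h2 : x.1 = y.1 <;> simp [h1, h2]
  · simp [h1]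

theorem transfer_tied_crossing (i t : ℕ) (o : Bool) (f : StateFun R) (τ : ℕ → Option ℕ)
    (p r : List Label) (x y : Label) (hp : p.length = i) (hx : x ∈ S.box) (hy : y ∈ S.box) :
    S.transfer [foot t i, foot t (i + 1), cross i o] f τ (p ++ x :: y :: r) =
      if (τ t = none ∨ τ t = some x.1) ∧ x.1 = y.1 then
        S.vert o * f (Function.update τ t (some x.1)) (p ++ x :: y :: r) + S.vert (!o) *
          if x = y then ∑ j ∈ Finset.range S.size,
            f (Function.update τ t (some x.1)) (p ++ (x.1, j) :: (x.1, j) :: r) else 0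
      else 0 := by
  refine (S.transfer_tied_vertical i t (S.step (cross i o) f) τ p r x y hp).trans ?_
  split_ifs with h1 <;> simp_all [S.step_cross_same i o f _ p r]

theorem transfer_tied_horizontal (i t : ℕ) (f : StateFun R) (τ : ℕ → Option ℕ) (p r : List Label)
    (x y : Label) (hp : p.length = i) (hx : x ∈ S.box) :
    S.transfer [foot t i, cap i, cup i (), foot t i] f τ (p ++ x :: y :: r) =
      if (τ t = none ∨ τ t = some x.1) ∧ x = y then
        ∑ j ∈ Finset.range S.size,
          f (Function.update τ t (some x.1)) (p ++ (x.1, j) :: (x.1, j) :: r) else 0 := by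
  simp only [transfer_cons, transfer_nil]
  rw [S.step_foot _ _ _ _ _ _ _ hp, S.step_cap _ _ _ _ _ _ _ hp, S.step_cup _ _ _ _ _ _ hp]
  simp only [S.step_foot _ _ _ _ _ _ _ hp]
  have := S.sum_box_color x.1 (S.mem_box.1 hx).1 fun u =>
    f (Function.update τ t (some x.1)) (p ++ u :: u :: r)
  rw [← this]
  by_cases h1 : τ t = none ∨ τ t = some x.1
  · by_cases h2 : x = y
    · subst h2
      rw [if_pos h1, if_pos rfl, if_pos ⟨h1, rfl⟩]
      simp only [Function.update_self, reduceCtorEq, false_or, Option.some.injEq,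
        Function.update_idem]
      refine Finset.sum_congr rfl fun u _ => ?_
      by_cases h3 : u.1 = x.1
      · simp [h3]
      · simp [h3, Ne.symm h3]
    · simp [h2]
  · simp [h1]

/-! ### The rules of the bracket for the partition function -/

theorem partitionFn_middle (a x b : Word Unit) :
    S.partitionFn (a ++ x ++ b) =
      S.transfer a (S.transfer x (S.transfer b vacuum)) (fun _ => none) [] := by
  simp only [partitionFn, transfer_append]

theorem partitionFn_circle (D : UnorientedDiagram) (h : D.word = [cup 0 (), cap 0]) :
    S.partitionFn D.word = S.colors * S.size := by
  rw [h, partitionFn, S.transfer_circle 0 _ _ _ le_rfl, vacuum, if_pos rfl, mul_one]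

theorem run_middle {a x b : Word Unit} {D : UnorientedDiagram} (hD : D.word = a ++ x ++ b) :
    ∃ u v, Word.run a (strands []) = some u ∧ Word.run x u = some v ∧ Word.run b v = some [] := by
  have h := D.closed
  rw [hD] at h
  obtain ⟨v, h, hb⟩ := Word.run_append_eq_some.1 h
  obtain ⟨u, ha, hx⟩ := Word.run_append_eq_some.1 h
  exact ⟨u, v, ha, hx, hb⟩

theorem le_length_of_run_piece {P : Piece Unit} {i : ℕ} {w : Word Unit} {u v : List Unit}
    (h : Word.run (.piece P i :: w) u = some v) : i + P.ins ≤ u.length := by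
  obtain ⟨m, hm, -⟩ := Word.run_cons_eq_some.1 h
  exact (Letter.act_piece_length _ _ _ _ hm).1

theorem partitionFn_union (a b : Word Unit) (i : ℕ) (D E : UnorientedDiagram)
    (hD : D.word = a ++ b) (hE : E.word = a ++ [cup i (), cap i] ++ b) :
    S.partitionFn E.word = S.colors * S.size * S.partitionFn D.word := by
  obtain ⟨u, v, ha, hx, hb⟩ := run_middle hE
  rw [hE, partitionFn_middle, hD, partitionFn, transfer_append, ← transfer_const_mul]
  refine S.transfer_congr a _ _ _ _ u ha (by simp) fun τ l hl _ _ => ?_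
  subst hl
  have := le_length_of_run_piece hx
  rw [S.transfer_circle i _ _ _ (by simpa [Piece.ins] using this)]

theorem partitionFn_tiedUnion (a b : Word Unit) (i t j : ℕ) (D E : UnorientedDiagram)
    (ht : foot t j ∈ a ++ b) (hD : D.word = a ++ b)
    (hE : E.word = a ++ [cup i (), foot t i, cap i] ++ b) :
    S.partitionFn E.word = S.size * S.partitionFn D.word := by
  obtain ⟨u, v, ha, hx, hb⟩ := run_middle hE
  obtain ⟨u', ha', hb'⟩ := Word.run_append_eq_some.1 (hD ▸ D.closed)
  obtain rfl : u = u' := Option.some.inj (ha.symm.trans ha')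
  rw [hE, partitionFn_middle, hD, partitionFn, transfer_append, ← transfer_const_mul]
  refine S.transfer_congr a _ _ _ _ u ha (by simp) fun τ l hl hbox hτ => ?_
  subst hl
  have := le_length_of_run_piece hx
  refine S.transfer_tied_circle i t _ τ l (by simpa [Piece.ins] using this)
    (hτ.2 (by simp) t) fun h => ?_
  refine S.transfer_eq_sum_update b _ τ l t j [] hb' hbox ?_ h
  -- If `t` is still uncoloured above `a`, its other end lies in `b`.
  rcases List.mem_append.1 ht with ht | ht
  · exact absurd ht (((hτ.1 t).1 h).2 j)
  · exact ht

/-- The tie leaves only equal colours at the crossing, whose weight is there the Kauffman expansion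
itself. -/
theorem partitionFn_tiedCrossing (a b : Word Unit) (i t : ℕ) (D E F : UnorientedDiagram)
    (hD : D.word = a ++ [foot t i, foot t (i + 1), cross i true] ++ b)
    (hE : E.word = a ++ [foot t i, foot t (i + 1)] ++ b)
    (hF : F.word = a ++ [foot t i, cap i, cup i (), foot t i] ++ b) :
    S.partitionFn D.word = S.vert true * S.partitionFn E.word +
      S.vert false * S.partitionFn F.word := by
  obtain ⟨u, v, ha, hx, hb⟩ := run_middle hE
  rw [hD, hE, hF, partitionFn_middle, partitionFn_middle, partitionFn_middle, ← transfer_linear]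
  refine S.transfer_congr a _ _ _ _ u ha (by simp) fun τ l hl hbox hτ => ?_
  subst hl
  obtain ⟨m, hm, hx⟩ := Word.run_cons_eq_some.1 hx
  obtain ⟨-, rfl⟩ := Letter.act_foot _ _ _ _ hm
  obtain ⟨m, hm, hx⟩ := Word.run_cons_eq_some.1 hx
  have hi := (Letter.act_foot _ _ _ _ hm).1
  simp only [List.length_map] at hi
  obtain ⟨p, x, y, r, rfl, hp⟩ := exists_split_two hi
  have hx : x ∈ S.box := hbox x (by simp)
  have hy : y ∈ S.box := hbox y (by simp)
  rw [S.transfer_tied_crossing _ _ _ _ _ _ _ _ _ hp hx hy,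
    S.transfer_tied_vertical _ _ _ _ _ _ _ _ hp, S.transfer_tied_horizontal _ _ _ _ _ _ _ _ hp hx]
  by_cases h1 : τ t = none ∨ τ t = some x.1
  · by_cases h2 : x = y
    · subst h2
      simp [h1]
    · simp only [h1, h2, true_and, if_false, mul_zero, add_zero]
      split_ifs <;> simp
  · simp [h1]

/-- For different colours the signs of the two crossings are opposite, and the tied smoothings
vanish. For equal colours the two Kauffman expansions add up. Since `t` is fresh, the colour it
records in the smoothings has no effect on `b`. -/
theorem partitionFn_skein (a b : Word Unit) (i t : ℕ) (ht : Fresh t (a ++ b))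
    (D D' E F : UnorientedDiagram)
    (hD : D.word = a ++ [cross i true] ++ b)
    (hD' : D'.word = a ++ [cross i false] ++ b)
    (hE : E.word = a ++ [foot t i, foot t (i + 1)] ++ b)
    (hF : F.word = a ++ [foot t i, cap i, cup i (), foot t i] ++ b) :
    S.partitionFn D.word + S.partitionFn D'.word =
      (S.vert true + S.vert false) * (S.partitionFn E.word + S.partitionFn F.word) := by
  obtain ⟨u, v, ha, hx, hb⟩ := run_middle hD
  have h1 : ∀ A B : StateFun R, S.transfer a A (fun _ => none) [] +
      S.transfer a B (fun _ => none) [] =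
        S.transfer a (fun τ l => 1 * A τ l + 1 * B τ l) (fun _ => none) [] := by
    intro A B
    rw [transfer_linear, one_mul, one_mul]
  rw [hD, hD', hE, hF, partitionFn_middle, partitionFn_middle, partitionFn_middle,
    partitionFn_middle, h1, h1, ← transfer_const_mul]
  refine S.transfer_congr a _ _ _ _ u ha (by simp) fun τ l hl hbox hτ => ?_
  subst hl
  have hi := le_length_of_run_piece hx
  simp only [List.length_map, Piece.ins] at hi
  obtain ⟨p, x, y, r, rfl, hp⟩ := exists_split_two hi
  have hx : x ∈ S.box := hbox x (by simp)
  have hy : y ∈ S.box := hbox y (by simp)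
  have hτt : τ t = none := (hτ.1 t).2 ⟨rfl, fun i hi => ht i (by simp [hi])⟩
  have hup : ∀ l c, S.transfer b vacuum (Function.update τ t c) l = S.transfer b vacuum τ l :=
    fun l c => S.transfer_update_of_fresh b _ τ l t c (fun i hi => ht i (by simp [hi]))
      fun _ _ => rfl
  rw [S.transfer_tied_vertical _ _ _ _ _ _ _ _ hp, S.transfer_tied_horizontal _ _ _ _ _ _ _ _ hp hx]
  simp only [hτt, hup, true_or, true_and, transfer_cons, transfer_nil]
  by_cases hxy : x.1 = y.1
  · rw [S.step_cross_same _ _ _ _ _ _ _ _ hp hx hy hxy,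
      S.step_cross_same _ _ _ _ _ _ _ _ hp hx hy hxy, if_pos hxy]
    simp only [Bool.not_true, Bool.not_false]
    ring
  · have hne : x ≠ y := fun h => hxy (by rw [h])
    rw [S.step_cross_ne _ _ _ _ _ _ _ _ hp hx hy hxy, S.step_cross_ne _ _ _ _ _ _ _ _ hp hx hy hxy,
      if_neg hxy, if_neg hne]
    have : crossSign true x.1 y.1 + crossSign false x.1 y.1 = 0 := by
      by_cases h : y.1 < x.1 <;> simp [crossSign, h]
    have h' := congrArg (Int.cast : ℤ → R) this
    push_cast at h'
    linear_combination S.transfer b vacuum τ (p ++ y :: x :: r) * h'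

end VertexModel

/-! ### The interpolated bracket -/

open VertexModel

/-- The bracket polynomial that is interpolated by the partition functions. -/
noncomputable def tiedBracket (D : UnorientedDiagram) : BracketRing :=
  (exists_partitionFn_eq (R := ℂ) D).choose

theorem tiedBracket_spec (D : UnorientedDiagram) : Eventually fun S : VertexModel ℂ =>
    S.partitionFn D.word = S.colors * S.size * S.eval (tiedBracket D) :=
  (exists_partitionFn_eq (R := ℂ) D).choose_spec

theorem eq_of_eventually_eval (P Q : BracketRing)
    (h : Eventually fun S : VertexModel ℂ =>
      (S.colors * S.size : ℂ) * S.eval P = S.colors * S.size * S.eval Q) : P = Q := by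
  obtain ⟨K, hK⟩ := h
  rw [← sub_eq_zero]
  refine eq_zero_of_eval_complexModel _ (max K 1) fun N M hN hM => ?_
  have := hK (complexModel N M) (le_trans (le_max_left _ _) hN) (le_trans (le_max_left _ _) hM)
  have h0 : ((complexModel N M).colors * (complexModel N M).size : ℂ) ≠ 0 := by
    have h1 : N ≠ 0 := by omega
    have h2 : M ≠ 0 := by omega
    exact_mod_cast mul_ne_zero h1 h2
  rw [map_sub, sub_eq_zero]
  exact mul_left_cancel₀ h0 this

/-- Each rule is the corresponding identity of partition functions, valid in all large models, after
division by the common factor `colors * size`, the value of the circle. This division normalizes the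
circle to $1$. -/
theorem isTiedBracket_tiedBracket : IsTiedBracket tiedBracket where
  circle D h := by
    refine eq_of_eventually_eval _ _ ((tiedBracket_spec D).mono fun S hS => ?_)
    rw [← hS, S.partitionFn_circle D h, map_one, mul_one]
  union a b i D E hD hE := by
    refine eq_of_eventually_eval _ _
      (((tiedBracket_spec D).and (tiedBracket_spec E)).mono fun S hS => ?_)
    rw [map_mul, eval_varC, ← hS.2, S.partitionFn_union a b i D E hD hE, hS.1]
  tiedUnion a b i t j D E ht hD hE := by
    refine eq_of_eventually_eval _ _
      (((tiedBracket_spec D).and (tiedBracket_spec E)).mono fun S hS => ?_)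
    rw [map_mul, ← hS.2, S.partitionFn_tiedUnion a b i t j D E ht hD hE, hS.1, ← loopValue,
      eval_loopValue]
    ring
  regular D E h := by
    refine eq_of_eventually_eval _ _
      (((tiedBracket_spec D).and (tiedBracket_spec E)).mono fun S hS => ?_)
    rw [← hS.1, ← hS.2, S.partitionFn_regular h]
  tiedCrossing a b i t _ D E F hD hE hF := by
    refine eq_of_eventually_eval _ _ (((tiedBracket_spec D).and
      ((tiedBracket_spec E).and (tiedBracket_spec F))).mono fun S hS => ?_)
    have h := S.partitionFn_tiedCrossing a b i t D E F hD hE hF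
    rw [hS.1, hS.2.1, hS.2.2] at h
    rw [h, map_add, map_mul, map_mul, eval_varA, eval_inv_varA]
    simp only [vert, if_true, Bool.false_eq_true, if_false]
    ring
  skein a b i t ht D D' E F hD hD' hE hF := by
    refine eq_of_eventually_eval _ _ (((tiedBracket_spec D).and ((tiedBracket_spec D').and
      ((tiedBracket_spec E).and (tiedBracket_spec F)))).mono fun S hS => ?_)
    have h := S.partitionFn_skein a b i t ht D D' E F hD hD' hE hF
    rw [hS.1, hS.2.1, hS.2.2.1, hS.2.2.2, ← mul_add] at h
    rw [map_add, h, map_mul, map_add, map_add, eval_varA, eval_inv_varA]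
    simp only [vert, if_true, Bool.false_eq_true, if_false]
    ring

/-! ### Ties on one component -/

section TieMoves

variable {α : Type}

theorem Word.eraseTies_append (a b : Word α) :
    Word.eraseTies (a ++ b) = a.eraseTies ++ b.eraseTies := by
  induction a with
  | nil => rfl
  | cons L a ih => rcases L with ⟨P, i⟩ | ⟨t, i⟩ <;> simp [Word.eraseTies, ih]

theorem Word.feet_append (a b : Word α) (k : ℕ) :
    Word.feet k (a ++ b) = Word.feet k a ++ Word.feet (k + a.eraseTies.length) b := by
  induction a generalizing k with
  | nil => rfl
  | cons L a ih =>
    rcases L with ⟨P, i⟩ | ⟨t, i⟩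
    · simp [Word.feet, Word.eraseTies, ih, Nat.add_assoc, Nat.add_comm 1]
    · simp [Word.feet, Word.eraseTies, ih]

theorem Word.exists_foot_of_mem_feet (w : Word α) (k t : ℕ) (p : ℕ × ℕ)
    (h : (t, p) ∈ Word.feet k w) : ∃ i, foot t i ∈ w := by
  induction w generalizing k with
  | nil => simp [Word.feet] at h
  | cons L w ih =>
    rcases L with ⟨P, i⟩ | ⟨s, i⟩
    · obtain ⟨j, hj⟩ := ih _ h
      exact ⟨j, by simp [hj]⟩
    · simp only [Word.feet, List.mem_cons, Prod.mk.injEq] at h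
      rcases h with ⟨rfl, -⟩ | h
      · exact ⟨i, by simp [foot]⟩
      · obtain ⟨j, hj⟩ := ih _ h
        exact ⟨j, by simp [hj]⟩

theorem adjacent_eraseTies_iff (w : Word α) (k : ℕ) (p q : ℕ × ℕ) :
    Adjacent k w.eraseTies p q ↔ Adjacent k w p q := by
  induction w generalizing k with
  | nil => rfl
  | cons L w ih =>
    rcases L with ⟨P, i⟩ | ⟨t, i⟩
    · simp only [Word.eraseTies]
      constructor
      · intro h
        cases h with
        | left _ _ _ _ j hj => exact .left _ _ _ _ j hj
        | right _ _ _ _ j hj => exact .right _ _ _ _ j hj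
        | cup => exact .cup _ _ _ _
        | cap => exact .cap _ _ _
        | crossLeft => exact .crossLeft _ _ _ _
        | crossRight => exact .crossRight _ _ _ _
        | afterPiece _ _ _ _ _ _ h => exact .afterPiece _ _ _ _ _ _ ((ih _).1 h)
      · intro h
        cases h with
        | left _ _ _ _ j hj => exact .left _ _ _ _ j hj
        | right _ _ _ _ j hj => exact .right _ _ _ _ j hj
        | cup => exact .cup _ _ _ _
        | cap => exact .cap _ _ _
        | crossLeft => exact .crossLeft _ _ _ _
        | crossRight => exact .crossRight _ _ _ _
        | afterPiece _ _ _ _ _ _ h => exact .afterPiece _ _ _ _ _ _ ((ih _).2 h)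
    · simp only [Word.eraseTies, ih]
      constructor
      · exact .afterFoot _ _ _ _ _ _
      · intro h
        cases h with
        | afterFoot _ _ _ _ _ _ h => exact h

theorem Adjacent.append_right {k : ℕ} {w : Word α} {p q : ℕ × ℕ} (h : Adjacent k w p q)
    (b : Word α) : Adjacent k (w ++ b) p q := by
  induction h with
  | left _ _ _ _ j hj => exact .left _ _ _ _ j hj
  | right _ _ _ _ j hj => exact .right _ _ _ _ j hj
  | cup => exact .cup _ _ _ _
  | cap => exact .cap _ _ _
  | crossLeft => exact .crossLeft _ _ _ _
  | crossRight => exact .crossRight _ _ _ _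
  | afterPiece _ _ _ _ _ _ _ ih => exact .afterPiece _ _ _ _ _ _ ih
  | afterFoot _ _ _ _ _ _ _ ih => exact .afterFoot _ _ _ _ _ _ ih

theorem Adjacent.append_left {k : ℕ} (a : Word α) {w : Word α} {p q : ℕ × ℕ}
    (h : Adjacent (k + a.eraseTies.length) w p q) : Adjacent k (a ++ w) p q := by
  induction a generalizing k with
  | nil => exact h
  | cons L a ih =>
    rcases L with ⟨P, i⟩ | ⟨t, i⟩
    · refine .afterPiece _ _ _ _ _ _ (ih ?_)
      rwa [Word.eraseTies, List.length_cons, Nat.add_comm (Word.eraseTies a).length, ← Nat.add_assoc] at h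
    · exact .afterFoot _ _ _ _ _ _ (ih h)

theorem Adjacent.middle {a x : Word α} {p q : ℕ × ℕ} (h : Adjacent a.eraseTies.length x p q)
    (b : Word α) : Word.tiePartition (a ++ x ++ b) p q := by
  refine .rel _ _ (.inl ((Adjacent.append_left a ?_).append_right b))
  rwa [Nat.zero_add]

theorem tiePartition_of_feet {a x : Word α} (b : Word α) {t : ℕ} {p q : ℕ × ℕ}
    (hp : (t, p) ∈ Word.feet a.eraseTies.length x) (hq : (t, q) ∈ Word.feet a.eraseTies.length x) :
    Word.tiePartition (a ++ x ++ b) p q := by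
  refine .rel _ _ (.inr ⟨t, ?_, ?_⟩) <;> rw [Word.feet_append, Word.feet_append, Nat.zero_add] <;>
    simp [*]

/-- Changes of a tie `t` that has no ends elsewhere. -/
theorem tieMove_of_fresh (a x y b : Word α) (t : ℕ) (ht : Fresh t (a ++ b))
    (hxy : x.eraseTies = y.eraseTies)
    (hx : ∀ f ∈ Word.feet a.eraseTies.length x, f.1 = t)
    (hy : ∀ f ∈ Word.feet a.eraseTies.length y, f.1 = t)
    (hx' : ∀ p q, (t, p) ∈ Word.feet a.eraseTies.length x → (t, q) ∈ Word.feet a.eraseTies.length x →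
      Word.tiePartition (a ++ y ++ b) p q)
    (hy' : ∀ p q, (t, p) ∈ Word.feet a.eraseTies.length y → (t, q) ∈ Word.feet a.eraseTies.length y →
      Word.tiePartition (a ++ x ++ b) p q) : TieMove (a ++ x ++ b) (a ++ y ++ b) := by
  -- One inclusion between the partitions; the situation is symmetric in `x` and `y`.
  have key : ∀ x y : Word α, x.eraseTies = y.eraseTies →
      (∀ f ∈ Word.feet a.eraseTies.length x, f.1 = t) →
      (∀ p q, (t, p) ∈ Word.feet a.eraseTies.length x → (t, q) ∈ Word.feet a.eraseTies.length x →
        Word.tiePartition (a ++ y ++ b) p q) →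
      ∀ p q, Word.tiePartition (a ++ x ++ b) p q → Word.tiePartition (a ++ y ++ b) p q := by
    intro x y hxy hx hx' p q h
    induction h with
    | refl p => exact .refl p
    | symm p q _ ih => exact .symm _ _ ih
    | trans p q r _ _ ih1 ih2 => exact .trans _ _ _ ih1 ih2
    | rel p q h =>
      rcases h with h | ⟨s, hp, hq⟩
      · refine .rel _ _ (.inl ?_)
        rw [← adjacent_eraseTies_iff] at h ⊢
        simpa only [Word.eraseTies_append, hxy] using h
      · by_cases hs : s = t
        · subst hs
          have hin : ∀ p, (s, p) ∈ Word.feet 0 (a ++ x ++ b) →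
              (s, p) ∈ Word.feet a.eraseTies.length x := by
            intro p hp
            rw [Word.feet_append, Word.feet_append, Nat.zero_add] at hp
            simp only [List.mem_append] at hp
            rcases hp with (hp | hp) | hp
            · obtain ⟨i, hi⟩ := Word.exists_foot_of_mem_feet _ _ _ _ hp
              exact absurd (List.mem_append_left b hi) (ht i)
            · exact hp
            · obtain ⟨i, hi⟩ := Word.exists_foot_of_mem_feet _ _ _ _ hp
              exact absurd (List.mem_append_right a hi) (ht i)
          exact hx' p q (hin p hp) (hin q hq)
        · have hin : ∀ p, (s, p) ∈ Word.feet 0 (a ++ x ++ b) →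
              (s, p) ∈ Word.feet 0 (a ++ y ++ b) := by
            intro p hp
            rw [Word.feet_append, Word.feet_append, Nat.zero_add] at hp ⊢
            simp only [List.mem_append, Word.eraseTies_append, hxy] at hp ⊢
            rcases hp with (hp | hp) | hp
            · exact .inl (.inl hp)
            · exact absurd (hx _ hp) hs
            · exact .inr hp
          exact .rel _ _ (.inr ⟨s, hin p hp, hin q hq⟩)
  refine ⟨by simp only [Word.eraseTies_append, hxy], ?_⟩
  ext p q
  exact ⟨key x y hxy hx hx' p q, key y x hxy.symm hy hy' p q⟩

theorem exists_fresh (w : Word α) : ∃ t, Fresh t w := by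
  suffices ∃ n, ∀ t, n ≤ t → Fresh t w by
    obtain ⟨n, hn⟩ := this
    exact ⟨n, hn n le_rfl⟩
  induction w with
  | nil => exact ⟨0, fun t _ i => by simp⟩
  | cons L w ih =>
    obtain ⟨n, hn⟩ := ih
    rcases L with ⟨P, i⟩ | ⟨s, i⟩
    · exact ⟨n, fun t ht i => by simpa [foot] using hn t ht i⟩
    · refine ⟨max n (s + 1), fun t ht j => ?_⟩
      have h1 := hn t (by omega) j
      have h2 : t ≠ s := by omega
      simp only [foot, List.mem_cons, Letter.foot.injEq, not_or] at h1 ⊢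
      exact ⟨fun h => h2 h.1, h1⟩

end TieMoves

/-! ### Removal of curls -/

theorem run_cup_replicate (w : Word Unit) (i n : ℕ) (h : i ≤ n) :
    Word.run (cup i () :: w) (List.replicate n ()) = Word.run w (List.replicate (n + 2) ()) := by
  rw [Word.run, Letter.act_piece_unit _ _ _ (List.replicate (n + 2) ()) (by simpa [Piece.ins])
    (by simp [Piece.ins, Piece.outs])]
  rfl

theorem run_cap_replicate (w : Word Unit) (i n : ℕ) (h : i ≤ n) :
    Word.run (cap i :: w) (List.replicate (n + 2) ()) = Word.run w (List.replicate n ()) := by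
  rw [Word.run, Letter.act_piece_unit _ _ _ (List.replicate n ()) (by simpa [Piece.ins])
    (by simp [Piece.ins, Piece.outs])]
  rfl

theorem run_cross_replicate (w : Word Unit) (i n : ℕ) (o : Bool) (h : i + 2 ≤ n) :
    Word.run (cross i o :: w) (List.replicate n ()) = Word.run w (List.replicate n ()) := by
  rw [Word.run, Letter.act_piece_unit _ _ _ (List.replicate n ()) (by simpa [Piece.ins])
    (by simp [Piece.ins, Piece.outs])]
  rfl

theorem run_foot_replicate (w : Word Unit) (t i n : ℕ) (h : i < n) :
    Word.run (foot t i :: w) (List.replicate n ()) = Word.run w (List.replicate n ()) := by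
  rw [Word.run, Letter.act_foot_unit _ _ _ (by simpa)]
  rfl

theorem unit_list_eq_replicate (u : List Unit) : u = List.replicate u.length () :=
  unit_list_ext (by simp)

theorem exists_diagram_middle (a x b : Word Unit) (n m : ℕ)
    (ha : Word.run a [] = some (List.replicate n ()))
    (hx : Word.run x (List.replicate n ()) = some (List.replicate m ()))
    (hb : Word.run b (List.replicate m ()) = some []) (hne : x ≠ []) :
    ∃ D : UnorientedDiagram, D.word = a ++ x ++ b :=
  ⟨⟨a ++ x ++ b, Word.run_append_eq_some.2 ⟨_, Word.run_append_eq_some.2 ⟨_, ha, hx⟩, hb⟩,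
    by simp [hne]⟩, rfl⟩

theorem exists_run_of_diagram_append {a b : Word Unit} {D : UnorientedDiagram}
    (hD : D.word = a ++ b) : ∃ n, Word.run a [] = some (List.replicate n ()) ∧
      Word.run b (List.replicate n ()) = some [] := by
  have h := D.closed
  rw [hD] at h
  obtain ⟨u, ha, hb⟩ := Word.run_append_eq_some.1 h
  exact ⟨u.length, by rw [ha, ← unit_list_eq_replicate], by rw [← unit_list_eq_replicate, hb]⟩

theorem val_neg_varA_zpow_three :
    (((-varA) ^ (3 : ℤ) : BracketRingˣ) : BracketRing) = -(varA : BracketRing) ^ 3 := by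
  rw [zpow_ofNat, Units.val_pow_eq_pow_val, Units.val_neg]
  ring

theorem val_neg_varA_zpow_neg_three : (((-varA) ^ (-3 : ℤ) : BracketRingˣ) : BracketRing) =
    -((varA⁻¹ : BracketRingˣ) : BracketRing) ^ 3 := by
  have h : (-varA : BracketRingˣ)⁻¹ = -varA⁻¹ := by
    apply inv_eq_of_mul_eq_one_right
    ext1
    rw [Units.val_mul, Units.val_neg, Units.val_neg, neg_mul_neg, Units.mul_inv, Units.val_one]
  rw [zpow_neg, zpow_ofNat, ← inv_pow, h, Units.val_pow_eq_pow_val, Units.val_neg]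
  ring

/-- The brackets of two curls, from the brackets of the smoothings with ties. -/
theorem IsTiedBracket.curl {br : UnorientedDiagram → BracketRing} (hbr : IsTiedBracket br)
    (a b : Word Unit) (i t : ℕ) (ht : Fresh t (a ++ b)) (D D' T E F G : UnorientedDiagram)
    (hD : D.word = a ++ [cross i true] ++ b)
    (hD' : D'.word = a ++ [cross i false] ++ b)
    (hT : T.word = a ++ [foot t i, foot t (i + 1), cross i true] ++ b)
    (hE : E.word = a ++ [foot t i, foot t (i + 1)] ++ b)
    (hF : F.word = a ++ [foot t i, cap i, cup i (), foot t i] ++ b)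
    (hDT : br D = br T)
    (hEG : br E = -((varA ^ 2 : BracketRingˣ) + (varA ^ (-2 : ℤ) : BracketRingˣ) : BracketRing) *
      br G)
    (hFG : br F = br G) :
    br D = ((-varA) ^ (3 : ℤ) : BracketRingˣ) * br G ∧
      br D' = ((-varA) ^ (-3 : ℤ) : BracketRingˣ) * br G := by
  have h1 := hbr.tiedCrossing a b i t ht T E F hT hE hF
  have h2 := hbr.skein a b i t ht D D' E F hD hD' hE hF
  have hA : (varA : BracketRing) * ((varA⁻¹ : BracketRingˣ) : BracketRing) = 1 := varA.mul_inv
  have e2 : ((varA ^ (-2 : ℤ) : BracketRingˣ) : BracketRing) =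
      ((varA⁻¹ : BracketRingˣ) : BracketRing) ^ 2 := by
    rw [zpow_neg, zpow_ofNat, ← inv_pow, Units.val_pow_eq_pow_val]
  rw [e2, Units.val_pow_eq_pow_val] at hEG
  rw [val_neg_varA_zpow_three, val_neg_varA_zpow_neg_three]
  rw [hDT, h1, hEG, hFG] at h2
  rw [hDT, h1, hEG, hFG]
  generalize (varA : BracketRing) = A at *
  generalize ((varA⁻¹ : BracketRingˣ) : BracketRing) = B at *
  constructor
  -- With $AB=1$ the tied crossing gives $-A(A^2+B^2)+B=-A^3$, and the skein rule below gives
  -- $(A+B)(1-A^2-B^2)+A^3=-B^3$.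
  · linear_combination (-B * br G) * hA
  · linear_combination h2 - A * br G * hA

theorem IsTiedBracket.of_tieMove {br : UnorientedDiagram → BracketRing} (hbr : IsTiedBracket br)
    {D E : UnorientedDiagram} (h : TieMove D.word E.word) : br D = br E :=
  hbr.regular D E (.rel _ _ (.inr (.inr (.inl h))))

theorem IsTiedBracket.of_planarMove {br : UnorientedDiagram → BracketRing}
    (hbr : IsTiedBracket br) {D E : UnorientedDiagram} (h : Local PlanarMove D.word E.word) :
    br D = br E :=
  hbr.regular D E (.rel _ _ (.inl h))

theorem fresh_insert {a b x y : Word Unit} {t : ℕ} (h : Fresh t (a ++ b)) (hx : Fresh t x)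
    (hy : Fresh t y) : Fresh t ((a ++ x) ++ (y ++ b)) := by
  intro i hi
  simp only [List.mem_append] at hi
  rcases hi with (hi | hi) | (hi | hi)
  exacts [h i (by simp [hi]), hx i hi, hy i hi, h i (by simp [hi])]

theorem Adjacent.eqvGen_middle {a x y : Word Unit} (b : Word Unit) {p q : ℕ × ℕ}
    (h : Relation.EqvGen (Adjacent (Word.eraseTies a).length x) p q)
    (hxy : x.eraseTies = y.eraseTies) : Word.tiePartition (a ++ y ++ b) p q := by
  induction h with
  | rel p q h =>
    refine Adjacent.middle ?_ b
    rwa [← adjacent_eraseTies_iff, ← hxy, adjacent_eraseTies_iff]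
  | refl p => exact .refl p
  | symm p q _ ih => exact .symm _ _ ih
  | trans p q r _ _ ih1 ih2 => exact .trans _ _ _ ih1 ih2

/-- The path runs once around the loop of the curl. Here `i` is the position of the strand, `c` that
of the minimum and the maximum, `e` that of the crossing; the alternatives are the curls to the
right and to the left. -/
theorem eqvGen_curl_crossing (k i c e : ℕ) (hce : c = i + 1 ∧ e = i ∨ c = i ∧ e = i + 1) (o : Bool) :
    Relation.EqvGen (Adjacent k [cup c (), cross e o, cap c]) (k + 1, e) (k + 1, e + 1) := by
  have h1 : Adjacent k [cup c (), cross e o, cap c] (k + 1, c) (k + 1, c + 1) := .cup _ _ _ _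
  have h2 : Adjacent k [cup c (), cross e o, cap c] (k + 1, e) (k + 2, e + 1) :=
    .afterPiece _ _ _ _ _ _ (.crossLeft _ _ _ _)
  have h3 : Adjacent k [cup c (), cross e o, cap c] (k + 1, e + 1) (k + 2, e) :=
    .afterPiece _ _ _ _ _ _ (.crossRight _ _ _ _)
  have h4 : Adjacent k [cup c (), cross e o, cap c] (k + 2, c) (k + 2, c + 1) :=
    .afterPiece _ _ _ _ _ _ (.afterPiece _ _ _ _ _ _ (.cap _ _ _))
  rcases hce with ⟨rfl, rfl⟩ | ⟨rfl, rfl⟩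
  · have h5 : Adjacent k [cup (e + 1) (), cross e o, cap (e + 1)] (k + 1, e + 2) (k + 2, e + 2) :=
      .afterPiece _ _ _ _ _ _ (.right _ _ _ _ e le_rfl)
    exact .trans _ _ _ (.rel _ _ h2) (.trans _ _ _ (.rel _ _ h4) (.trans _ _ _
      (.symm _ _ (.rel _ _ h5)) (.symm _ _ (.rel _ _ h1))))
  · have h5 : Adjacent k [cup c (), cross (c + 1) o, cap c] (k + 1, c) (k + 2, c) :=
      .afterPiece _ _ _ _ _ _ (.left _ _ _ _ c (Nat.lt_succ_self c))
    exact .trans _ _ _ (.symm _ _ (.rel _ _ h1)) (.trans _ _ _ (.rel _ _ h5) (.trans _ _ _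
      (.rel _ _ h4) (.symm _ _ (.rel _ _ h3))))

/-- The horizontal smoothing of a curl is a single strand, so both ends of its tie lie on one
component. -/
theorem eqvGen_curl_horizontal (k i c e : ℕ) (hce : c = i + 1 ∧ e = i ∨ c = i ∧ e = i + 1) :
    Relation.EqvGen (Adjacent k [cup c (), cap e, cup e (), cap c]) (k + 1, e) (k + 3, e) := by
  have h1 : Adjacent k [cup c (), cap e, cup e (), cap c] (k + 1, c) (k + 1, c + 1) := .cup _ _ _ _
  have h2 : Adjacent k [cup c (), cap e, cup e (), cap c] (k + 1, e) (k + 1, e + 1) :=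
    .afterPiece _ _ _ _ _ _ (.cap _ _ _)
  have h3 : Adjacent k [cup c (), cap e, cup e (), cap c] (k + 3, e) (k + 3, e + 1) :=
    .afterPiece _ _ _ _ _ _ (.afterPiece _ _ _ _ _ _ (.cup _ _ _ _))
  have h4 : Adjacent k [cup c (), cap e, cup e (), cap c] (k + 3, c) (k + 3, c + 1) :=
    .afterPiece _ _ _ _ _ _ (.afterPiece _ _ _ _ _ _ (.afterPiece _ _ _ _ _ _ (.cap _ _ _)))
  rcases hce with ⟨rfl, rfl⟩ | ⟨rfl, rfl⟩
  · have h5 : Adjacent k [cup (e + 1) (), cap e, cup e (), cap (e + 1)] (k + 1, e + 2) (k + 2, e) :=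
      .afterPiece _ _ _ _ _ _ (.right _ _ _ _ e le_rfl)
    have h6 : Adjacent k [cup (e + 1) (), cap e, cup e (), cap (e + 1)] (k + 2, e) (k + 3, e + 2) :=
      .afterPiece _ _ _ _ _ _ (.afterPiece _ _ _ _ _ _ (.right _ _ _ _ e le_rfl))
    exact .trans _ _ _ (.rel _ _ h2) (.trans _ _ _ (.rel _ _ h1) (.trans _ _ _ (.rel _ _ h5)
      (.trans _ _ _ (.rel _ _ h6) (.trans _ _ _ (.symm _ _ (.rel _ _ h4))
        (.symm _ _ (.rel _ _ h3))))))
  · have h5 : Adjacent k [cup c (), cap (c + 1), cup (c + 1) (), cap c] (k + 1, c) (k + 2, c) :=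
      .afterPiece _ _ _ _ _ _ (.left _ _ _ _ c (Nat.lt_succ_self c))
    have h6 : Adjacent k [cup c (), cap (c + 1), cup (c + 1) (), cap c] (k + 2, c) (k + 3, c) :=
      .afterPiece _ _ _ _ _ _ (.afterPiece _ _ _ _ _ _ (.left _ _ _ _ c (Nat.lt_succ_self c)))
    exact .trans _ _ _ (.symm _ _ (.rel _ _ h1)) (.trans _ _ _ (.rel _ _ h5)
      (.trans _ _ _ (.rel _ _ h6) (.rel _ _ h4)))

/-- The two ends of the tie in the vertical smoothing of a curl lie on a circle and on the strand. -/
theorem eqvGen_curl_vertical (k i c e : ℕ) (hce : c = i + 1 ∧ e = i ∨ c = i ∧ e = i + 1) :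
    ∃ e₁ e₂, (e₁ = e ∧ e₂ = e + 1 ∨ e₁ = e + 1 ∧ e₂ = e) ∧
      Relation.EqvGen (Adjacent k [cup c (), cap c]) (k, i) (k + 1, e₁) ∧
      Relation.EqvGen (Adjacent k [cup c (), cap c]) (k + 1, c) (k + 1, e₂) := by
  rcases hce with ⟨rfl, rfl⟩ | ⟨rfl, rfl⟩
  · exact ⟨e, e + 1, .inl ⟨rfl, rfl⟩, .rel _ _ (.left _ _ _ _ e (Nat.lt_succ_self e)), .refl _⟩
  · exact ⟨c + 2, c + 1, .inr ⟨rfl, rfl⟩, .rel _ _ (.right _ _ _ _ c le_rfl),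
      .rel _ _ (.cup _ _ _ _)⟩

theorem Word.run_nil (u : List Unit) : Word.run [] u = some u := rfl

/-- The horizontal smoothing of a curl consists of these two bends, one above the other. -/
theorem curl_planarMove (i c e : ℕ) (hce : c = i + 1 ∧ e = i ∨ c = i ∧ e = i + 1) :
    PlanarMove [cup c (), cap e] [] ∧ PlanarMove [cup e (), cap c] [] := by
  rcases hce with ⟨rfl, rfl⟩ | ⟨rfl, rfl⟩
  · exact ⟨.zagzig _ _, .zigzag _ _⟩
  · exact ⟨.zigzag _ _, .zagzig _ _⟩

/-- The effect of the first Reidemeister move on a tied bracket. -/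
theorem IsTiedBracket.reidemeisterI {br : UnorientedDiagram → BracketRing} (hbr : IsTiedBracket br)
    (a b : Word Unit) (i c e : ℕ) (hce : c = i + 1 ∧ e = i ∨ c = i ∧ e = i + 1)
    (D D' G : UnorientedDiagram)
    (hD : D.word = a ++ [cup c (), cross e true, cap c] ++ b)
    (hD' : D'.word = a ++ [cup c (), cross e false, cap c] ++ b)
    (hG : G.word = a ++ b) :
    br D = ((-varA) ^ (3 : ℤ) : BracketRingˣ) * br G ∧
      br D' = ((-varA) ^ (-3 : ℤ) : BracketRingˣ) * br G := by
  obtain ⟨t, ht⟩ := exists_fresh (a ++ b)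
  obtain ⟨n, ha, hb⟩ := exists_run_of_diagram_append hG
  have hi : i + 1 ≤ n := by
    obtain ⟨m, ha', hm⟩ := exists_run_of_diagram_append (a := a)
      (b := [cup c (), cross e true, cap c] ++ b) (by rw [hD]; simp)
    have := Option.some.inj (ha.symm.trans ha')
    have := congrArg List.length this
    simp only [List.length_replicate] at this
    subst this
    obtain ⟨u, hu, hm⟩ := Word.run_cons_eq_some.1 hm
    obtain ⟨v, hv, hm⟩ := Word.run_cons_eq_some.1 hm
    have h1 := Letter.act_piece_length _ _ _ _ hu
    have h2 := Letter.act_piece_length _ _ _ _ hv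
    simp [Piece.ins, Piece.outs] at h1 h2
    omega
  have hadd : ∀ x : Word Unit, x ≠ [] →
      Word.run x (List.replicate n ()) = some (List.replicate n ()) →
      ∃ D : UnorientedDiagram, D.word = a ++ x ++ b := fun x hx h =>
    exists_diagram_middle a x b n n ha h hb hx
  -- `T` is the curl with a tie at its crossing; `E` and `F` are its smoothings. `F'` is `F` without
  -- the tie and `F''` has one bend less. In `E'` the tie runs from the strand below to the circle,
  -- and `G'` is `G` with a tie that has a single end.
  obtain ⟨T, hT⟩ := hadd [cup c (), foot t e, foot t (e + 1), cross e true, cap c] (by simp) (by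
    simp (disch := omega) only [run_cup_replicate, run_foot_replicate, run_cross_replicate,
      run_cap_replicate, Word.run_nil])
  obtain ⟨E, hE⟩ := hadd [cup c (), foot t e, foot t (e + 1), cap c] (by simp) (by
    simp (disch := omega) only [run_cup_replicate, run_foot_replicate, run_cap_replicate,
      Word.run_nil])
  obtain ⟨F, hF⟩ := hadd [cup c (), foot t e, cap e, cup e (), foot t e, cap c] (by simp) (by
    simp (disch := omega) only [run_cup_replicate, run_foot_replicate, run_cap_replicate,
      Word.run_nil])
  obtain ⟨F', hF'⟩ := hadd [cup c (), cap e, cup e (), cap c] (by simp) (by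
    simp (disch := omega) only [run_cup_replicate, run_cap_replicate, Word.run_nil])
  obtain ⟨F'', hF''⟩ := hadd [cup e (), cap c] (by simp) (by
    simp (disch := omega) only [run_cup_replicate, run_cap_replicate, Word.run_nil])
  obtain ⟨E', hE'⟩ := hadd [foot t i, cup c (), foot t c, cap c] (by simp) (by
    simp (disch := omega) only [run_cup_replicate, run_foot_replicate, run_cap_replicate,
      Word.run_nil])
  obtain ⟨G', hG'⟩ := hadd [foot t i] (by simp) (by
    simp (disch := omega) only [run_foot_replicate, Word.run_nil])
  refine hbr.curl (a ++ [cup c ()]) ([cap c] ++ b) e t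
    (fresh_insert ht (by simp [Fresh]) (by simp [Fresh])) D D' T E F G (by simp [hD]) (by simp [hD'])
    (by simp [hT]) (by simp [hE]) (by simp [hF]) ?_ ?_ ?_
  -- Both strands at the crossing belong to one component, so the tie does not change the partition.
  · refine hbr.of_tieMove ?_
    have h := Adjacent.eqvGen_middle (a := a) (y := [cup c (), cross e true, cap c]) b
      (eqvGen_curl_crossing (Word.eraseTies a).length i c e hce true) rfl
    rw [hD, hT]
    refine tieMove_of_fresh a _ _ b t ht rfl (by simp [Word.feet]) (by simp [Word.feet])
      (by simp [Word.feet]) ?_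
    intro p q hp hq
    simp only [Word.feet, List.mem_cons, Prod.mk.injEq, true_and, List.not_mem_nil, or_false]
      at hp hq
    rcases hp with rfl | rfl <;> rcases hq with rfl | rfl
    exacts [.refl _, h, .symm _ _ h, .refl _]
  · have h1 : br E = br E' := by
      refine hbr.of_tieMove ?_
      obtain ⟨e₁, e₂, he, h1, h2⟩ := eqvGen_curl_vertical (Word.eraseTies a).length i c e hce
      rw [hE, hE']
      refine tieMove_of_fresh a _ _ b t ht rfl (by simp [Word.feet]) (by simp [Word.feet]) ?_ ?_
      · have h1 := Adjacent.eqvGen_middle (y := [foot t i, cup c (), foot t c, cap c]) b h1 rfl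
        have h2 := Adjacent.eqvGen_middle (y := [foot t i, cup c (), foot t c, cap c]) b h2 rfl
        have h3 := tiePartition_of_feet (a := a) (x := [foot t i, cup c (), foot t c, cap c]) b
          (t := t) (p := ((Word.eraseTies a).length, i)) (q := ((Word.eraseTies a).length + 1, c))
          (by simp [Word.feet]) (by simp [Word.feet])
        have h : Word.tiePartition (a ++ [foot t i, cup c (), foot t c, cap c] ++ b)
            ((Word.eraseTies a).length + 1, e₁) ((Word.eraseTies a).length + 1, e₂) :=
          .trans _ _ _ (.symm _ _ h1) (.trans _ _ _ h3 h2)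
        intro p q hp hq
        simp only [Word.feet, List.mem_cons, Prod.mk.injEq, true_and, List.not_mem_nil, or_false]
          at hp hq
        rcases he with ⟨rfl, rfl⟩ | ⟨rfl, rfl⟩ <;> rcases hp with rfl | rfl <;>
          rcases hq with rfl | rfl
        exacts [.refl _, h, .symm _ _ h, .refl _, .refl _, .symm _ _ h, h, .refl _]
      · have h1 := Adjacent.eqvGen_middle (y := [cup c (), foot t e, foot t (e + 1), cap c]) b h1 rfl
        have h2 := Adjacent.eqvGen_middle (y := [cup c (), foot t e, foot t (e + 1), cap c]) b h2 rfl
        have h3 := tiePartition_of_feet (a := a) (x := [cup c (), foot t e, foot t (e + 1), cap c]) b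
          (t := t) (p := ((Word.eraseTies a).length + 1, e₁))
          (q := ((Word.eraseTies a).length + 1, e₂))
          (by rcases he with ⟨rfl, rfl⟩ | ⟨rfl, rfl⟩ <;> simp [Word.feet])
          (by rcases he with ⟨rfl, rfl⟩ | ⟨rfl, rfl⟩ <;> simp [Word.feet])
        have h : Word.tiePartition (a ++ [cup c (), foot t e, foot t (e + 1), cap c] ++ b)
            ((Word.eraseTies a).length, i) ((Word.eraseTies a).length + 1, c) :=
          .trans _ _ _ h1 (.trans _ _ _ h3 (.symm _ _ h2))
        intro p q hp hq
        simp only [Word.feet, List.mem_cons, Prod.mk.injEq, true_and, List.not_mem_nil, or_false]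
          at hp hq
        rcases hp with rfl | rfl <;> rcases hq with rfl | rfl
        exacts [.refl _, h, .symm _ _ h, .refl _]
    -- A tie with one end joins nothing; it provides the end of `t` outside the circle that
    -- `tiedUnion` asks for.
    have h2 : br G = br G' := by
      refine hbr.of_tieMove ?_
      rw [hG, hG']
      have := tieMove_of_fresh a [] [foot t i] b t ht rfl (by simp [Word.feet])
        (by simp [Word.feet]) (by simp [Word.feet]) (by
          intro p q hp hq
          simp only [Word.feet, List.mem_cons, Prod.mk.injEq, true_and, List.not_mem_nil, or_false]
            at hp hq
          rw [hp, hq])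
      simpa using this
    rw [h1, h2]
    exact hbr.tiedUnion (a ++ [foot t i]) b c t i G' E' (by simp) hG' (by simp [hE'])
  · have h1 : br F = br F' := by
      refine hbr.of_tieMove ?_
      have h := Adjacent.eqvGen_middle (a := a) (y := [cup c (), cap e, cup e (), cap c]) b
        (eqvGen_curl_horizontal (Word.eraseTies a).length i c e hce) rfl
      rw [hF, hF']
      refine tieMove_of_fresh a _ _ b t ht rfl (by simp [Word.feet]) (by simp [Word.feet]) ?_
        (by simp [Word.feet])
      intro p q hp hq
      simp only [Word.feet, List.mem_cons, Prod.mk.injEq, true_and, List.not_mem_nil, or_false]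
        at hp hq
      rcases hp with rfl | rfl <;> rcases hq with rfl | rfl
      exacts [.refl _, h, .symm _ _ h, .refl _]
    obtain ⟨m1, m2⟩ := curl_planarMove i c e hce
    have h2 : br F' = br F'' :=
      hbr.of_planarMove ⟨a, [cup e (), cap c] ++ b, _, _, m1, by simp [hF'], by simp [hF'']⟩
    have h3 : br F'' = br G := hbr.of_planarMove ⟨a, b, _, _, m2, hF'', by simp [hG]⟩
    rw [h1, h2, h3]

/-! ### Forgetting orientations -/

theorem Piece.forget_ins (P : Piece Bool) : P.forget.ins = P.ins := by
  cases P <;> rfl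

theorem Piece.forget_outs (P : Piece Bool) : P.forget.outs = P.outs := by
  cases P <;> rfl

theorem Word.forget_shift (w : Word Bool) :
    (Word.shift w).map Letter.forget = Word.shift (w.map Letter.forget) := by
  induction w with
  | nil => rfl
  | cons L w ih => rcases L with ⟨P, i⟩ | ⟨t, i⟩ <;> simp [Word.shift, Letter.forget, ih]

theorem Word.forget_eraseTies (w : Word Bool) :
    (Word.eraseTies w).map Letter.forget = Word.eraseTies (w.map Letter.forget) := by
  induction w with
  | nil => rfl
  | cons L w ih => rcases L with ⟨P, i⟩ | ⟨t, i⟩ <;> simp [Word.eraseTies, Letter.forget, ih]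

theorem Word.forget_feet (w : Word Bool) (k : ℕ) :
    Word.feet k (w.map Letter.forget) = Word.feet k w := by
  induction w generalizing k with
  | nil => rfl
  | cons L w ih => rcases L with ⟨P, i⟩ | ⟨t, i⟩ <;> simp [Word.feet, Letter.forget, ih]

theorem adjacent_forget_iff (w : Word Bool) (k : ℕ) (p q : ℕ × ℕ) :
    Adjacent k (w.map Letter.forget) p q ↔ Adjacent k w p q := by
  constructor
  · intro h
    induction w generalizing k with
    | nil => cases h
    | cons L w ih =>
      rcases L with ⟨_ | _ | _, i⟩ | ⟨t, i⟩
      · rw [List.map_cons, Letter.forget, Piece.forget] at h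
        cases h with
        | left _ _ _ _ j hj => exact .left _ _ _ _ j hj
        | right _ _ _ _ j hj => exact .right _ (.cup _) _ _ j hj
        | cup => exact .cup _ _ _ _
        | afterPiece _ _ _ _ _ _ h => exact .afterPiece _ _ _ _ _ _ (ih _ h)
      · rw [List.map_cons, Letter.forget, Piece.forget] at h
        cases h with
        | left _ _ _ _ j hj => exact .left _ _ _ _ j hj
        | right _ _ _ _ j hj => exact .right _ .cap _ _ j hj
        | cap => exact .cap _ _ _
        | afterPiece _ _ _ _ _ _ h => exact .afterPiece _ _ _ _ _ _ (ih _ h)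
      · rw [List.map_cons, Letter.forget, Piece.forget] at h
        cases h with
        | left _ _ _ _ j hj => exact .left _ _ _ _ j hj
        | right _ _ _ _ j hj => exact .right _ (.cross _) _ _ j hj
        | crossLeft => exact .crossLeft _ _ _ _
        | crossRight => exact .crossRight _ _ _ _
        | afterPiece _ _ _ _ _ _ h => exact .afterPiece _ _ _ _ _ _ (ih _ h)
      · rw [List.map_cons, Letter.forget] at h
        cases h with
        | afterFoot _ _ _ _ _ _ h => exact .afterFoot _ _ _ _ _ _ (ih _ h)
  · intro h
    induction h with
    | left _ _ _ _ j hj => exact .left _ _ _ _ j hj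
    | right k P i w j hj =>
      have := Adjacent.right k P.forget i (w.map Letter.forget) j hj
      rwa [Piece.forget_ins, Piece.forget_outs] at this
    | cup => exact .cup _ _ _ _
    | cap => exact .cap _ _ _
    | crossLeft => exact .crossLeft _ _ _ _
    | crossRight => exact .crossRight _ _ _ _
    | afterPiece _ _ _ _ _ _ _ ih => exact .afterPiece _ _ _ _ _ _ ih
    | afterFoot _ _ _ _ _ _ _ ih => exact .afterFoot _ _ _ _ _ _ ih

theorem Word.forget_tiePartition (w : Word Bool) :
    Word.tiePartition (w.map Letter.forget) = Word.tiePartition w := by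
  simp only [Word.tiePartition, adjacent_forget_iff, Word.forget_feet]

theorem Local.forget {B : Word Bool → Word Bool → Prop} {B' : Word Unit → Word Unit → Prop}
    (h : ∀ x y, B x y → B' (x.map Letter.forget) (y.map Letter.forget)) {w v : Word Bool}
    (hwv : Local B w v) : Local B' (w.map Letter.forget) (v.map Letter.forget) := by
  obtain ⟨a, b, x, y, hxy, rfl, rfl⟩ := hwv
  exact ⟨a.map Letter.forget, b.map Letter.forget, _, _, h x y hxy, by simp, by simp⟩

theorem PlanarMove.forget {x y : Word Bool} (h : PlanarMove x y) :
    PlanarMove (x.map Letter.forget) (y.map Letter.forget) := by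
  rcases h with ⟨P, Q, i, k, hik⟩ | ⟨i, d⟩ | ⟨i, d⟩ | ⟨i, o⟩ | ⟨i, d, o⟩
  · have := PlanarMove.exchange P.forget Q.forget i k hik
    rwa [Piece.forget_ins, Piece.forget_outs] at this
  · exact .zigzag i ()
  · exact .zagzig i ()
  · exact .turnCap i o
  · exact .turnCup i () o

theorem RegularStep.forget {D E : OrientedDiagram} (h : RegularStep D E) :
    RegularStep D.forget E.forget := by
  rcases h with h | h | h | h | h
  · exact .inl (Local.forget (fun _ _ h => h.forget) h)
  · right; left
    change SphereMove (D.word.map Letter.forget) (E.word.map Letter.forget)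
    obtain ⟨d, w, hD, hE⟩ := h.exists_eq
    have := SphereMove.mk () (w.map Letter.forget)
    rw [hD, hE]
    simpa [Letter.forget, Piece.forget, Word.forget_shift] using this
  · right; right; left
    refine ⟨?_, ?_⟩
    · change Word.eraseTies (D.word.map Letter.forget) = Word.eraseTies (E.word.map Letter.forget)
      rw [← Word.forget_eraseTies, ← Word.forget_eraseTies, h.1]
    · change Word.tiePartition (D.word.map Letter.forget) =
        Word.tiePartition (E.word.map Letter.forget)
      rw [Word.forget_tiePartition, Word.forget_tiePartition, h.2]
  · refine .inr (.inr (.inr (.inl (Local.forget (fun x y h => ?_) h))))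
    obtain ⟨i, o⟩ := h
    exact .mk i o
  · refine .inr (.inr (.inr (.inr (Local.forget (fun x y h => ?_) h))))
    obtain ⟨i, o₁, o₂, o₃, ho⟩ := h
    exact .mk i o₁ o₂ o₃ ho

/-! ### The writhe -/

theorem Word.writhe_append (a b : Word Bool) (l m : List Bool) (h : Word.run a l = some m) :
    Word.writhe (a ++ b) l = Word.writhe a l + Word.writhe b m := by
  induction a generalizing l with
  | nil =>
    obtain rfl := Option.some.inj h
    simp [Word.writhe]
  | cons L a ih =>
    obtain ⟨u, hu, hw⟩ := Word.run_cons_eq_some.1 h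
    simp only [List.cons_append, Word.writhe, hu, Option.getD_some, ih u hw]
    ring

theorem writhe_eraseTies (w : Word Bool) (l m : List Bool) (h : Word.run w l = some m) :
    Word.writhe (Word.eraseTies w) l = Word.writhe w l := by
  induction w generalizing l with
  | nil => rfl
  | cons L w ih =>
    obtain ⟨u, hu, hw⟩ := Word.run_cons_eq_some.1 h
    rcases L with ⟨P, i⟩ | ⟨t, i⟩
    · simp only [Word.eraseTies, Word.writhe, hu, Option.getD_some, ih u hw]
    · obtain ⟨-, rfl⟩ := Letter.act_foot _ _ _ _ hu
      simp only [Word.eraseTies, Word.writhe, hu, Option.getD_some, ih _ hw, Letter.sign, zero_add]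

/-! ### Pieces acting on lists of directions -/

theorem act_cup (p r : List Bool) (i : ℕ) (d : Bool) (hp : p.length = i) :
    (cup i d).act (p ++ r) = some (p ++ d :: (!d) :: r) := by
  subst hp
  simp [Letter.act, StrandLabel.rev]

theorem act_cap (p r : List Bool) (x y : Bool) (i : ℕ) (hp : p.length = i) :
    (cap i).act (p ++ x :: y :: r) = if y = !x then some (p ++ r) else none := by
  subst hp
  simp [Letter.act, StrandLabel.rev]

theorem act_cross (p r : List Bool) (x y : Bool) (i : ℕ) (o : Bool) (hp : p.length = i) :
    (cross i o).act (p ++ x :: y :: r) = some (p ++ y :: x :: r) := by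
  subst hp
  simp [Letter.act]

theorem act_cup_succ (p r : List Bool) (x : Bool) (i : ℕ) (d : Bool) (hp : p.length = i) :
    (cup (i + 1) d).act (p ++ x :: r) = some (p ++ x :: d :: (!d) :: r) := by
  simpa using act_cup (p ++ [x]) r (i + 1) d (by simp [hp])

theorem act_cap_succ (p r : List Bool) (w x y : Bool) (i : ℕ) (hp : p.length = i) :
    (cap (i + 1)).act (p ++ w :: x :: y :: r) = if y = !x then some (p ++ w :: r) else none := by
  simpa using act_cap (p ++ [w]) r x y (i + 1) (by simp [hp])

theorem act_cross_succ (p r : List Bool) (w x y : Bool) (i : ℕ) (o : Bool) (hp : p.length = i) :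
    (cross (i + 1) o).act (p ++ w :: x :: y :: r) = some (p ++ w :: y :: x :: r) := by
  simpa using act_cross (p ++ [w]) r x y (i + 1) o (by simp [hp])

theorem sign_cross (p r : List Bool) (x y : Bool) (i : ℕ) (o : Bool) (hp : p.length = i) :
    (cross i o).sign (p ++ x :: y :: r) = if x = y ↔ o = true then 1 else -1 := by
  subst hp
  simp [Letter.sign]

theorem sign_cross_succ (p r : List Bool) (w x y : Bool) (i : ℕ) (o : Bool) (hp : p.length = i) :
    (cross (i + 1) o).sign (p ++ w :: x :: y :: r) = if x = y ↔ o = true then 1 else -1 := by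
  simpa using sign_cross (p ++ [w]) r x y (i + 1) o (by simp [hp])

theorem sign_cup (l : List Bool) (i : ℕ) (d : Bool) : (cup i d).sign l = 0 := rfl

theorem sign_cap (l : List Bool) (i : ℕ) : (cap i : Letter Bool).sign l = 0 := rfl

theorem act_piece_append (P : Piece Bool) (i : ℕ) (p c r : List Bool) (hp : p.length = i)
    (hc : c.length = P.ins) : (Letter.piece P i).act (p ++ (c ++ r)) =
      ((Letter.piece P 0).act c).map fun b => p ++ (b ++ r) := by
  rcases P with d | _ | o
  · obtain rfl := List.length_eq_zero_iff.1 hc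
    rw [List.nil_append, act_cup p r i d hp]
    rfl
  · obtain ⟨x, y, rfl⟩ := List.length_eq_two.1 hc
    have := act_cap [] [] x y 0 rfl
    simp only [List.nil_append] at this
    simp only [List.cons_append, List.nil_append]
    rw [act_cap p r x y i hp, this]
    split_ifs <;> rfl
  · obtain ⟨x, y, rfl⟩ := List.length_eq_two.1 hc
    simp only [List.cons_append, List.nil_append]
    rw [act_cross p r x y i o hp]
    rfl

theorem sign_piece_append (P : Piece Bool) (i : ℕ) (p c r : List Bool) (hp : p.length = i)
    (hc : c.length = P.ins) : (Letter.piece P i).sign (p ++ (c ++ r)) =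
      (Letter.piece P 0).sign c := by
  rcases P with d | _ | o
  · rfl
  · rfl
  · obtain ⟨x, y, rfl⟩ := List.length_eq_two.1 hc
    have := sign_cross [] [] x y 0 o rfl
    simp only [List.nil_append] at this
    simp only [List.cons_append, List.nil_append]
    rw [sign_cross p r x y i o hp, this]

theorem writhe_exchange (P Q : Piece Bool) (i k : ℕ) (hik : i ≤ k) (l m m' : List Bool)
    (h : Word.run [.piece P i, .piece Q (k + P.outs)] l = some m)
    (h' : Word.run [.piece Q (k + P.ins), .piece P i] l = some m') :
    m = m' ∧ Word.writhe [.piece P i, .piece Q (k + P.outs)] l =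
      Word.writhe [.piece Q (k + P.ins), .piece P i] l := by
  have hlen : k + P.ins + Q.ins ≤ l.length := by
    obtain ⟨n, hn, -⟩ := Word.run_cons_eq_some.1 h'
    exact (Letter.act_piece_length _ _ _ _ hn).1
  obtain ⟨p, c, r, rfl, hp, hc⟩ := exists_split_append (i := i) (n := P.ins) (l := l) (by omega)
  obtain ⟨q, c', r, rfl, hq, hc'⟩ := exists_split_append (i := k - i) (n := Q.ins) (l := r) (by
    simp at hlen
    omega)
  have e1 : ∀ b : List Bool, p ++ (b ++ (q ++ (c' ++ r))) = (p ++ b ++ q) ++ (c' ++ r) := by simp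
  have e2 : ∀ b : List Bool, (p ++ c ++ q) ++ (b ++ r) = p ++ (c ++ (q ++ (b ++ r))) := by simp
  have hP := act_piece_append P i p c (q ++ (c' ++ r)) hp hc
  have hQ := act_piece_append Q (k + P.ins) (p ++ c ++ q) c' r (by simp; omega) hc'
  rw [← e1] at hQ
  simp only [Word.run, Word.writhe, hP, hQ] at h h' ⊢
  cases hb : (Letter.piece P 0).act c with
  | none => simp [hb] at h
  | some b =>
    cases hb' : (Letter.piece Q 0).act c' with
    | none => simp [hb'] at h'
    | some b' =>
      have hlb : b.length = P.outs := by
        have := (Letter.act_piece_length _ _ _ _ hb).2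
        omega
      have hQ' := act_piece_append Q (k + P.outs) (p ++ b ++ q) c' r (by simp; omega) hc'
      have hP' := act_piece_append P i p c (q ++ (b' ++ r)) hp hc
      have sP := sign_piece_append P i p c (q ++ (c' ++ r)) hp hc
      have sQ := sign_piece_append Q (k + P.ins) (p ++ c ++ q) c' r (by simp; omega) hc'
      have sQ' := sign_piece_append Q (k + P.outs) (p ++ b ++ q) c' r (by simp; omega) hc'
      have sP' := sign_piece_append P i p c (q ++ (b' ++ r)) hp hc
      simp only [hb, hb', Option.map_some, Option.bind_some, Option.getD_some, e2] at h h' ⊢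
      rw [e1 b, hQ', hb'] at h
      rw [hP', hb] at h'
      rw [e1 b, sQ', sP', sP, e1 c, sQ]
      simp only [Option.map_some, Option.bind_some, Option.some.injEq] at h h'
      refine ⟨?_, by ring⟩
      rw [← h, ← h']
      simp

/-- Turning a crossing changes its type and reverses one of the two strands relative to the
vertical, so its sign is kept. The equality of the directions at the top is included because the
crossings of the word above depend on them. -/
theorem writhe_planarMove {x y : Word Bool} (h : PlanarMove x y) (l m m' : List Bool)
    (hx : Word.run x l = some m) (hy : Word.run y l = some m') :
    m = m' ∧ Word.writhe x l = Word.writhe y l := by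
  rcases h with ⟨P, Q, i, k, hik⟩ | ⟨i, d⟩ | ⟨i, d⟩ | ⟨i, o⟩ | ⟨i, d, o⟩
  · exact writhe_exchange P Q i k hik l m m' hx hy
  · obtain ⟨n, hn, hw⟩ := Word.run_cons_eq_some.1 hx
    obtain ⟨n', hn', hw⟩ := Word.run_cons_eq_some.1 hw
    have h1 := Letter.act_piece_length _ _ _ _ hn
    have h2 := Letter.act_piece_length _ _ _ _ hn'
    simp only [Piece.ins, Piece.outs] at h1 h2
    obtain ⟨p, x, r, rfl, hp⟩ := exists_split_one (i := i) (l := l) (by omega)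
    have a1 := act_cup p (x :: r) i d hp
    have a2 := act_cap_succ p r d (!d) x i hp
    simp only [Word.run, Word.writhe, a1, a2, Option.bind_some, Option.getD_some, sign_cup,
      sign_cap, Option.some.injEq] at hx hy ⊢
    rw [← hy]
    cases d <;> cases x <;> simp_all
  · obtain ⟨n, hn, hw⟩ := Word.run_cons_eq_some.1 hx
    have h1 := Letter.act_piece_length _ _ _ _ hn
    simp only [Piece.ins, Piece.outs] at h1
    obtain ⟨p, x, r, rfl, hp⟩ := exists_split_one (i := i) (l := l) (by omega)
    have a1 := act_cup_succ p r x i d hp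
    have a2 := act_cap p ((!d) :: r) x d i hp
    simp only [Word.run, Word.writhe, a1, a2, Option.bind_some, Option.getD_some, sign_cup,
      sign_cap, Option.some.injEq] at hx hy ⊢
    rw [← hy]
    cases d <;> cases x <;> simp_all
  · obtain ⟨n, hn, hw⟩ := Word.run_cons_eq_some.1 hy
    have h1 := Letter.act_piece_length _ _ _ _ hn
    simp only [Piece.ins, Piece.outs] at h1
    obtain ⟨p, x, y, z, r, rfl, hp⟩ := exists_split_three (i := i) (l := l) (by omega)
    have a1 := act_cross p (z :: r) x y i o hp
    have a2 := act_cap_succ p r y x z i hp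
    have a3 := act_cross_succ p r x y z i (!o) hp
    have a4 := act_cap p (y :: r) x z i hp
    have s1 := sign_cross p (z :: r) x y i o hp
    have s2 := sign_cross_succ p r x y z i (!o) hp
    simp only [Word.run, Word.writhe, a1, a2, a3, a4, s1, s2, Option.bind_some, Option.getD_some,
      sign_cap] at hx hy ⊢
    cases x <;> cases y <;> cases z <;> cases o <;> simp_all
  · obtain ⟨n, hn, hw⟩ := Word.run_cons_eq_some.1 hx
    have h1 := Letter.act_piece_length _ _ _ _ hn
    simp only [Piece.ins, Piece.outs] at h1
    obtain ⟨p, x, r, rfl, hp⟩ := exists_split_one (i := i) (l := l) (by omega)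
    have a1 := act_cup_succ p r x i d hp
    have a2 := act_cross p ((!d) :: r) x d i o hp
    have a3 := act_cup p (x :: r) i d hp
    have a4 := act_cross_succ p r d (!d) x i (!o) hp
    have s1 := sign_cross p ((!d) :: r) x d i o hp
    have s2 := sign_cross_succ p r d (!d) x i (!o) hp
    simp only [Word.run, Word.writhe, a1, a2, a3, a4, s1, s2, Option.bind_some, Option.getD_some,
      sign_cup] at hx hy ⊢
    cases x <;> cases d <;> cases o <;> simp_all

theorem writhe_reidemeisterII {x y : Word Bool} (h : ReidemeisterII x y) (l m m' : List Bool)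
    (hx : Word.run x l = some m) (hy : Word.run y l = some m') :
    m = m' ∧ Word.writhe x l = Word.writhe y l := by
  obtain ⟨i, o⟩ := h
  obtain ⟨n, hn, hw⟩ := Word.run_cons_eq_some.1 hx
  have h1 := Letter.act_piece_length _ _ _ _ hn
  simp only [Piece.ins, Piece.outs] at h1
  obtain ⟨p, x, y, r, rfl, hp⟩ := exists_split_two (i := i) (l := l) (by omega)
  have a1 := act_cross p r x y i o hp
  have a2 := act_cross p r y x i (!o) hp
  have s1 := sign_cross p r x y i o hp
  have s2 := sign_cross p r y x i (!o) hp
  simp only [Word.run, Word.writhe, a1, a2, s1, s2, Option.bind_some, Option.getD_some,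
    Option.some.injEq] at hx hy ⊢
  refine ⟨hx.symm.trans hy, ?_⟩
  cases x <;> cases y <;> cases o <;> simp

/-- The same three pairs of strands cross with the same signs; only the order of the crossings
changes. -/
theorem writhe_reidemeisterIII {x y : Word Bool} (h : ReidemeisterIII x y) (l m m' : List Bool)
    (hx : Word.run x l = some m) (hy : Word.run y l = some m') :
    m = m' ∧ Word.writhe x l = Word.writhe y l := by
  obtain ⟨i, o₁, o₂, o₃, -⟩ := h
  obtain ⟨n, hn, hw⟩ := Word.run_cons_eq_some.1 hy
  have h1 := Letter.act_piece_length _ _ _ _ hn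
  simp only [Piece.ins, Piece.outs] at h1
  obtain ⟨p, x, y, z, r, rfl, hp⟩ := exists_split_three (i := i) (l := l) (by omega)
  have a1 := act_cross p (z :: r) x y i o₁ hp
  have a2 := act_cross_succ p r y x z i o₂ hp
  have a3 := act_cross p (x :: r) y z i o₃ hp
  have a4 := act_cross_succ p r x y z i o₃ hp
  have a5 := act_cross p (y :: r) x z i o₂ hp
  have a6 := act_cross_succ p r z x y i o₁ hp
  have s1 := sign_cross p (z :: r) x y i o₁ hp
  have s2 := sign_cross_succ p r y x z i o₂ hp
  have s3 := sign_cross p (x :: r) y z i o₃ hp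
  have s4 := sign_cross_succ p r x y z i o₃ hp
  have s5 := sign_cross p (y :: r) x z i o₂ hp
  have s6 := sign_cross_succ p r z x y i o₁ hp
  simp only [Word.run, Word.writhe, a1, a2, a3, a4, a5, a6, s1, s2, s3, s4, s5, s6,
    Option.bind_some, Option.getD_some, Option.some.injEq] at hx hy ⊢
  exact ⟨hx.symm.trans hy, by ring⟩

/-- A local move changes the writhe by the change of the writhe of the word that is replaced. -/
theorem writhe_local (a b x y : Word Bool) (c : ℤ) (D E : OrientedDiagram)
    (hD : D.word = a ++ x ++ b) (hE : E.word = a ++ y ++ b)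
    (h : ∀ l m m', Word.run x l = some m → Word.run y l = some m' →
      m = m' ∧ Word.writhe x l = Word.writhe y l + c) : D.writhe = E.writhe + c := by
  have h1 := D.closed
  have h2 := E.closed
  rw [hD] at h1
  rw [hE] at h2
  obtain ⟨m, h1, hb⟩ := Word.run_append_eq_some.1 h1
  obtain ⟨m', h2, hb'⟩ := Word.run_append_eq_some.1 h2
  obtain ⟨l, ha, hx⟩ := Word.run_append_eq_some.1 h1
  obtain ⟨l', ha', hy⟩ := Word.run_append_eq_some.1 h2
  obtain rfl : l = l' := Option.some.inj (ha.symm.trans ha')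
  obtain ⟨rfl, hc⟩ := h l m m' hx hy
  rw [Diagram.writhe, Diagram.writhe, hD, hE, Word.writhe_append _ _ _ _ h1,
    Word.writhe_append _ _ _ _ h2, Word.writhe_append _ _ _ _ ha, Word.writhe_append _ _ _ _ ha, hc]
  ring

theorem writhe_local_eq {B : Word Bool → Word Bool → Prop} (hB : ∀ x y, B x y → ∀ l m m',
    Word.run x l = some m → Word.run y l = some m' → m = m' ∧ Word.writhe x l = Word.writhe y l)
    {D E : OrientedDiagram} (h : Local B D.word E.word) : D.writhe = E.writhe := by
  obtain ⟨a, b, x, y, hxy, hD, hE⟩ := h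
  simpa using writhe_local a b x y 0 D E hD hE (by simpa using hB x y hxy)

theorem Letter.sign_append (L : Letter Bool) (l m r : List Bool) (h : L.act l = some m) :
    L.sign (l ++ r) = L.sign l := by
  rcases L with ⟨P, i⟩ | ⟨t, i⟩
  · obtain ⟨p, c, s, rfl, hp, hc⟩ := exists_split_append (Letter.act_piece_length _ _ _ _ h).1
    rw [show p ++ (c ++ s) ++ r = p ++ (c ++ (s ++ r)) by simp, sign_piece_append P i p c _ hp hc,
      sign_piece_append P i p c _ hp hc]
  · rfl

theorem Word.writhe_concat (w : Word Bool) (l m r : List Bool) (h : Word.run w l = some m) :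
    Word.writhe w (l ++ r) = Word.writhe w l := by
  induction w generalizing l with
  | nil => rfl
  | cons L w ih =>
    obtain ⟨u, hu, hw⟩ := Word.run_cons_eq_some.1 h
    simp only [Word.writhe, hu, L.act_append l u r hu, L.sign_append l u r hu, Option.getD_some,
      ih u hw]

theorem Word.writhe_shift (w : Word Bool) (x : Bool) (l m : List Bool) (h : Word.run w l = some m) :
    Word.writhe (Word.shift w) (x :: l) = Word.writhe w l := by
  induction w generalizing l with
  | nil => rfl
  | cons L w ih =>
    obtain ⟨u, hu, hw⟩ := Word.run_cons_eq_some.1 h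
    have key : ∃ L' : Letter Bool, Word.shift (L :: w) = L' :: Word.shift w ∧
        L'.act (x :: l) = some (x :: u) ∧ L'.sign (x :: l) = L.sign l := by
      rcases L with ⟨P, i⟩ | ⟨t, i⟩
      · refine ⟨_, rfl, ?_, ?_⟩
        · have := Word.run_shift [.piece P i] x l
          simpa [Word.shift, Word.run, hu] using this
        · obtain ⟨p, c, s, rfl, hp, hc⟩ := exists_split_append (Letter.act_piece_length _ _ _ _ hu).1
          rw [sign_piece_append P i p c _ hp hc]
          exact sign_piece_append P (i + 1) (x :: p) c s (by simp [hp]) hc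
      · refine ⟨_, rfl, ?_, rfl⟩
        have := Word.run_shift [.foot t i] x l
        simpa [Word.shift, Word.run, hu] using this
    obtain ⟨L', h1, h2, h3⟩ := key
    rw [h1]
    simp only [Word.writhe, h2, h3, hu, Option.getD_some, ih u hw]

/-- The closing arc takes part in no crossing. In both closures `w` starts on a strand of direction
`!d`, the right leg of one minimum and the left leg of the other, so its crossings have the same
signs. -/
theorem writhe_sphereMove {D E : OrientedDiagram} (h : SphereMove D.word E.word) :
    D.writhe = E.writhe := by
  obtain ⟨d, w, hD, hE⟩ := h.exists_eq
  have a1 : (cup 0 d).act [] = some [d, !d] := act_cup [] [] 0 d rfl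
  have a2 : (cup 0 (!d)).act [] = some [!d, !!d] := act_cup [] [] 0 (!d) rfl
  have hrun : ∃ m, Word.run w [!d] = some m := by
    have := D.closed
    rw [hD, List.cons_append] at this
    obtain ⟨u, hu, hw⟩ := Word.run_cons_eq_some.1 this
    obtain rfl := Option.some.inj (a1.symm.trans hu)
    obtain ⟨v, hw, hv⟩ := Word.run_append_eq_some.1 hw
    rw [Word.run_shift, Option.map_eq_some_iff] at hw
    obtain ⟨m, hm, -⟩ := hw
    exact ⟨m, hm⟩
  obtain ⟨m, hm⟩ := hrun
  have h1 : Word.run (Word.shift w) [d, !d] = some (d :: m) := by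
    rw [Word.run_shift, hm]
    rfl
  have h2 : Word.run w [!d, !!d] = some (m ++ [!!d]) := Word.run_concat w _ _ [!!d] hm
  have h3 : Word.writhe w [!d, !!d] = Word.writhe w [!d] := Word.writhe_concat w _ _ [!!d] hm
  have e : (StrandLabel.rev d) = !d := rfl
  rw [Diagram.writhe, Diagram.writhe, hD, hE, e]
  simp only [List.cons_append, Word.writhe, a1, a2, Option.getD_some, sign_cup]
  rw [Word.writhe_append _ _ _ _ h1, Word.writhe_append _ _ _ _ h2, Word.writhe_shift w _ _ _ hm,
    h3]
  simp [Word.writhe, sign_cap]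

theorem RegularStep.writhe_eq {D E : OrientedDiagram} (h : RegularStep D E) :
    D.writhe = E.writhe := by
  rcases h with h | h | h | h | h
  · exact writhe_local_eq (fun _ _ h => writhe_planarMove h) h
  · exact writhe_sphereMove h
  · rw [Diagram.writhe, Diagram.writhe, ← writhe_eraseTies _ _ _ D.closed,
      ← writhe_eraseTies _ _ _ E.closed, h.1]
  · exact writhe_local_eq (fun _ _ h => writhe_reidemeisterII h) h
  · exact writhe_local_eq (fun _ _ h => writhe_reidemeisterIII h) h

/-! ### Invariance of the polynomial -/

/-- The sign of a crossing of two strands that are directed upwards. -/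
def crossingSign (o : Bool) : ℤ := if o then 1 else -1

/-- The maximum fits only if the strand passes its crossing both times upwards or both times
downwards. So the sign depends on the type of the crossing alone, not on the orientation. -/
theorem writhe_curl (i c e : ℕ) (hce : c = i + 1 ∧ e = i ∨ c = i ∧ e = i + 1) (d o : Bool)
    (l m : List Bool) (h : Word.run [cup c d, cross e o, cap c] l = some m) :
    m = l ∧ Word.writhe [cup c d, cross e o, cap c] l = crossingSign o := by
  obtain ⟨n, hn, hw⟩ := Word.run_cons_eq_some.1 h
  obtain ⟨n', hn', hw⟩ := Word.run_cons_eq_some.1 hw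
  have h1 := Letter.act_piece_length _ _ _ _ hn
  have h2 := Letter.act_piece_length _ _ _ _ hn'
  simp only [Piece.ins, Piece.outs] at h1 h2
  obtain ⟨p, x, r, rfl, hp⟩ := exists_split_one (i := i) (l := l) (by omega)
  rcases hce with ⟨rfl, rfl⟩ | ⟨rfl, rfl⟩
  · have a1 := act_cup_succ p r x e d hp
    have a2 := act_cross p ((!d) :: r) x d e o hp
    have a3 := act_cap_succ p r d x (!d) e hp
    have s1 := sign_cross p ((!d) :: r) x d e o hp
    simp only [Word.run, Word.writhe, a1, a2, a3, s1, Option.bind_some, Option.getD_some,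
      sign_cup, sign_cap] at h ⊢
    cases x <;> cases d <;> cases o <;> simp_all [crossingSign]
  · have a1 := act_cup p (x :: r) c d hp
    have a2 := act_cross_succ p r d (!d) x c o hp
    have a3 := act_cap p ((!d) :: r) d x c hp
    have s1 := sign_cross_succ p r d (!d) x c o hp
    simp only [Word.run, Word.writhe, a1, a2, a3, s1, Option.bind_some, Option.getD_some,
      sign_cup, sign_cap] at h ⊢
    cases x <;> cases d <;> cases o <;> simp_all [crossingSign]

theorem reidemeisterI_eq_curl {x y : Word Bool} (h : ReidemeisterI x y) :
    ∃ i c e d o, (c = i + 1 ∧ e = i ∨ c = i ∧ e = i + 1) ∧ x = [cup c d, cross e o, cap c] ∧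
      y = [] := by
  rcases h with ⟨i, d, o⟩ | ⟨i, d, o⟩
  · exact ⟨i, i + 1, i, d, o, .inl ⟨rfl, rfl⟩, rfl, rfl⟩
  · exact ⟨i, i, i + 1, d, o, .inr ⟨rfl, rfl⟩, rfl, rfl⟩

/-- The diagram with another crossing at the same place. -/
theorem exists_diagram_cross (a b : Word Unit) (i : ℕ) (o o' : Bool) (D : UnorientedDiagram)
    (hD : D.word = a ++ [cross i o] ++ b) :
    ∃ E : UnorientedDiagram, E.word = a ++ [cross i o'] ++ b := by
  have h : Word.run (a ++ [cross i o'] ++ b) [] = some [] := by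
    have := D.closed
    rw [hD] at this
    simpa [Word.run_append, Word.run, Letter.act] using this
  exact ⟨⟨_, h, by simp⟩, rfl⟩

/-- The curl multiplies the bracket by $(-A)^{\pm3}$ and changes the writhe by the same sign, which
the factor $(-A)^{-3w}$ compensates. -/
theorem IsTiedBracket.jonesPoly_reidemeisterI {br : UnorientedDiagram → BracketRing}
    (hbr : IsTiedBracket br) {D E : OrientedDiagram} (h : Local ReidemeisterI D.word E.word) :
    jonesPoly br D = jonesPoly br E := by
  obtain ⟨a, b, x, y, hxy, hD, hE⟩ := h
  obtain ⟨i, c, e, d, o, hce, rfl, rfl⟩ := reidemeisterI_eq_curl hxy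
  have hw : D.writhe = E.writhe + crossingSign o := by
    refine writhe_local a b _ _ _ D E hD hE fun l m m' hx hy => ?_
    obtain ⟨h1, h2⟩ := writhe_curl i c e hce d o l m hx
    obtain rfl := Option.some.inj hy
    exact ⟨h1, by rw [h2]; simp [Word.writhe]⟩
  have hD' : D.forget.word = a.map Letter.forget ++ [cup c (), cross e o, cap c] ++
      b.map Letter.forget := by
    simp [Diagram.forget, hD, Letter.forget, Piece.forget]
  have hE' : E.forget.word = a.map Letter.forget ++ b.map Letter.forget := by
    simp [Diagram.forget, hE]
  have hbrD : br D.forget = ((-varA) ^ (3 * crossingSign o) : BracketRingˣ) * br E.forget := by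
    -- Rule 6 relates the two curls with opposite crossings, so `reidemeisterI` needs the other curl
    -- as well.
    obtain ⟨D', hD''⟩ := exists_diagram_cross (a.map Letter.forget ++ [cup c ()])
      ([cap c] ++ b.map Letter.forget) e o (!o) D.forget (by simp [hD'])
    cases o
    · exact (hbr.reidemeisterI _ _ i c e hce D' D.forget E.forget (by simpa using hD'') hD' hE').2
    · exact (hbr.reidemeisterI _ _ i c e hce D.forget D' E.forget hD' (by simpa using hD'') hE').1
  rw [jonesPoly, jonesPoly, hbrD, hw, ← mul_assoc, ← Units.val_mul, ← zpow_add]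
  congr 3
  ring

theorem IsTiedBracket.jonesPoly_eq {br : UnorientedDiagram → BracketRing} (hbr : IsTiedBracket br)
    {D E : OrientedDiagram} (h : TieIsotopic D E) : jonesPoly br D = jonesPoly br E := by
  induction h with
  | rel D E h =>
    rcases h with h | h
    · rw [jonesPoly, jonesPoly, h.writhe_eq, hbr.regular _ _ (.rel _ _ h.forget)]
    · exact hbr.jonesPoly_reidemeisterI h
  | refl D => rfl
  | symm D E _ ih => exact ih.symm
  | trans D E F _ _ ih1 ih2 => exact ih1.trans ih2

end TiedLink

theorem mainTheorem6 :
    (∃ br : TiedLink.UnorientedDiagram → TiedLink.BracketRing, TiedLink.IsTiedBracket br) ∧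
    ∀ br : TiedLink.UnorientedDiagram → TiedLink.BracketRing, TiedLink.IsTiedBracket br →
      ∀ D E : TiedLink.OrientedDiagram, TiedLink.TieIsotopic D E →
        TiedLink.jonesPoly br D = TiedLink.jonesPoly br E :=
  ⟨⟨_, TiedLink.isTiedBracket_tiedBracket⟩, fun _ hbr _ _ h => hbr.jonesPoly_eq h⟩
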